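/- Let $(K,*)$ be a commutative hypergroup: $K$ is a locally compact Hausdorff space with a bilinear, associative, weakly continuous, positivity-preserving convolution of bounded regular Borel measures such that, for all $x,y\in K$: $\delta_x*\delta_y$ is a probability measure with compact support; $(x,y)\mapsto \operatorname{supp}(\delta_x*\delta_y)$ is continuous for the Michael topology on compact sets; there is an identity $e$ with $\delta_e*\delta_x=\delta_x*\delta_e=\delta_x$; there is a homeomorphic involution $x\mapsto x^\sim$ of $K$ with $(\delta_x*\delta_y)^\sim=\delta_{y^\sim}*\delta_{x^\sim}$ and with $e\in\operatorname{supp}(\delta_x*\delta_y)$ if and only if $x=y^\sim$; and $\delta_x*\delta_y=\delta_y*\delta_x$. For a function $f$ on $K$ put $T^xf(y)=\int_K f\,d(\delta_x*\delta_y)$. Let $\lambda$ be a Haar measure, i.e. a nonzero regular Borel measure with $\int_K T^xf\,d\lambda=\int_K f\,d\lambda$ for every $x\in K$ and every nonnegative Borel function $f$. Let $\rho:K\times K\to[0,\infty)$ be a quasi-metric: $\rho(x,y)=0$ if and only if $x=y$, $\rho(x,y)=\rho(y,x)$, and $\rho(x,y)\le c(\rho(x,z)+\rho(z,y))$ for some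 constant $c\ge1$. Write $B(x,r)=\{y\in K:\rho(x,y)<r\}$. Assume that all balls are $\lambda$-measurable, that $0<\lambda B(x,2r)\le D\,\lambda B(x,r)<\infty$ for a constant $D$ and all $x\in K$, $r>0$, and that there are a real number $N$ and constants $c_1,c_2,c_3>0$ such that for all $x,y\in K$ and $r>0$ the function $\Lambda_x(y)=T^x\chi_{B(e,r)}(y^\sim)$ satisfies $$\operatorname{supp}\Lambda_x\subset B(x,c_1r),\qquad \lambda B(x,r)\,\Lambda_x(y)\le c_2\,\lambda B(e,r)\le c_3r^N,$$ where $\operatorname{supp}\Lambda_x$ is read as $\{y:\Lambda_x(y)\ne0\}$. Let $1<p<\infty$, $\frac1p+\frac1{p'}=1$, and let $a:[0,\infty)\to[0,\infty)$ be a Borel function, not identically zero on $(0,\infty)$, which is almost increasing ($a(t_1)\le C a(t_2)$ for all $0<t_1<t_2$, with a constant $C>0$), such that for some $0<\beta<N/p$ the function $a(r)/r^\beta$ is almost decreasing (the same inequality for all $0<t_2<t_1$), and such that $\int_0^1\frac{a(t)}t\,dt<\infty$. Put $A(r)=\int_0^r\frac{a(t)}t\,dt$. Then the function $r\mapsto\int_0^rA(t^{-1/N})\,t^{-1/p'}\,dt$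 is a bijection of $[0,\infty]$ whose inverse $\Phi$ is an $N$-function, i.e. $\Phi(r)=\int_0^r\phi(t)\,dt$ with $\phi:[0,\infty]\to[0,\infty]$ nondecreasing and left continuous, $\phi(0)=0$, $\lim_{t\to\infty}\phi(t)=\infty$. Moreover, with $k(y)=a(\rho(e,y))/\rho(e,y)^N$, the generalized fractional integral $$I_af(x)=\int_K T^xk(y)\,f(y^\sim)\,d\lambda(y)$$ is bounded from $L^p(K,\lambda)$ into the Orlicz space $L^\Phi(K,\lambda)$: for every $x$ the integral $T^xk(y)$ converges for $\lambda$-almost every $y$, and there is a constant $C>0$ such that for every $f\in L^p(K,\lambda)$ the integral $I_af(x)$ converges absolutely for $\lambda$-almost every $x$, $I_af$ is locally integrable with $\int_K\Phi(|I_af|/\eta)\,d\lambda<\infty$ for some $\eta>0$, and $$\|I_af\|_\Phi:=\inf\Big\{\eta>0:\int_K\Phi\big(|I_af|/\eta\big)\,d\lambda\le1\Big\}\le C\,\|f\|_{L^p(K,\lambda)}.$$ -/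

import Mathlib

open MeasureTheory Set Filter Topology
open scoped ENNReal NNReal

namespace HypergroupPotential

section Hypergroups

set_option linter.unusedSectionVars false

variable {K : Type*} [TopologicalSpace K] [T2Space K] [LocallyCompactSpace K]
  [MeasurableSpace K] [BorelSpace K]

variable (K) in
/-- The cone of bounded regular (nonnegative) Borel measures on `K`, with the weak topology
induced by integration against bounded continuous functions. -/
def RegularFinite : Submodule ℝ≥0 (FiniteMeasure K) where
  carrier := {μ | (μ : Measure K).Regular}
  zero_mem' := by
    change ((0 : FiniteMeasure K) : Measure K).Regular
    rw [FiniteMeasure.toMeasure_zero]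
    infer_instance
  add_mem' := by
    intro μ ν hμ hν
    have h₁ : (μ : Measure K).Regular := hμ
    have h₂ : (ν : Measure K).Regular := hν
    change ((μ + ν : FiniteMeasure K) : Measure K).Regular
    rw [FiniteMeasure.toMeasure_add]
    infer_instance
  smul_mem' := by
    intro c μ hμ
    have h₁ : (μ : Measure K).Regular := hμ
    change ((c • μ : FiniteMeasure K) : Measure K).Regular
    rw [FiniteMeasure.toMeasure_smul]
    infer_instance

/-- Point masses are regular. -/
theorem regular_dirac (x : K) : (Measure.dirac x).Regular := by
  have : (Measure.dirac x).InnerRegular := by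
    refine ⟨fun s hs r hr => ?_⟩
    by_cases hx : x ∈ s
    · refine ⟨{x}, singleton_subset_iff.2 hx, isCompact_singleton, ?_⟩
      rw [Measure.dirac_apply' x hs, indicator_of_mem hx] at hr
      rwa [Measure.dirac_apply_of_mem (mem_singleton x)]
    · rw [Measure.dirac_apply' x hs, indicator_of_notMem hx] at hr
      exact absurd hr not_lt_zero
  infer_instance

/-- The point mass at `x`, as a bounded regular Borel measure. -/
noncomputable def pointMass (x : K) : RegularFinite K :=
  ⟨⟨Measure.dirac x, inferInstance⟩, regular_dirac x⟩

/-- A bounded regular Borel measure, as a measure. -/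
def asMeasure (μ : RegularFinite K) : Measure K := (μ : FiniteMeasure K)

variable (K) in
/-- A hypergroup structure on the locally compact Hausdorff space `K`.  The convolution is given
on the cone of nonnegative bounded regular Borel measures; being bilinear there, it extends
uniquely to a bilinear product of all (signed or complex) bounded regular Borel measures. -/
structure Hypergroup where
  /-- the convolution of measures, a bilinear operation -/
  conv : RegularFinite K →ₗ[ℝ≥0] RegularFinite K →ₗ[ℝ≥0] RegularFinite K
  conv_assoc : ∀ μ ν σ, conv (conv μ ν) σ = conv μ (conv ν σ)
  /-- weak continuity of the convolution -/
  continuous_conv : Continuous fun q : RegularFinite K × RegularFinite K => conv q.1 q.2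
  isProbabilityMeasure_conv : ∀ x y,
    IsProbabilityMeasure (asMeasure (conv (pointMass x) (pointMass y)))
  isCompact_support : ∀ x y, IsCompact (asMeasure (conv (pointMass x) (pointMass y))).support
  /-- continuity of the support for the Michael (Vietoris) topology on compact sets -/
  continuous_support : Continuous fun q : K × K =>
    (⟨(asMeasure (conv (pointMass q.1) (pointMass q.2))).support, isCompact_support q.1 q.2⟩ :
      TopologicalSpace.Compacts K)
  /-- the identity -/
  e : K
  conv_e_left : ∀ x, conv (pointMass e) (pointMass x) = pointMass x
  conv_e_right : ∀ x, conv (pointMass x) (pointMass e) = pointMass x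
  /-- the involution -/
  inv : K ≃ₜ K
  inv_inv : ∀ x, inv (inv x) = x
  map_inv_conv : ∀ x y,
    (asMeasure (conv (pointMass x) (pointMass y))).map inv =
      (asMeasure (conv (pointMass (inv y)) (pointMass (inv x))))
  e_mem_support_iff : ∀ x y,
    e ∈ (asMeasure (conv (pointMass x) (pointMass y))).support ↔ x = inv y

namespace Hypergroup

/-- The measure `δ_x * δ_y`. -/
noncomputable def pconv (H : Hypergroup K) (x y : K) : Measure K :=
  asMeasure (H.conv (pointMass x) (pointMass y))

/-- `K` is a commutative hypergroup: `δ_x * δ_y = δ_y * δ_x`. -/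
def IsCommutative (H : Hypergroup K) : Prop :=
  ∀ x y, H.conv (pointMass x) (pointMass y) = H.conv (pointMass y) (pointMass x)

/-- `m` is a Haar measure of the hypergroup: a nonzero regular Borel measure with
`∫ f(δ_x * δ_y) dm(y) = ∫ f(y) dm(y)` for all nonnegative Borel functions `f` and all `x`. -/
structure IsHaar (H : Hypergroup K) (m : Measure K) : Prop where
  regular : m.Regular
  ne_zero : m ≠ 0
  lintegral_translate : ∀ (x : K) (f : K → ℝ≥0∞), Measurable f →
    ∫⁻ y, (∫⁻ z, f z ∂(H.pconv x y)) ∂m = ∫⁻ y, f y ∂m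

/-- The generalized translation `T^x f (y) = ∫ f d(δ_x * δ_y)`. -/
noncomputable def translate (H : Hypergroup K) (x : K) (f : K → ℝ) (y : K) : ℝ :=
  ∫ z, f z ∂(H.pconv x y)

end Hypergroup

end Hypergroups

section QuasiMetrics

variable {K : Type*}

/-- `ρ` is a quasi-metric on `K`. -/
structure IsQuasiMetric (ρ : K → K → ℝ) : Prop where
  nonneg : ∀ x y, 0 ≤ ρ x y
  eq_zero_iff : ∀ x y, ρ x y = 0 ↔ x = y
  symm : ∀ x y, ρ x y = ρ y x
  quasi_triangle : ∃ c : ℝ, 1 ≤ c ∧ ∀ x y z, ρ x y ≤ c * (ρ x z + ρ z y)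

/-- The ball `B(x, r)` of `ρ`. -/
def qball (ρ : K → K → ℝ) (x : K) (r : ℝ) : Set K := {y | ρ x y < r}

/-- All balls are measurable for (the completion of) `m`, and
`0 < m B(x, 2r) ≤ D m B(x, r) < ∞`. -/
structure IsDoubling [MeasurableSpace K] (ρ : K → K → ℝ) (m : Measure K) : Prop where
  nullMeasurableSet_qball : ∀ x r, NullMeasurableSet (qball ρ x r) m
  doubling : ∃ D : ℝ≥0, ∀ x r, 0 < r →
    0 < m (qball ρ x (2 * r)) ∧ m (qball ρ x (2 * r)) ≤ D * m (qball ρ x r) ∧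
      m (qball ρ x r) < ∞

end QuasiMetrics

section Conditions

variable {K : Type*} [TopologicalSpace K] [T2Space K] [LocallyCompactSpace K]
  [MeasurableSpace K] [BorelSpace K]

/-- `Λ_x(y) = T^x χ_{B(e, r)} (y~)`. -/
noncomputable def ballTranslate (H : Hypergroup K) (ρ : K → K → ℝ) (r : ℝ) (x y : K) : ℝ :=
  H.translate x ((qball ρ H.e r).indicator 1) (H.inv y)

/-- The support condition `supp Λ_x ⊆ B(x, c₁ r)`. -/
def SupportCondition (H : Hypergroup K) (ρ : K → K → ℝ) : Prop :=
  ∃ c₁ : ℝ, 0 < c₁ ∧ ∀ (x : K) (r : ℝ), 0 < r →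
    Function.support (ballTranslate H ρ r x) ⊆ qball ρ x (c₁ * r)

/-- The size condition `m B(x, r) · T^x χ_{B(e, r)} (y~) ≤ c₂ m B(e, r) ≤ c₃ r ^ N`. -/
def SizeCondition (H : Hypergroup K) (ρ : K → K → ℝ) (m : Measure K) (N : ℝ) : Prop :=
  ∃ c₂ c₃ : ℝ, 0 < c₂ ∧ 0 < c₃ ∧ ∀ (x y : K) (r : ℝ), 0 < r →
    m.real (qball ρ x r) * ballTranslate H ρ r x y ≤ c₂ * m.real (qball ρ H.e r) ∧
      c₂ * m.real (qball ρ H.e r) ≤ c₃ * r ^ N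

/-- The kernel `a(ρ(e, y)) / ρ(e, y) ^ N`. -/
noncomputable def potentialKernel (H : Hypergroup K) (ρ : K → K → ℝ) (N : ℝ) (a : ℝ → ℝ)
    (y : K) : ℝ :=
  a (ρ H.e y) / ρ H.e y ^ N

/-- The generalized fractional integral `I_a f`. -/
noncomputable def fracIntegral (H : Hypergroup K) (ρ : K → K → ℝ) (m : Measure K) (N : ℝ)
    (a : ℝ → ℝ) (f : K → ℝ) (x : K) : ℝ :=
  ∫ y, H.translate x (potentialKernel H ρ N a) y * f (H.inv y) ∂m

end Conditions

section Functions

/-- `g` is almost increasing (on the positive half-line). -/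
def AlmostIncreasing (g : ℝ → ℝ) : Prop :=
  ∃ C : ℝ, 0 < C ∧ ∀ t₁ t₂, 0 < t₁ → t₁ < t₂ → g t₁ ≤ C * g t₂

/-- `g` is almost decreasing (on the positive half-line). -/
def AlmostDecreasing (g : ℝ → ℝ) : Prop :=
  ∃ C : ℝ, 0 < C ∧ ∀ t₁ t₂, 0 < t₂ → t₂ < t₁ → g t₁ ≤ C * g t₂

/-- `A(r) = ∫_0^r a(t) / t dt`. -/
noncomputable def logPrimitive (a : ℝ → ℝ) (r : ℝ) : ℝ≥0∞ :=
  ∫⁻ t in Ioo 0 r, ENNReal.ofReal (a t / t)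

/-- The function `r ↦ ∫_0^r A(t ^ (-1/N)) t ^ (-1/p') dt` on `[0, ∞]`, with `1/p + 1/p' = 1`. -/
noncomputable def inverseYoung (a : ℝ → ℝ) (N p : ℝ) (r : ℝ≥0∞) : ℝ≥0∞ :=
  ∫⁻ t in {t : ℝ | 0 < t ∧ ENNReal.ofReal t < r},
    logPrimitive a (t ^ (-1 / N)) * ENNReal.ofReal (t ^ (-1 / p.conjExponent))

/-- `Φ : [0, ∞] → [0, ∞]` is an `N`-function: `Φ(r) = ∫_0^r φ(t) dt` with `φ : [0, ∞] → [0, ∞]`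
nondecreasing, left continuous, `φ(0) = 0` and `φ(t) → ∞` as `t → ∞`. -/
def IsNFunction (Φ : ℝ≥0∞ → ℝ≥0∞) : Prop :=
  ∃ φ : ℝ≥0∞ → ℝ≥0∞, Monotone φ ∧ (∀ t, ContinuousWithinAt φ (Iio t) t) ∧ φ 0 = 0 ∧
    Tendsto φ (𝓝[<] ∞) (𝓝 ∞) ∧
    ∀ r, Φ r = ∫⁻ t in {t : ℝ | 0 < t ∧ ENNReal.ofReal t < r}, φ (ENNReal.ofReal t)

variable {K : Type*} [MeasurableSpace K]

/-- `∫ Φ(|f| / η) dm`. -/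
noncomputable def orliczModular (Φ : ℝ≥0∞ → ℝ≥0∞) (m : Measure K) (f : K → ℝ) (η : ℝ) : ℝ≥0∞ :=
  ∫⁻ x, Φ (ENNReal.ofReal (|f x| / η)) ∂m

/-- Membership in the Orlicz space `L^Φ(K, m)`. -/
def MemOrlicz [TopologicalSpace K] (Φ : ℝ≥0∞ → ℝ≥0∞) (m : Measure K) (f : K → ℝ) : Prop :=
  LocallyIntegrable f m ∧ ∃ η : ℝ, 0 < η ∧ orliczModular Φ m f η < ∞

/-- The norm `‖f‖_Φ = inf {η > 0 : ∫ Φ(|f| / η) dm ≤ 1}` (`∞` if there is no such `η`). -/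
noncomputable def orliczNorm (Φ : ℝ≥0∞ → ℝ≥0∞) (m : Measure K) (f : K → ℝ) : ℝ≥0∞ :=
  ⨅ (η : ℝ) (_ : 0 < η ∧ orliczModular Φ m f η ≤ 1), ENNReal.ofReal η

end Functions

end HypergroupPotential

open HypergroupPotential

/-! The analytic core is Hedberg's argument. Since `a` is almost increasing, the kernel is at most a
constant times `∫_0^∞ a(t) t^(-N-1) χ_{B(e,t)} dt`, so everything reduces to convolving `|f|` with
indicators of balls. The support and size conditions together with doubling bound such a convolution
by a constant times `t^N Mf(x)`, where `M` is the centred maximal operator. Hölder's inequality,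
with `0 ≤ T^x χ ≤ 1` and the invariance of Haar measure, bounds it by a constant times `t^(N(1-1/p))
‖f‖_p`. The first bound for `t < δ` and the second for `t > δ`, where `β < N/p` makes the tail
converge, give `I_a|f|(x) ≤ Q A(δ) (Mf(x) + δ^(-N/p) ‖f‖_p)`; this is `exists_hedberg_bound`.

Balance the two terms by `δ = u^(-p/N)` with `u = Mf(x)/‖f‖_p`. Then `I_a|f|(x)` is at most a
multiple of `‖f‖_p u A(u^(-p/N))`, and `u A(u^(-p/N))` is at most `Φ⁻¹(u^p)`, because the integrand
defining `Φ⁻¹` is decreasing. Hence, up to constants, `Φ(I_a|f| / ‖f‖_p) ≤ (Mf/‖f‖_p)^p`, and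
`maximalFunction_strong_type` finishes: see `HedbergBound.exists_modular_le`. That `Φ` is an
`N`-function follows from `Φ' = 1/ω(Φ)`, with `ω` the decreasing integrand
(`exists_nFunction_inverse`).

The hypergroup axioms must first yield three facts. Weak continuity and the density of discrete
measures give `δ_x * μ = ∫ δ_x * δ_t dμ(t)` (`lintegral_conv_pointMass`), hence a calculus of
supports. This calculus and commutativity make Haar measure invariant under the involution
(`IsHaar.map_inv`), which is needed because `I_a` evaluates `f` at `y~`. Finally `I_a f` is
measurable, by approximation with continuous data (`IsHaar.measurable_lconv`). Balls being
measurable only up to null sets, `ρ(e, ·)` is replaced throughout by a Borel function `τ` equal to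
it almost everywhere. -/

namespace HypergroupPotential

/-! ### Weak approximation by point masses and disintegration of `δ_x * μ`. -/

section DiscreteApproximation

set_option linter.unusedSectionVars false

open scoped BoundedContinuousFunction

variable {K : Type*} [TopologicalSpace K] [T2Space K] [LocallyCompactSpace K]
  [MeasurableSpace K] [BorelSpace K]

/-- Rounding the finitely many bounded functions of `F` down to multiples of `1/(n+1)` cuts `K` into
finitely many measurable cells. The map `r` collapses each cell to one of its own points. -/
theorem exists_simpleFunc_approx [Nonempty K] (F : Finset (K →ᵇ ℝ≥0)) (n : ℕ) :
    ∃ r : SimpleFunc K K, ∀ f ∈ F, ∀ t, |(f (r t) : ℝ) - f t| ≤ 1 / ((n : ℝ) + 1) := by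
  classical
  let q : K → F → ℕ := fun t f => ⌊(f.1 t) * ((n : ℝ≥0) + 1)⌋₊
  have hq : Measurable q := by
    refine measurable_pi_lambda _ fun f => ?_
    exact Nat.measurable_floor.comp (f.1.continuous.measurable.mul_const _)
  have hqfin : (range q).Finite := by
    have h1 : ∀ f : F, ∃ B : ℕ, ∀ t, q t f ≤ B := by
      intro f
      refine ⟨⌊nndist f.1 0 * ((n : ℝ≥0) + 1)⌋₊, fun t => Nat.floor_mono ?_⟩
      gcongr
      simpa [nndist_comm] using f.1.nndist_coe_le_nndist (g := 0) t
    choose B hB using h1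
    refine (Set.Finite.pi' (t := fun f : F => Set.Iic (B f))
      (fun f => Set.finite_Iic _)).subset ?_
    rintro _ ⟨t, rfl⟩ f
    exact hB f t
  let σ : (F → ℕ) → K := fun v => if h : ∃ t, q t = v then h.choose else Classical.arbitrary K
  have hσ : ∀ t, q (σ (q t)) = q t := by
    intro t
    have h : ∃ s, q s = q t := ⟨t, rfl⟩
    simp only [σ, dif_pos h]
    exact h.choose_spec
  refine ⟨⟨σ ∘ q, fun x => ?_, ?_⟩, fun f hf t => ?_⟩
  · rw [preimage_comp]
    exact hq (Set.to_countable _).measurableSet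
  · exact (hqfin.image σ).subset (by rw [range_comp])
  · change |(f (σ (q t)) : ℝ) - f t| ≤ _
    have h := congrFun (hσ t) ⟨f, hf⟩
    simp only [q] at h
    set s := σ (q t)
    have hn : (0 : ℝ) < (n : ℝ) + 1 := by positivity
    have a1 := Nat.floor_le (show 0 ≤ f s * ((n : ℝ≥0) + 1) from bot_le)
    have a2 := Nat.lt_floor_add_one (f s * ((n : ℝ≥0) + 1))
    have b1 := Nat.floor_le (show 0 ≤ f t * ((n : ℝ≥0) + 1) from bot_le)
    have b2 := Nat.lt_floor_add_one (f t * ((n : ℝ≥0) + 1))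
    rw [h] at a1 a2
    rw [← NNReal.coe_le_coe] at a1 b1
    rw [← NNReal.coe_lt_coe] at a2 b2
    push_cast at a1 a2 b1 b2
    rw [le_div_iff₀ hn, ← abs_of_pos hn, ← abs_mul, abs_le]
    constructor <;> nlinarith

/-- The push-forward of `μ` by a simple function, as a combination of point masses. -/
noncomputable def discretize (μ : RegularFinite K) (r : SimpleFunc K K) : RegularFinite K :=
  ∑ v ∈ r.range, ((μ : FiniteMeasure K) (r ⁻¹' {v})) • pointMass v

theorem lintegral_ne_top_of_boundedContinuous (μ : FiniteMeasure K) (h : K →ᵇ ℝ≥0) :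
    ∫⁻ x, h x ∂(μ : Measure K) ≠ ∞ := by
  rw [← FiniteMeasure.testAgainstNN_coe_eq]
  exact ENNReal.coe_ne_top

/-- The integral of a bounded continuous function, as a linear functional. -/
noncomputable def testFunctional (h : K →ᵇ ℝ≥0) : RegularFinite K →ₗ[ℝ≥0] ℝ≥0 where
  toFun μ := (μ : FiniteMeasure K).testAgainstNN h
  map_add' μ ν := by
    simp only [FiniteMeasure.testAgainstNN, Submodule.coe_add, FiniteMeasure.toMeasure_add,
      lintegral_add_measure]
    exact ENNReal.toNNReal_add (lintegral_ne_top_of_boundedContinuous _ h)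
      (lintegral_ne_top_of_boundedContinuous _ h)
  map_smul' c μ := by
    simp only [Submodule.coe_smul, RingHom.id_apply]
    exact FiniteMeasure.smul_testAgainstNN_apply _ _ _

theorem coe_testFunctional (h : K →ᵇ ℝ≥0) (μ : RegularFinite K) :
    ((testFunctional h μ : ℝ≥0) : ℝ≥0∞) = ∫⁻ x, h x ∂(asMeasure μ) :=
  FiniteMeasure.testAgainstNN_coe_eq

theorem continuous_testFunctional (h : K →ᵇ ℝ≥0) :
    Continuous fun μ : RegularFinite K => testFunctional h μ :=
  (FiniteMeasure.continuous_testAgainstNN_eval h).comp continuous_subtype_val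

theorem asMeasure_pointMass (x : K) : asMeasure (pointMass x) = Measure.dirac x := rfl

theorem testFunctional_pointMass (h : K →ᵇ ℝ≥0) (x : K) :
    testFunctional h (pointMass x) = h x := by
  rw [← ENNReal.coe_inj, coe_testFunctional, asMeasure_pointMass, lintegral_dirac']
  exact h.continuous.measurable.coe_nnreal_ennreal

theorem continuous_pointMass : Continuous (pointMass : K → RegularFinite K) := by
  refine Continuous.subtype_mk ?_ _
  refine continuous_iff_continuousAt.2 fun x => ?_
  refine FiniteMeasure.tendsto_iff_forall_testAgainstNN_tendsto.2 fun f => ?_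
  change Tendsto (fun y => testFunctional f (pointMass y)) _ (𝓝 (testFunctional f (pointMass x)))
  simp only [testFunctional_pointMass]
  exact f.continuous.tendsto x

theorem testFunctional_discretize (h : K →ᵇ ℝ≥0) (μ : RegularFinite K) (r : SimpleFunc K K) :
    ((testFunctional h (discretize μ r) : ℝ≥0) : ℝ≥0∞) = ∫⁻ x, h (r x) ∂(asMeasure μ) := by
  have h1 : ∫⁻ x, h (r x) ∂(asMeasure μ) =
      ∫⁻ x, (r.map fun v => (h v : ℝ≥0∞)) x ∂(asMeasure μ) := rfl
  rw [h1, SimpleFunc.lintegral_eq_lintegral, SimpleFunc.map_lintegral, discretize, map_sum,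
    ENNReal.ofNNReal_finsetSum]
  refine Finset.sum_congr rfl fun v _ => ?_
  rw [map_smul, testFunctional_pointMass, smul_eq_mul, ENNReal.coe_mul, mul_comm]
  congr 1
  exact FiniteMeasure.ennreal_coeFn_eq_coeFn_toMeasure _ _

/-- A net of finite combinations of point masses converges weakly to `μ`. -/
theorem exists_tendsto_discretize [Nonempty K] (μ : RegularFinite K) :
    ∃ r : Finset (K →ᵇ ℝ≥0) × ℕ → SimpleFunc K K,
      Tendsto (fun i => discretize μ (r i)) atTop (𝓝 μ) := by
  choose r hr using fun i : Finset (K →ᵇ ℝ≥0) × ℕ => exists_simpleFunc_approx i.1 i.2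
  refine ⟨r, ?_⟩
  rw [tendsto_subtype_rng]
  refine FiniteMeasure.tendsto_iff_forall_testAgainstNN_tendsto.2 fun f => ?_
  change Tendsto (fun i => testFunctional f (discretize μ (r i))) atTop
    (𝓝 (testFunctional f μ))
  rw [← ENNReal.tendsto_coe]
  simp_rw [testFunctional_discretize, coe_testFunctional]
  set c : ℝ≥0∞ := asMeasure μ univ with hc
  have hctop : c ≠ ∞ := measure_ne_top (μ : FiniteMeasure K).toMeasure _
  have hfin : ∫⁻ x, f x ∂(asMeasure μ) ≠ ∞ :=
    lintegral_ne_top_of_boundedContinuous (μ : FiniteMeasure K) f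
  have hev : ∀ᶠ i : Finset (K →ᵇ ℝ≥0) × ℕ in atTop, f ∈ i.1 := by
    filter_upwards [eventually_ge_atTop (({f}, 0) : Finset (K →ᵇ ℝ≥0) × ℕ)] with i hi
    exact hi.1 (Finset.mem_singleton_self f)
  have hlim : Tendsto (fun i : Finset (K →ᵇ ℝ≥0) × ℕ =>
      ENNReal.ofReal (1 / ((i.2 : ℝ) + 1)) * c) atTop (𝓝 0) := by
    have h1 : Tendsto (fun n : ℕ => ENNReal.ofReal (1 / ((n : ℝ) + 1)) * c) atTop (𝓝 0) := by
      have := ENNReal.Tendsto.mul_const (b := c)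
        (ENNReal.tendsto_ofReal tendsto_one_div_add_atTop_nhds_zero_nat) (Or.inr hctop)
      simpa using this
    exact h1.comp (by rw [← prod_atTop_atTop_eq]; exact tendsto_snd)
  -- A uniform error `1/(n+1)` in the integrand costs at most `1/(n+1)` times the total mass `c`;
  -- this is applied to `r` and the identity in both orders.
  have key : ∀ (n : ℕ) (u v : K → K), (∀ t, |(f (u t) : ℝ) - f (v t)| ≤ 1 / ((n : ℝ) + 1)) →
      ∫⁻ x, f (u x) ∂(asMeasure μ) ≤ ∫⁻ x, f (v x) ∂(asMeasure μ) +
        ENNReal.ofReal (1 / ((n : ℝ) + 1)) * c := by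
    intro n u v huv
    rw [hc, ← lintegral_const, ← lintegral_add_right _ measurable_const]
    refine lintegral_mono fun t => ?_
    rw [← ENNReal.ofReal_coe_nnreal, ← ENNReal.ofReal_coe_nnreal,
      ← ENNReal.ofReal_add (by positivity) (by positivity)]
    refine ENNReal.ofReal_le_ofReal ?_
    linarith [(abs_le.1 (huv t)).2]
  refine ENNReal.tendsto_nhds hfin |>.2 fun ε hε => ?_
  filter_upwards [hev, (ENNReal.tendsto_nhds_zero.1 hlim) ε hε] with i hi hi'
  constructor
  · refine tsub_le_iff_right.2 ((key i.2 id (r i) fun t => ?_).trans (add_le_add le_rfl hi'))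
    rw [abs_sub_comm]
    exact hr i f hi t
  · exact (key i.2 (r i) id fun t => hr i f hi t).trans (add_le_add le_rfl hi')

end DiscreteApproximation

namespace Hypergroup

set_option linter.unusedSectionVars false

open scoped BoundedContinuousFunction

variable {K : Type*} [TopologicalSpace K] [T2Space K] [LocallyCompactSpace K]
  [MeasurableSpace K] [BorelSpace K] (H : Hypergroup K)

instance (x y : K) : IsProbabilityMeasure (H.pconv x y) := H.isProbabilityMeasure_conv x y

instance (x y : K) : (H.pconv x y).Regular := (H.conv (pointMass x) (pointMass y)).2

theorem continuous_conv_pointMass :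
    Continuous fun q : K × K => H.conv (pointMass q.1) (pointMass q.2) :=
  H.continuous_conv.comp ((continuous_pointMass.comp continuous_fst).prodMk
    (continuous_pointMass.comp continuous_snd))

theorem continuous_conv_pointMass_right (x : K) :
    Continuous fun y => H.conv (pointMass x) (pointMass y) :=
  Continuous.comp (g := fun q : K × K => H.conv (pointMass q.1) (pointMass q.2))
    (f := fun y => (x, y)) H.continuous_conv_pointMass (Continuous.prodMk_right x)

theorem continuous_conv_right (μ : RegularFinite K) : Continuous fun ν => H.conv μ ν :=
  Continuous.comp (g := fun q : RegularFinite K × RegularFinite K => H.conv q.1 q.2)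
    (f := fun ν => (μ, ν)) H.continuous_conv (Continuous.prodMk_right μ)

/-- Both sides are weakly continuous in `μ`: the left one by the continuity of the convolution, the
right one because `t ↦ ∫ h d(δ_x * δ_t)` is bounded and continuous. By linearity they agree on
finite combinations of point masses, which are weakly dense. -/
theorem lintegral_conv_pointMass (x : K) (μ : RegularFinite K) (h : K →ᵇ ℝ≥0) :
    ∫⁻ z, h z ∂(asMeasure (H.conv (pointMass x) μ)) =
      ∫⁻ t, ∫⁻ z, h z ∂(H.pconv x t) ∂(asMeasure μ) := by
  classical
  have : Nonempty K := ⟨x⟩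
  have hcont : Continuous fun t => testFunctional h (H.conv (pointMass x) (pointMass t)) :=
    (continuous_testFunctional h).comp (H.continuous_conv_pointMass_right x)
  have hbound : ∀ t, testFunctional h (H.conv (pointMass x) (pointMass t)) ≤ nndist h 0 := by
    intro t
    rw [← ENNReal.coe_le_coe, coe_testFunctional]
    refine (lintegral_mono (g := fun _ => ((nndist h 0 : ℝ≥0) : ℝ≥0∞)) fun z => ?_).trans ?_
    · exact ENNReal.coe_le_coe.2 (by simpa using h.nndist_coe_le_nndist (g := 0) z)
    · rw [lintegral_const]
      have := H.isProbabilityMeasure_conv x t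
      rw [measure_univ, mul_one]
  let g : K →ᵇ ℝ≥0 := BoundedContinuousFunction.mkOfBound ⟨_, hcont⟩ (nndist h 0) fun s t => by
    rw [NNReal.dist_eq, abs_le]
    have h1 : (testFunctional h (H.conv (pointMass x) (pointMass s)) : ℝ) ≤ nndist h 0 :=
      NNReal.coe_le_coe.2 (hbound s)
    have h2 : (testFunctional h (H.conv (pointMass x) (pointMass t)) : ℝ) ≤ nndist h 0 :=
      NNReal.coe_le_coe.2 (hbound t)
    have h3 := (testFunctional h (H.conv (pointMass x) (pointMass s))).coe_nonneg
    have h4 := (testFunctional h (H.conv (pointMass x) (pointMass t))).coe_nonneg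
    constructor <;> simp only [ContinuousMap.coe_mk] <;> linarith
  have hg : ∀ t, g t = testFunctional h (H.conv (pointMass x) (pointMass t)) := fun _ => rfl
  obtain ⟨r, hr⟩ := exists_tendsto_discretize μ
  have l1 : Tendsto (fun i => testFunctional h (H.conv (pointMass x) (discretize μ (r i)))) atTop
      (𝓝 (testFunctional h (H.conv (pointMass x) μ))) :=
    (((continuous_testFunctional h).comp
      (H.continuous_conv_right (pointMass x))).tendsto μ).comp hr
  have l2 : Tendsto (fun i => testFunctional g (discretize μ (r i))) atTop
      (𝓝 (testFunctional g μ)) := ((continuous_testFunctional g).tendsto μ).comp hr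
  have heq : ∀ s, testFunctional h (H.conv (pointMass x) (discretize μ s)) =
      testFunctional g (discretize μ s) := by
    intro s
    simp only [discretize, map_sum, map_smul, testFunctional_pointMass, hg]
  simp only [heq] at l1
  have := tendsto_nhds_unique l1 l2
  rw [← ENNReal.coe_inj, coe_testFunctional, coe_testFunctional] at this
  rw [this]
  refine lintegral_congr fun t => ?_
  rw [hg, coe_testFunctional]
  rfl

end Hypergroup

end HypergroupPotential

namespace HypergroupPotential

open scoped BoundedContinuousFunction

/-! ### Bump functions, supports, and exchange of integrals. -/

section BumpFunctions

set_option linter.unusedSectionVars false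

variable {K : Type*} [TopologicalSpace K] [T2Space K] [LocallyCompactSpace K]
  [MeasurableSpace K] [BorelSpace K]

theorem exists_bump {C U : Set K} (hC : IsCompact C) (hU : IsOpen U) (hCU : C ⊆ U) :
    ∃ h : K →ᵇ ℝ≥0, (∀ x ∈ C, h x = 1) ∧ (∀ x, x ∉ U → h x = 0) ∧ (∀ x, h x ≤ 1) ∧
      HasCompactSupport h := by
  obtain ⟨f, h1, h0, hc, h01⟩ := exists_continuous_one_zero_of_isCompact hC hU.isClosed_compl
    (disjoint_compl_right_iff_subset.2 hCU)
  have hle : ∀ x, (f x).toNNReal ≤ 1 := fun x => by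
    rw [← Real.toNNReal_one]
    exact Real.toNNReal_le_toNNReal (h01 x).2
  refine ⟨BoundedContinuousFunction.mkOfBound
    ⟨fun x => (f x).toNNReal, continuous_real_toNNReal.comp f.continuous⟩ 1 fun x y => ?_, ?_, ?_, hle, ?_⟩
  · rw [NNReal.dist_eq, abs_le]
    have hx : (((f x).toNNReal : ℝ≥0) : ℝ) ≤ 1 := by exact_mod_cast hle x
    have hy : (((f y).toNNReal : ℝ≥0) : ℝ) ≤ 1 := by exact_mod_cast hle y
    have hx' := (f x).toNNReal.coe_nonneg
    have hy' := (f y).toNNReal.coe_nonneg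
    constructor <;> simp only [ContinuousMap.coe_mk] <;> linarith
  · intro x hx
    change (f x).toNNReal = 1
    rw [h1 hx]
    simp
  · intro x hx
    change (f x).toNNReal = 0
    rw [h0 hx]
    simp
  · exact hc.comp_left (g := Real.toNNReal) (by simp)

theorem lintegral_pos_of_mem_support {μ : Measure K} {x : K} (hx : x ∈ μ.support)
    {h : K → ℝ≥0} (hc : Continuous h) (hpos : 0 < h x) : 0 < ∫⁻ y, h y ∂μ := by
  rw [lintegral_pos_iff_support hc.measurable.coe_nnreal_ennreal]
  refine (Measure.mem_support_iff_forall x).1 hx _ ?_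
  filter_upwards [hc.continuousAt.eventually (lt_mem_nhds hpos)] with y hy
  simpa using hy.ne'

theorem lintegral_eq_zero_of_support {μ : Measure K} [μ.Regular] {h : K → ℝ≥0}
    (hz : ∀ x ∈ μ.support, h x = 0) : ∫⁻ y, h y ∂μ = 0 := by
  have : (fun y => (h y : ℝ≥0∞)) =ᵐ[μ] 0 := by
    filter_upwards [Measure.support_mem_ae_of_regular (μ := μ)] with y hy
    simp [hz y hy]
  rw [lintegral_congr_ae this]
  simp

theorem mem_support_of_forall_bump {μ : Measure K} {x : K}
    (h : ∀ f : K →ᵇ ℝ≥0, f x = 1 → ∫⁻ y, f y ∂μ ≠ 0) : x ∈ μ.support := by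
  rw [Measure.mem_support_iff_forall]
  intro U hU
  obtain ⟨V, hVU, hV, hxV⟩ := mem_nhds_iff.1 hU
  obtain ⟨f, h1, h0, -, -⟩ := exists_bump isCompact_singleton hV (singleton_subset_iff.2 hxV)
  by_contra hzero
  have hUz : μ V = 0 := measure_mono_null hVU (by simpa using hzero)
  refine h f (h1 x rfl) ?_
  have : (fun y => (f y : ℝ≥0∞)) =ᵐ[μ] 0 := by
    have hVae : Vᶜ ∈ ae μ := by rwa [mem_ae_iff, compl_compl]
    filter_upwards [hVae] with y hy
    simp [h0 y hy]
  rw [lintegral_congr_ae this]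
  simp

/-- Tonelli's theorem is not directly available: `K` need not be second countable, so a continuous
function on `K × K` need not be measurable for the product σ-algebra, and the measures need not be
σ-finite. Compact support reduces the claim to the exchange for Bochner integrals. -/
theorem lintegral_lintegral_swap_of_hasCompactSupport {μ ν : Measure K}
    [IsFiniteMeasureOnCompacts μ] [IsFiniteMeasureOnCompacts ν] {f : K → K → ℝ≥0}
    (hf : Continuous f.uncurry) (hfc : HasCompactSupport f.uncurry) :
    ∫⁻ x, ∫⁻ y, f x y ∂ν ∂μ = ∫⁻ y, ∫⁻ x, f x y ∂μ ∂ν := by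
  have key : ∀ (μ ν : Measure K) [IsFiniteMeasureOnCompacts μ] [IsFiniteMeasureOnCompacts ν]
      (f : K → K → ℝ≥0), Continuous f.uncurry → HasCompactSupport f.uncurry →
      ∫⁻ x, ∫⁻ y, f x y ∂ν ∂μ = ENNReal.ofReal (∫ x, ∫ y, (f x y : ℝ) ∂ν ∂μ) := by
    intro μ ν _ _ f hf hfc
    have hA : IsCompact (Prod.fst '' tsupport f.uncurry) := hfc.isCompact.image continuous_fst
    have hB : IsCompact (Prod.snd '' tsupport f.uncurry) := hfc.isCompact.image continuous_snd
    have hzA : ∀ x y, x ∉ Prod.fst '' tsupport f.uncurry → f x y = 0 := by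
      intro x y hx
      by_contra hne
      exact hx ⟨(x, y), subset_tsupport _ hne, rfl⟩
    have hzB : ∀ x y, y ∉ Prod.snd '' tsupport f.uncurry → f x y = 0 := by
      intro x y hx
      by_contra hne
      exact hx ⟨(x, y), subset_tsupport _ hne, rfl⟩
    have hx : ∀ x, Continuous fun y => (f x y : ℝ) := fun x =>
      NNReal.continuous_coe.comp (hf.comp (Continuous.prodMk_right x))
    have hxi : ∀ x, Integrable (fun y => (f x y : ℝ)) ν := fun x =>
      (hx x).integrable_of_hasCompactSupport
        (HasCompactSupport.intro hB fun y hy => by simp [hzB x y hy])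
    have hF : Continuous fun x => ∫ y, (f x y : ℝ) ∂ν := by
      rw [← continuousOn_univ]
      refine continuousOn_integral_of_compact_support hB ?_ ?_
      · exact (NNReal.continuous_coe.comp hf).continuousOn
      · intro x y _ hy
        simp [hzB x y hy]
    have hFi : Integrable (fun x => ∫ y, (f x y : ℝ) ∂ν) μ :=
      hF.integrable_of_hasCompactSupport (HasCompactSupport.intro hA fun x hx => by
        simp [hzA x _ hx])
    rw [ofReal_integral_eq_lintegral_ofReal hFi
      (Eventually.of_forall fun x => integral_nonneg fun y => NNReal.coe_nonneg _)]
    refine lintegral_congr fun x => ?_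
    rw [ofReal_integral_eq_lintegral_ofReal (hxi x)
      (Eventually.of_forall fun y => NNReal.coe_nonneg _)]
    simp
  have hswap : Continuous (Function.uncurry fun y x => f x y) := hf.comp continuous_swap
  have hswapc : HasCompactSupport (Function.uncurry fun y x => f x y) :=
    hfc.comp_homeomorph (Homeomorph.prodComm K K)
  rw [key μ ν f hf hfc, key ν μ (fun y x => f x y) hswap hswapc]
  congr 1
  exact integral_integral_swap_of_hasCompactSupport (f := fun x y => (f x y : ℝ))
    (NNReal.continuous_coe.comp hf) (hfc.comp_left (g := ((↑) : ℝ≥0 → ℝ)) rfl)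

end BumpFunctions

/-! ### Supports of convolutions and invariance of Haar measure under the involution. -/

namespace Hypergroup

set_option linter.unusedSectionVars false

variable {K : Type*} [TopologicalSpace K] [T2Space K] [LocallyCompactSpace K]
  [MeasurableSpace K] [BorelSpace K] (H : Hypergroup K)

theorem pconv_comm {H : Hypergroup K} (hcomm : H.IsCommutative) (x y : K) :
    H.pconv x y = H.pconv y x := congrArg asMeasure (hcomm x y)

/-- The translate of a bounded continuous function with values in `ℝ≥0`. -/
noncomputable def translateNN (h : K →ᵇ ℝ≥0) (x y : K) : ℝ≥0 :=
  testFunctional h (H.conv (pointMass x) (pointMass y))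

theorem coe_translateNN (h : K →ᵇ ℝ≥0) (x y : K) :
    (H.translateNN h x y : ℝ≥0∞) = ∫⁻ z, h z ∂(H.pconv x y) := coe_testFunctional _ _

theorem continuous_translateNN (h : K →ᵇ ℝ≥0) :
    Continuous fun q : K × K => H.translateNN h q.1 q.2 :=
  (continuous_testFunctional h).comp H.continuous_conv_pointMass

theorem continuous_translateNN_right (h : K →ᵇ ℝ≥0) (x : K) :
    Continuous fun y => H.translateNN h x y :=
  (continuous_testFunctional h).comp (H.continuous_conv_pointMass_right x)

/-- By inner regularity the measure of an open set is approached from below by integrals of bump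
functions, and these depend continuously on the pair of points. -/
theorem lowerSemicontinuous_pconv {U : Set K} (hU : IsOpen U) :
    LowerSemicontinuous fun q : K × K => H.pconv q.1 q.2 U := by
  intro q c hc
  obtain ⟨C, hCU, hC, hcC⟩ := hU.exists_lt_isCompact hc
  obtain ⟨h, h1, h0, hle, -⟩ := exists_bump hC hU hCU
  have hq : c < H.translateNN h q.1 q.2 := by
    rw [coe_translateNN]
    refine hcC.trans_le ?_
    rw [← lintegral_indicator_one hC.measurableSet]
    refine lintegral_mono fun z => ?_
    by_cases hz : z ∈ C
    · simp [hz, h1 z hz]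
    · simp [hz]
  have hcont : Continuous fun q : K × K => (H.translateNN h q.1 q.2 : ℝ≥0∞) :=
    ENNReal.continuous_coe.comp (H.continuous_translateNN h)
  filter_upwards [hcont.continuousAt.eventually (lt_mem_nhds hq)] with p hp
  refine lt_of_lt_of_le hp ?_
  rw [coe_translateNN, ← lintegral_indicator_one hU.measurableSet]
  refine lintegral_mono fun z => ?_
  by_cases hz : z ∈ U
  · simpa [hz] using hle z
  · simp [hz, h0 z hz]

theorem lowerSemicontinuous_pconv_right {U : Set K} (hU : IsOpen U) (x : K) :
    LowerSemicontinuous fun y => H.pconv x y U := by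
  intro y c hc
  have := H.lowerSemicontinuous_pconv hU (x, y) c hc
  exact (Continuous.prodMk_right x).continuousAt.eventually this

theorem measurable_pconv_right (x : K) : Measurable fun y => H.pconv x y := by
  refine Measurable.measure_of_isPiSystem_of_isProbabilityMeasure
    (BorelSpace.measurable_eq (α := K)) isPiSystem_isOpen fun U hU => ?_
  exact (H.lowerSemicontinuous_pconv_right hU x).measurable

theorem measurable_lintegral_pconv (x : K) {f : K → ℝ≥0∞} (hf : Measurable f) :
    Measurable fun y => ∫⁻ z, f z ∂(H.pconv x y) :=
  (Measure.measurable_lintegral hf).comp (H.measurable_pconv_right x)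

/-- Disintegrate over `δ_x * δ_y`: for a function positive at `e`, the inner integral is continuous
and is positive at `z`, because `e` lies in the support of `δ_{z~} * δ_z`. -/
theorem e_mem_support_conv {x y z : K} (hz : z ∈ (H.pconv x y).support) :
    H.e ∈ (asMeasure (H.conv (pointMass (H.inv z)) (H.conv (pointMass x) (pointMass y)))).support
    := by
  refine mem_support_of_forall_bump fun h he => ?_
  rw [lintegral_conv_pointMass]
  simp only [← coe_translateNN]
  refine (lintegral_pos_of_mem_support hz (H.continuous_translateNN_right h _) ?_).ne'
  rw [← ENNReal.coe_pos, coe_translateNN]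
  refine lintegral_pos_of_mem_support ((H.e_mem_support_iff _ _).2 rfl) h.continuous ?_
  rw [he]
  exact one_pos

theorem isCompact_iUnion_support {S : Set (K × K)} (hS : IsCompact S) :
    IsCompact (⋃ q ∈ S, (H.pconv q.1 q.2).support) := by
  have := TopologicalSpace.Compacts.isCompact_biUnion_coe_of_isCompact
    (hS.image H.continuous_support)
  rw [biUnion_image] at this
  exact this

/-- The union of the supports of `δ_x * δ_w` over `w` in the compact set `supp(δ_u * δ_v)` is
compact, hence closed. If it missed `e`, a bump function at `e` vanishing on it would have zero
integral, against the assumption. So `e ∈ supp(δ_x * δ_w)` for some such `w`, that is `x = w~`. -/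
theorem inv_mem_support_of_e_mem {x : K} {u v : K}
    (he' : H.e ∈ (asMeasure (H.conv (pointMass x) (H.conv (pointMass u) (pointMass v)))).support) :
    H.inv x ∈ (H.pconv u v).support := by
  by_contra hx
  set S := (H.pconv u v).support with hS
  have hcomp := H.isCompact_iUnion_support
    ((isCompact_singleton (x := x)).prod (H.isCompact_support u v))
  set R := ⋃ q ∈ {x} ×ˢ S, (H.pconv q.1 q.2).support with hR
  have heR : H.e ∉ R := by
    intro he
    simp only [hR, mem_iUnion, mem_prod, mem_singleton_iff, exists_prop] at he
    obtain ⟨⟨a, w⟩, ⟨rfl, hw⟩, he⟩ := he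
    have : a = H.inv w := (H.e_mem_support_iff _ _).1 he
    rw [this, H.inv_inv] at hx
    exact hx hw
  obtain ⟨h, h1, h0, -, -⟩ := exists_bump isCompact_singleton hcomp.isClosed.isOpen_compl
    (singleton_subset_iff.2 heR)
  have hpos := lintegral_pos_of_mem_support he' h.continuous (by rw [h1 _ rfl]; exact one_pos)
  rw [lintegral_conv_pointMass] at hpos
  simp only [← coe_translateNN] at hpos
  refine hpos.ne' (lintegral_eq_zero_of_support (μ := H.pconv u v) fun w hw => ?_)
  rw [← ENNReal.coe_eq_zero, coe_translateNN]
  refine lintegral_eq_zero_of_support fun z hz => h0 z ?_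
  rw [mem_compl_iff, not_not]
  exact mem_biUnion (x := (x, w)) ⟨rfl, hw⟩ hz

theorem inv_mem_support {x y z : K} (h : z ∈ (H.pconv x y).support) :
    H.inv z ∈ (H.pconv (H.inv y) (H.inv x)).support := by
  have := H.map_inv_conv x y
  change (H.pconv x y).map H.inv = H.pconv (H.inv y) (H.inv x) at this
  rw [← this, Measure.mem_support_iff_forall]
  intro U hU
  have h1 := (Measure.mem_support_iff_forall z).1 h _ (H.inv.continuous.continuousAt hU)
  rwa [← H.inv.toMeasurableEquiv_coe, MeasurableEquiv.map_apply]

/-- The hypergroup form of "`z = xy` implies `x = y⁻¹z`". Commutativity rewrites `e ∈ supp(δ_{z~} *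
δ_x * δ_y)` as `e ∈ supp(δ_x * δ_{z~} * δ_y)`, so `x~` lies in the support of `δ_{z~} * δ_y`; then
apply the involution. -/
theorem mem_support_of_mem_support {H : Hypergroup K} (hcomm : H.IsCommutative) {x y z : K}
    (h : z ∈ (H.pconv x y).support) : x ∈ (H.pconv (H.inv y) z).support := by
  have h1 := H.e_mem_support_conv h
  rw [← H.conv_assoc, hcomm (H.inv z) x, H.conv_assoc] at h1
  have h2 := H.inv_mem_support (H.inv_mem_support_of_e_mem h1)
  rwa [H.inv_inv, H.inv_inv] at h2

/-- Fix a compact neighbourhood `V₀` of `e`. If the support of `δ_y * δ_s` meets `V₀`, then `s` lies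
in the compact set `Q = C~ * V₀`. Only `s ∈ Q \ U` can be harmful, and `C * (Q \ U)` is a compact
set avoiding `e`; removing it from `V₀` leaves the desired neighbourhood. -/
theorem exists_nhds_e_disjoint_support {H : Hypergroup K} (hcomm : H.IsCommutative) {C U : Set K}
    (hC : IsCompact C) (hU : IsOpen U) (hCU : ∀ y ∈ C, H.inv y ∈ U) :
    ∃ V : Set K, IsOpen V ∧ H.e ∈ V ∧
      ∀ y ∈ C, ∀ s, s ∉ U → ∀ z ∈ (H.pconv y s).support, z ∉ V := by
  obtain ⟨V₀, hV₀, heV₀⟩ := exists_compact_mem_nhds H.e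
  have hQ := H.isCompact_iUnion_support ((hC.image H.inv.continuous).prod hV₀)
  set Q := ⋃ q ∈ (H.inv '' C) ×ˢ V₀, (H.pconv q.1 q.2).support with hQdef
  have hR := H.isCompact_iUnion_support (hC.prod (hQ.diff hU))
  set R := ⋃ q ∈ C ×ˢ (Q \ U), (H.pconv q.1 q.2).support with hRdef
  have heR : H.e ∉ R := by
    intro he
    simp only [hRdef, mem_iUnion, mem_prod, exists_prop] at he
    obtain ⟨⟨y, s⟩, ⟨hy, hs⟩, he⟩ := he
    have : y = H.inv s := (H.e_mem_support_iff _ _).1 he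
    have h2 := hCU y hy
    rw [this, H.inv_inv] at h2
    exact hs.2 h2
  refine ⟨interior V₀ ∩ Rᶜ, isOpen_interior.inter hR.isClosed.isOpen_compl,
    ⟨mem_interior_iff_mem_nhds.2 heV₀, heR⟩, fun y hy s hs z hz hzV => ?_⟩
  have hsQ : s ∈ Q := by
    have hz' := hz
    rw [pconv_comm hcomm] at hz'
    exact mem_biUnion (x := (H.inv y, z)) ⟨mem_image_of_mem _ hy, interior_subset hzV.1⟩
      (mem_support_of_mem_support hcomm hz')
  exact hzV.2 (mem_biUnion (x := (y, s)) ⟨hy, hsQ, hs⟩ hz)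

/-- If `m U = 0`, invariance gives `(δ_{z~} * δ_y)(U) = 0` for almost every `y`. This quantity is
lower semicontinuous in `y` and positive at `y = z`, so `z` has a null neighbourhood. Then `m` has
empty support and vanishes by regularity. -/
theorem IsHaar.measure_pos_of_e_mem {H : Hypergroup K} {m : Measure K} (hm : H.IsHaar m)
    {U : Set K} (hU : IsOpen U) (he : H.e ∈ U) : 0 < m U := by
  have := hm.regular
  by_contra hzero
  have hU0 : m U = 0 := by simpa using hzero
  have hsupp : m.support = ∅ := by
    refine eq_empty_of_forall_notMem fun z hz => ?_
    have h1 := hm.lintegral_translate (H.inv z) (U.indicator 1)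
      (measurable_one.indicator hU.measurableSet)
    simp only [lintegral_indicator_one hU.measurableSet, hU0] at h1
    rw [lintegral_eq_zero_iff (H.lowerSemicontinuous_pconv_right hU _).measurable] at h1
    have h2 := (H.lowerSemicontinuous_pconv_right hU (H.inv z)) z 0
      ((Measure.mem_support_iff_forall _).1 ((H.e_mem_support_iff _ _).2 rfl) U (hU.mem_nhds he))
    have h3 := (Measure.mem_support_iff_forall z).1 hz _ h2
    refine h3.ne' ?_
    rw [Filter.EventuallyEq, ae_iff] at h1
    refine measure_mono_null (fun y hy => ?_) h1
    exact ne_of_gt hy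
  have := Measure.support_mem_ae_of_regular (μ := m)
  rw [hsupp, mem_ae_iff, compl_empty, Measure.measure_univ_eq_zero] at this
  exact hm.ne_zero this

/-- For a bump `φ` concentrated near `e`, the translate `T^y φ(s)` lives near `s = y~`. Integrating
it first over `s`, with `y ∈ C`, gives at least `m C ∫ φ`; integrating first over `y`, where
commutativity allows `T^y φ(s) = T^s φ(y)`, gives at most `m W ∫ φ`. Since `0 < ∫ φ < ∞`, the factor
cancels. -/
theorem IsHaar.measure_preimage_inv_le {H : Hypergroup K} (hcomm : H.IsCommutative)
    {m : Measure K} (hm : H.IsHaar m) {C W : Set K} (hC : IsCompact C) (hW : IsOpen W)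
    (hCW : ∀ y ∈ C, H.inv y ∈ W) : m C ≤ m W := by
  have := hm.regular
  have hC' : IsCompact (H.inv '' C) := hC.image H.inv.continuous
  have hC'W : H.inv '' C ⊆ W := by
    rintro _ ⟨y, hy, rfl⟩
    exact hCW y hy
  obtain ⟨L, hL, hCL, hLW⟩ := exists_compact_between hC' hW hC'W
  obtain ⟨V, hV, heV, hVC⟩ := exists_nhds_e_disjoint_support hcomm hC isOpen_interior
    fun y hy => hCL (mem_image_of_mem _ hy)
  obtain ⟨φ, hφ1, hφ0, -, hφc⟩ := exists_bump isCompact_singleton hV (singleton_subset_iff.2 heV)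
  -- The cutoffs `u` and `g` make the double integrand compactly supported. Neither loses anything
  -- on the range that matters: `g = 1` on `C`, and `u = 1` wherever `T^y φ` is nonzero for some `y
  -- ∈ C`.
  obtain ⟨u, hu1, hu0, hule, huc⟩ := exists_bump hL hW hLW
  obtain ⟨g, hg1, -, hgle, hgc⟩ := exists_bump hC isOpen_univ (subset_univ C)
  have hφpos : ∫⁻ z, φ z ∂m ≠ 0 := by
    refine ((lintegral_pos_iff_support φ.continuous.measurable.coe_nnreal_ennreal).2 ?_).ne'
    have h1 : IsOpen {z | 0 < φ z} := isOpen_lt continuous_const φ.continuous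
    have h2 := hm.measure_pos_of_e_mem h1 (by simp [hφ1 H.e rfl])
    refine h2.trans_le (measure_mono fun z hz => ?_)
    have : 0 < φ z := hz
    simpa using this.ne'
  have hφfin : ∫⁻ z, φ z ∂m ≠ ∞ := by
    have h1 : Integrable (fun z => (φ z : ℝ)) m :=
      (NNReal.continuous_coe.comp φ.continuous).integrable_of_hasCompactSupport
        (hφc.comp_left (g := ((↑) : ℝ≥0 → ℝ)) rfl)
    have h2 := h1.lintegral_lt_top
    simp only [ENNReal.ofReal_coe_nnreal] at h2
    exact h2.ne
  have htrans : ∀ x, ∫⁻ y, (H.translateNN φ x y : ℝ≥0∞) ∂m = ∫⁻ z, φ z ∂m := by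
    intro x
    simp only [coe_translateNN]
    exact hm.lintegral_translate x _ φ.continuous.measurable.coe_nnreal_ennreal
  have hcommNN : ∀ x y, H.translateNN φ x y = H.translateNN φ y x := by
    intro x y
    rw [translateNN, hcomm x y]
    rfl
  have hlow : ∀ y ∈ C, ∀ s, u s * H.translateNN φ y s = H.translateNN φ y s := by
    intro y hy s
    by_cases hs : s ∈ interior L
    · rw [hu1 s (interior_subset hs), one_mul]
    · have : H.translateNN φ y s = 0 := by
        rw [← ENNReal.coe_eq_zero, coe_translateNN]
        exact lintegral_eq_zero_of_support fun z hz => hφ0 z (hVC y hy s hs z hz)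
      rw [this, mul_zero]
  have hcont : Continuous (Function.uncurry fun y s => g y * (u s * H.translateNN φ y s)) :=
    (g.continuous.comp continuous_fst).mul
      ((u.continuous.comp continuous_snd).mul (H.continuous_translateNN φ))
  have hcs : HasCompactSupport
      (Function.uncurry fun y s => g y * (u s * H.translateNN φ y s)) := by
    refine HasCompactSupport.intro (hgc.isCompact.prod huc.isCompact) fun q hq => ?_
    rw [mem_prod, not_and_or] at hq
    rcases hq with hq | hq
    · simp [Function.uncurry, image_eq_zero_of_notMem_tsupport hq]
    · simp [Function.uncurry, image_eq_zero_of_notMem_tsupport hq]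
  have hswap := lintegral_lintegral_swap_of_hasCompactSupport (μ := m) (ν := m) hcont hcs
  have h1 : m C * ∫⁻ z, φ z ∂m ≤ ∫⁻ y, ∫⁻ s, ((g y * (u s * H.translateNN φ y s) : ℝ≥0) : ℝ≥0∞)
      ∂m ∂m := by
    rw [mul_comm, ← lintegral_indicator_const hC.measurableSet]
    refine lintegral_mono fun y => ?_
    by_cases hy : y ∈ C
    · simp only [hlow y hy, hg1 y hy, one_mul, htrans, indicator_of_mem hy, le_refl]
    · simp [hy]
  have h2 : ∫⁻ s, ∫⁻ y, ((g y * (u s * H.translateNN φ y s) : ℝ≥0) : ℝ≥0∞) ∂m ∂m ≤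
      m W * ∫⁻ z, φ z ∂m := by
    rw [mul_comm, ← lintegral_indicator_const hW.measurableSet]
    refine lintegral_mono fun s => ?_
    by_cases hs : s ∈ W
    · rw [indicator_of_mem hs, ← htrans s]
      refine lintegral_mono fun y => ?_
      rw [ENNReal.coe_le_coe, hcommNN y s, ← mul_assoc]
      exact mul_le_of_le_one_left' (mul_le_one' (hgle y) (hule s))
    · simp [hs, hu0 s hs]
  rw [hswap] at h1
  exact (ENNReal.mul_le_mul_iff_left hφpos hφfin).1 (h1.trans h2)

/-- The Haar measure of a commutative hypergroup is invariant under the involution. -/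
theorem IsHaar.map_inv {H : Hypergroup K} (hcomm : H.IsCommutative)
    {m : Measure K} (hm : H.IsHaar m) : m.map H.inv = m := by
  have := hm.regular
  have hopen : ∀ U : Set K, IsOpen U → m (H.inv ⁻¹' U) ≤ m U := by
    intro U hU
    rw [(hU.preimage H.inv.continuous).measure_eq_iSup_isCompact]
    refine iSup_le fun C => iSup_le fun hCU => iSup_le fun hC => ?_
    exact hm.measure_preimage_inv_le hcomm hC hU fun y hy => hCU hy
  have hmeas : ∀ E : Set K, m (H.inv ⁻¹' E) ≤ m E := by
    intro E
    refine le_of_forall_gt fun r hr => ?_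
    obtain ⟨U, hEU, hU, hUr⟩ := E.exists_isOpen_lt_of_lt r hr
    exact ((measure_mono (preimage_mono hEU)).trans (hopen U hU)).trans_lt hUr
  ext E hE
  rw [Measure.map_apply H.inv.continuous.measurable hE]
  refine le_antisymm (hmeas E) ?_
  have h1 := hmeas (H.inv ⁻¹' E)
  rw [← preimage_comp] at h1
  have h2 : (H.inv ∘ H.inv) = id := funext H.inv_inv
  rwa [h2, preimage_id] at h1

theorem IsHaar.measurePreserving_inv {H : Hypergroup K} (hcomm : H.IsCommutative)
    {m : Measure K} (hm : H.IsHaar m) : MeasurePreserving H.inv m m :=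
  ⟨H.inv.continuous.measurable, hm.map_inv hcomm⟩

end Hypergroup

end HypergroupPotential

/-! ### Measurability of convolutions. -/

namespace HypergroupPotential

namespace Hypergroup

open scoped BoundedContinuousFunction

set_option linter.unusedSectionVars false

variable {K : Type*} [TopologicalSpace K] [T2Space K] [LocallyCompactSpace K]
  [MeasurableSpace K] [BorelSpace K] (H : Hypergroup K)

/-- The convolution `∫ T^x k (y) g(y) dm(y)` of nonnegative functions. -/
noncomputable def lconv (m : Measure K) (k g : K → ℝ≥0∞) (x : K) : ℝ≥0∞ :=
  ∫⁻ y, (∫⁻ z, k z ∂(H.pconv x y)) * g y ∂m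

theorem _root_.NNReal.coe_le_add_edist (a b : ℝ≥0) : (a : ℝ≥0∞) ≤ b + edist a b := by
  rw [edist_nndist, NNReal.nndist_eq, ← ENNReal.coe_add, ENNReal.coe_le_coe]
  exact le_add_tsub.trans (by gcongr; exact le_max_left _ _)

theorem exists_hasCompactSupport_approx {m : Measure K} [m.Regular] {f : K → ℝ}
    (hf : Integrable f m) {ε : ℝ≥0∞} (hε : ε ≠ 0) :
    ∃ g : K → ℝ, eLpNorm (f - g) 1 m ≤ ε ∧ Continuous g ∧ HasCompactSupport g := by
  refine (memLp_one_iff_integrable.2 hf).induction_dense ENNReal.one_ne_top _ ?_ ?_ ?_ hε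
  · intro c s hs hms ε hε
    -- The bump differs from the indicator only on `s \ C` and `U \ s`; each gets half of the
    -- allowed error, and the `+ 1` avoids division by zero when `c = 0`.
    set δ : ℝ≥0∞ := ε / (‖c‖ₑ + 1) / 2 with hδ
    have hδ0 : δ ≠ 0 := by
      refine (ENNReal.div_pos (ENNReal.div_pos hε ?_).ne' (by simp)).ne'
      exact ENNReal.add_ne_top.2 ⟨enorm_ne_top, ENNReal.one_ne_top⟩
    obtain ⟨C, hCs, hC, hCδ⟩ := hs.exists_isCompact_sdiff_lt hms.ne hδ0
    obtain ⟨U, hsU, hU, -, hUδ⟩ := hs.exists_isOpen_sdiff_lt hms.ne hδ0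
    obtain ⟨h, h1, h0, hle, hhc⟩ := exists_bump hC hU (hCs.trans hsU)
    refine ⟨fun x => (h x : ℝ) * c, ?_,
      (NNReal.continuous_coe.comp h.continuous).mul continuous_const,
      HasCompactSupport.intro hhc.isCompact fun x hx => by
        simp [image_eq_zero_of_notMem_tsupport hx]⟩
    rw [eLpNorm_one_eq_lintegral_enorm]
    have hb : ∀ x, ‖((fun x => (h x : ℝ) * c) - s.indicator fun _ => c) x‖ₑ ≤
        ((s \ C) ∪ (U \ s)).indicator (fun _ => ‖c‖ₑ) x := by
      intro x
      rw [Pi.sub_apply]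
      by_cases hxC : x ∈ C
      · simp [h1 x hxC, hCs hxC]
      by_cases hxU : x ∈ U
      · have hx : x ∈ (s \ C) ∪ (U \ s) := by
          by_cases hxs : x ∈ s
          · exact Or.inl ⟨hxs, hxC⟩
          · exact Or.inr ⟨hxU, hxs⟩
        rw [indicator_of_mem hx]
        have hh : (h x : ℝ) ≤ 1 := by exact_mod_cast hle x
        have hh0 := (h x).coe_nonneg
        rw [enorm_le_iff_norm_le]
        by_cases hxs : x ∈ s
        · rw [indicator_of_mem hxs, show (h x : ℝ) * c - c = (h x - 1) * c by ring, norm_mul]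
          refine mul_le_of_le_one_left (norm_nonneg _) ?_
          rw [Real.norm_eq_abs, abs_le]
          constructor <;> linarith
        · rw [indicator_of_notMem hxs, sub_zero, norm_mul]
          refine mul_le_of_le_one_left (norm_nonneg _) ?_
          rw [Real.norm_eq_abs, abs_le]
          constructor <;> linarith
      · have hxs : x ∉ s := fun hx => hxU (hsU hx)
        simp [h0 x hxU, hxs]
    calc _ ≤ ∫⁻ x, ((s \ C) ∪ (U \ s)).indicator (fun _ => ‖c‖ₑ) x ∂m := lintegral_mono hb
      _ = ‖c‖ₑ * m ((s \ C) ∪ (U \ s)) := lintegral_indicator_const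
          ((hs.diff hC.measurableSet).union (hU.measurableSet.diff hs)) _
      _ ≤ ‖c‖ₑ * (δ + δ) := by
          gcongr
          exact (measure_union_le _ _).trans (add_le_add hCδ.le hUδ.le)
      _ ≤ (‖c‖ₑ + 1) * (ε / (‖c‖ₑ + 1)) := by
          rw [hδ, ENNReal.add_halves]
          gcongr
          exact le_self_add
      _ ≤ ε := ENNReal.mul_div_le
  · rintro f g ⟨hf, hf'⟩ ⟨hg, hg'⟩
    exact ⟨hf.add hg, hf'.add hg'⟩
  · rintro f ⟨hf, -⟩
    exact hf.aestronglyMeasurable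

theorem exists_bounded_approx (m : Measure K) [m.Regular] {k : K → ℝ≥0} (hk : Measurable k)
    (hfin : ∫⁻ z, k z ∂m ≠ ∞) {ε : ℝ≥0∞} (hε : ε ≠ 0) :
    ∃ f : K →ᵇ ℝ≥0, HasCompactSupport f ∧ ∫⁻ z, edist (k z) (f z) ∂m ≤ ε := by
  have hint : Integrable (fun z => (k z : ℝ)) m := by
    refine ⟨hk.coe_nnreal_real.aestronglyMeasurable, ?_⟩
    simpa [HasFiniteIntegral, lt_top_iff_ne_top] using hfin
  obtain ⟨f, hf, hfcont, hfc⟩ := exists_hasCompactSupport_approx hint hε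
  rw [eLpNorm_one_eq_lintegral_enorm] at hf
  obtain ⟨B, hB⟩ := hfc.exists_bound_of_continuous hfcont
  refine ⟨BoundedContinuousFunction.mkOfBound
    ⟨fun x => (f x).toNNReal, continuous_real_toNNReal.comp hfcont⟩ (B + B) fun x y => ?_, ?_, ?_⟩
  · rw [NNReal.dist_eq]
    have h : ∀ x, |(((f x).toNNReal : ℝ≥0) : ℝ)| ≤ B := fun x => by
      rw [NNReal.abs_eq, Real.coe_toNNReal']
      exact max_le ((le_abs_self _).trans (hB x)) ((norm_nonneg _).trans (hB x))
    exact (abs_sub _ _).trans (add_le_add (h x) (h y))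
  · exact hfc.comp_left (g := Real.toNNReal) (by simp)
  · refine le_trans (lintegral_mono fun z => ?_) hf
    change edist (k z) (f z).toNNReal ≤ _
    rw [Pi.sub_apply, ← edist_eq_enorm_sub]
    have h1 : edist (k z) (f z).toNNReal = edist ((k z : ℝ).toNNReal) (f z).toNNReal := by
      rw [Real.toNNReal_coe]
    rw [h1]
    simpa using Real.lipschitzWith_toNNReal (k z : ℝ) (f z)

theorem lconv_le_add_right (m : Measure K) {k g₁ g₂ : K → ℝ≥0} (hk : Measurable k)
    (hg₁ : Measurable g₁)
    (hg₂ : Measurable g₂) {b : ℝ≥0} (hb : ∀ z, k z ≤ b) (x : K) :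
    H.lconv m (fun z => k z) (fun z => g₁ z) x ≤
      H.lconv m (fun z => k z) (fun z => g₂ z) x + b * ∫⁻ z, edist (g₁ z) (g₂ z) ∂m := by
  unfold lconv
  have hkm := H.measurable_lintegral_pconv x hk.coe_nnreal_ennreal
  rw [← lintegral_const_mul _ (by fun_prop), ← lintegral_add_left (by fun_prop)]
  refine lintegral_mono fun y => ?_
  have h1 : (g₁ y : ℝ≥0∞) ≤ g₂ y + edist (g₁ y) (g₂ y) :=
    NNReal.coe_le_add_edist _ _
  have h2 : ∫⁻ z, (k z : ℝ≥0∞) ∂(H.pconv x y) ≤ b := by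
    refine (lintegral_mono (g := fun _ => (b : ℝ≥0∞)) fun z => ENNReal.coe_le_coe.2 (hb z)).trans ?_
    simp
  calc _ ≤ (∫⁻ z, (k z : ℝ≥0∞) ∂(H.pconv x y)) * (g₂ y + edist (g₁ y) (g₂ y)) := by gcongr
    _ ≤ _ := by rw [mul_add]; gcongr

/-- Stability in the first factor uses Haar invariance: the translate of `|k₁ - k₂|` has the same
integral as `|k₁ - k₂|`. -/
theorem IsHaar.lconv_le_add_left {H : Hypergroup K} {m : Measure K} (hm : H.IsHaar m)
    {k₁ k₂ g : K → ℝ≥0} (hk₁ : Measurable k₁) (hk₂ : Measurable k₂) (hg : Measurable g)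
    {b : ℝ≥0} (hb : ∀ z, g z ≤ b) (x : K) :
    H.lconv m (fun z => k₁ z) (fun z => g z) x ≤
      H.lconv m (fun z => k₂ z) (fun z => g z) x + b * ∫⁻ z, edist (k₁ z) (k₂ z) ∂m := by
  unfold lconv
  have hkm := H.measurable_lintegral_pconv x hk₂.coe_nnreal_ennreal
  have hd : Measurable fun z => edist (k₁ z) (k₂ z) := hk₁.edist hk₂
  have hkd := H.measurable_lintegral_pconv x hd
  rw [← hm.lintegral_translate x _ hd, ← lintegral_const_mul _ hkd,
    ← lintegral_add_left (by fun_prop)]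
  refine lintegral_mono fun y => ?_
  have h1 : ∀ z, (k₁ z : ℝ≥0∞) ≤ k₂ z + edist (k₁ z) (k₂ z) :=
    fun z => NNReal.coe_le_add_edist _ _
  have h2 : ∫⁻ z, (k₁ z : ℝ≥0∞) ∂(H.pconv x y) ≤
      ∫⁻ z, (k₂ z : ℝ≥0∞) ∂(H.pconv x y) + ∫⁻ z, edist (k₁ z) (k₂ z) ∂(H.pconv x y) := by
    rw [← lintegral_add_left (by fun_prop)]
    exact lintegral_mono h1
  have h3 : (g y : ℝ≥0∞) ≤ b := ENNReal.coe_le_coe.2 (hb y)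
  calc _ ≤ (∫⁻ z, (k₂ z : ℝ≥0∞) ∂(H.pconv x y) + ∫⁻ z, edist (k₁ z) (k₂ z) ∂(H.pconv x y)) * g y
      := by gcongr
    _ ≤ _ := by rw [add_mul, mul_comm (∫⁻ z, edist (k₁ z) (k₂ z) ∂(H.pconv x y))]; gcongr

theorem continuous_lconv (m : Measure K) [m.Regular] (k g : K →ᵇ ℝ≥0) (hg : HasCompactSupport g) :
    Continuous fun x => H.lconv m (fun z => k z) (fun z => g z) x := by
  have h1 : Continuous fun x => ∫ y, ((H.translateNN k x y * g y : ℝ≥0) : ℝ) ∂m := by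
    rw [← continuousOn_univ]
    refine continuousOn_integral_of_compact_support hg.isCompact ?_ ?_
    · exact (NNReal.continuous_coe.comp ((H.continuous_translateNN k).mul
        (g.continuous.comp continuous_snd))).continuousOn
    · intro x y _ hy
      simp [image_eq_zero_of_notMem_tsupport hy]
  have h2 : ∀ x, H.lconv m (fun z => k z) (fun z => g z) x =
      ENNReal.ofReal (∫ y, ((H.translateNN k x y * g y : ℝ≥0) : ℝ) ∂m) := by
    intro x
    rw [ofReal_integral_eq_lintegral_ofReal]
    · refine lintegral_congr fun y => ?_
      rw [← coe_translateNN, ENNReal.ofReal_coe_nnreal, ENNReal.coe_mul]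
    · refine Continuous.integrable_of_hasCompactSupport ?_ ?_
      · exact NNReal.continuous_coe.comp
          ((H.continuous_translateNN_right k x).mul g.continuous)
      · refine HasCompactSupport.intro hg.isCompact fun y hy => ?_
        simp [image_eq_zero_of_notMem_tsupport hy]
    · exact Eventually.of_forall fun y => NNReal.coe_nonneg _
  simp only [h2]
  exact ENNReal.continuous_ofReal.comp h1

/-- Without joint measurability of `(x, y) ↦ T^x k(y)`, measurability in `x` comes from writing the
convolution as a pointwise limit of convolutions of continuous compactly supported functions, which
are continuous. -/
theorem IsHaar.measurable_lconv_of_bounded {H : Hypergroup K} {m : Measure K} (hm : H.IsHaar m)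
    {k g : K → ℝ≥0} (hk : Measurable k) (hg : Measurable g) {b : ℝ≥0} (hb : ∀ z, k z ≤ b)
    (hkfin : ∫⁻ z, k z ∂m ≠ ∞) (hgfin : ∫⁻ z, g z ∂m ≠ ∞) :
    Measurable fun x => H.lconv m (fun z => k z) (fun z => g z) x := by
  have := hm.regular
  have hε : ∀ (n : ℕ) (c : ℝ≥0), ((n : ℝ≥0∞) + 1)⁻¹ / (c + 1) ≠ 0 := by
    intro n c
    refine (ENNReal.div_pos (ENNReal.inv_ne_zero.2 ?_) ?_).ne'
    · exact ENNReal.add_ne_top.2 ⟨ENNReal.natCast_ne_top n, ENNReal.one_ne_top⟩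
    · exact ENNReal.add_ne_top.2 ⟨ENNReal.coe_ne_top, ENNReal.one_ne_top⟩
  have hmul : ∀ (n : ℕ) (c : ℝ≥0) (t : ℝ≥0∞), t ≤ ((n : ℝ≥0∞) + 1)⁻¹ / (c + 1) →
      c * t ≤ ((n : ℝ≥0∞) + 1)⁻¹ := by
    intro n c t ht
    rw [ENNReal.le_div_iff_mul_le (by simp) (by simp)] at ht
    refine le_trans ?_ ht
    rw [mul_comm]
    gcongr
    exact le_self_add
  choose g' hg'c hg' using fun n : ℕ => exists_bounded_approx m hg hgfin (hε n b)
  have hB : ∀ n, ∃ B : ℝ≥0, ∀ z, g' n z ≤ B := fun n =>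
    ⟨nndist (g' n) 0, fun z => by simpa using (g' n).nndist_coe_le_nndist (g := 0) z⟩
  choose B hB using hB
  -- The order of choice matters: `g'` is chosen with accuracy relative to the bound `b` of `k`, and
  -- only then `k'` relative to the bound `B n` of the already chosen `g' n`.
  choose k' hk'c hk' using fun n : ℕ => exists_bounded_approx m hk hkfin (hε n (B n))
  have hlim : Tendsto (fun n : ℕ => 2 * ((n : ℝ≥0∞) + 1)⁻¹) atTop (𝓝 0) := by
    have h1 := (tendsto_add_atTop_iff_nat 1).2 ENNReal.tendsto_inv_nat_nhds_zero
    have h2 := ENNReal.Tendsto.const_mul (a := 2) h1 (Or.inr (by simp))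
    simpa using h2
  refine measurable_of_tendsto_metrizable
    (f := fun n x => H.lconv m (fun z => k' n z) (fun z => g' n z) x)
    (fun n => (H.continuous_lconv m (k' n) (g' n) (hg'c n)).measurable) ?_
  rw [tendsto_pi_nhds]
  intro x
  have hgc : ∀ n, Measurable (g' n) := fun n => (g' n).continuous.measurable
  have hkc : ∀ n, Measurable (k' n) := fun n => (k' n).continuous.measurable
  have hfin : H.lconv m (fun z => k z) (fun z => g z) x ≠ ∞ := by
    refine ne_top_of_le_ne_top (b := b * ∫⁻ z, g z ∂m) (ENNReal.mul_ne_top (by simp) hgfin) ?_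
    have := H.lconv_le_add_right m hk hg (measurable_const (a := (0 : ℝ≥0))) hb x
    simpa [lconv, edist_nndist] using this
  refine (ENNReal.tendsto_nhds hfin).2 fun ε hε => ?_
  filter_upwards [(ENNReal.tendsto_nhds_zero.1 hlim) ε hε] with n hn
  rw [two_mul] at hn
  constructor
  · refine tsub_le_iff_right.2 ?_
    refine (H.lconv_le_add_right m hk hg (hgc n) hb x).trans ?_
    refine (add_le_add (hm.lconv_le_add_left hk (hkc n) (hgc n) (hB n) x)
      (hmul n b _ (hg' n))).trans ?_
    rw [add_assoc]
    exact add_le_add le_rfl ((add_le_add (hmul n _ _ (hk' n)) le_rfl).trans hn)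
  · refine (hm.lconv_le_add_left (hkc n) hk (hgc n) (hB n) x).trans ?_
    simp only [edist_comm (k' n _)]
    refine (add_le_add (H.lconv_le_add_right m hk (hgc n) hg hb x)
      (hmul n _ _ (hk' n))).trans ?_
    simp only [edist_comm (g' n _)]
    rw [add_assoc]
    exact add_le_add le_rfl ((add_le_add (hmul n _ _ (hg' n)) le_rfl).trans hn)

theorem exists_monotone_approx (m : Measure K) [SigmaFinite m] {k : K → ℝ≥0∞}
    (hk : Measurable k) :
    ∃ f : ℕ → K → ℝ≥0, (∀ n, Measurable (f n)) ∧ (∀ n z, f n z ≤ n) ∧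
      (∀ n, ∫⁻ z, f n z ∂m ≠ ∞) ∧ (∀ z, Monotone fun n => (f n z : ℝ≥0∞)) ∧
      ∀ z, ⨆ n, (f n z : ℝ≥0∞) = k z := by
  classical
  have hne : ∀ (n : ℕ) z, min (k z) n ≠ ∞ := fun n z =>
    ((min_le_right _ _).trans_lt (ENNReal.natCast_lt_top n)).ne
  have hval : ∀ (n : ℕ) z, (((spanningSets m n).indicator (fun z => (min (k z) n).toNNReal) z :
      ℝ≥0) : ℝ≥0∞) = (spanningSets m n).indicator (fun z => min (k z) (n : ℝ≥0∞)) z := by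
    intro n z
    by_cases hz : z ∈ spanningSets m n
    · simp [hz, ENNReal.coe_toNNReal (hne n z)]
    · simp [hz]
  refine ⟨fun n => (spanningSets m n).indicator fun z => (min (k z) n).toNNReal, fun n => ?_,
    fun n z => ?_, fun n => ?_, fun z => ?_, fun z => ?_⟩
  · exact ((hk.min measurable_const).ennreal_toNNReal).indicator (measurableSet_spanningSets m n)
  · refine (indicator_le_self' (fun _ _ => bot_le) z).trans ?_
    rw [← ENNReal.coe_le_coe, ENNReal.coe_toNNReal (hne n z)]
    exact min_le_right _ _
  · refine ne_top_of_le_ne_top (b := n * m (spanningSets m n))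
      (ENNReal.mul_ne_top (by simp) (measure_spanningSets_lt_top m n).ne) ?_
    rw [← lintegral_indicator_const (measurableSet_spanningSets m n)]
    refine lintegral_mono fun z => ?_
    rw [hval]
    exact indicator_le_indicator (min_le_right _ _)
  · intro i j hij
    simp only [hval]
    refine (indicator_le_indicator_of_subset (monotone_spanningSets m hij) (fun _ => bot_le)
      z).trans (indicator_le_indicator ?_)
    exact min_le_min_left _ (by exact_mod_cast hij)
  · simp only [hval]
    refine le_antisymm (iSup_le fun n => (indicator_le_self' (fun _ _ => bot_le) z).trans
      (min_le_left _ _)) ?_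
    refine le_of_forall_lt fun c hc => ?_
    obtain ⟨n₁, hn₁⟩ := ENNReal.exists_nat_gt (hc.trans_le le_top).ne
    have hz : z ∈ ⋃ i, spanningSets m i := by simp [iUnion_spanningSets]
    obtain ⟨n₂, hn₂⟩ := mem_iUnion.1 hz
    refine lt_of_lt_of_le (b := (spanningSets m (max n₁ n₂)).indicator
      (fun z => min (k z) ((max n₁ n₂ : ℕ) : ℝ≥0∞)) z) ?_ (le_iSup (fun n : ℕ =>
      (spanningSets m n).indicator (fun z => min (k z) (n : ℝ≥0∞)) z) (max n₁ n₂))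
    rw [indicator_of_mem (monotone_spanningSets m (le_max_right _ _) hn₂)]
    refine lt_min hc (hn₁.trans_le ?_)
    exact_mod_cast le_max_left _ _

/-- Monotone convergence in each factor separately reduces to bounded integrable data. -/
theorem IsHaar.measurable_lconv {H : Hypergroup K} {m : Measure K} (hm : H.IsHaar m)
    [SigmaFinite m] {k g : K → ℝ≥0∞} (hk : Measurable k) (hg : Measurable g) :
    Measurable (H.lconv m k g) := by
  obtain ⟨f, hfm, hfb, hfi, hfmono, hfs⟩ := exists_monotone_approx m hk
  obtain ⟨u, hum, -, hui, humono, hus⟩ := exists_monotone_approx m hg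
  have h1 : ∀ x y, ∫⁻ z, k z ∂(H.pconv x y) = ⨆ n, ∫⁻ z, f n z ∂(H.pconv x y) := by
    intro x y
    rw [← lintegral_iSup (fun n => (hfm n).coe_nnreal_ennreal) fun i j hij z => hfmono z hij]
    simp only [hfs]
  have hmono : ∀ x y, Monotone fun n => ∫⁻ z, f n z ∂(H.pconv x y) := fun x y i j hij =>
    lintegral_mono fun z => hfmono z hij
  have h2 : ∀ n x, H.lconv m k (fun z => u n z) x =
      ⨆ i, H.lconv m (fun z => f i z) (fun z => u n z) x := by
    intro n x
    unfold lconv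
    rw [← lintegral_iSup]
    · simp only [h1, ENNReal.iSup_mul]
    · intro i
      exact (H.measurable_lintegral_pconv x (hfm i).coe_nnreal_ennreal).mul
        (hum n).coe_nnreal_ennreal
    · intro i j hij y
      exact mul_le_mul_left (hmono x y hij) _
  have h3 : ∀ x, H.lconv m k g x = ⨆ n, H.lconv m k (fun z => u n z) x := by
    intro x
    unfold lconv
    rw [← lintegral_iSup]
    · simp only [← hus, ENNReal.mul_iSup]
    · intro i
      exact (H.measurable_lintegral_pconv x hk).mul (hum i).coe_nnreal_ennreal
    · intro i j hij y
      exact mul_le_mul_right (humono y hij) _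
  have h4 : H.lconv m k g = fun x => ⨆ n, ⨆ i, H.lconv m (fun z => f i z) (fun z => u n z) x := by
    funext x
    rw [h3]
    simp only [h2]
  rw [h4]
  exact Measurable.iSup fun n => Measurable.iSup fun i =>
    hm.measurable_lconv_of_bounded (hfm i) (hum n) (hfb i) (hfi i) (hui n)

end Hypergroup

end HypergroupPotential

namespace HypergroupPotential

/-! ### The Hardy–Littlewood maximal theorem for doubling quasi-metric measure spaces. -/

section MaximalFunction

set_option linter.unusedSectionVars false

variable {K : Type*} [MeasurableSpace K] {ρ : K → K → ℝ} {m : Measure K}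

theorem mem_qball_self (hρ : IsQuasiMetric ρ) (x : K) {r : ℝ} (hr : 0 < r) : x ∈ qball ρ x r := by
  change ρ x x < r
  rwa [(hρ.eq_zero_iff x x).2 rfl]

theorem qball_mono {x : K} {r s : ℝ} (h : r ≤ s) : qball ρ x r ⊆ qball ρ x s :=
  fun _ hy => lt_of_lt_of_le hy h

theorem IsDoubling.measure_qball_pos (hd : IsDoubling ρ m) (x : K) {r : ℝ} (hr : 0 < r) :
    0 < m (qball ρ x r) := by
  obtain ⟨D, hD⟩ := hd.doubling
  have := (hD x (r / 2) (by positivity)).1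
  rwa [mul_div_cancel₀ _ two_ne_zero] at this

theorem IsDoubling.measure_qball_lt_top (hd : IsDoubling ρ m) (x : K) (r : ℝ) :
    m (qball ρ x r) < ∞ := by
  obtain ⟨D, hD⟩ := hd.doubling
  exact (measure_mono (qball_mono (le_max_left r 1))).trans_lt
    (hD x (max r 1) (lt_max_of_lt_right one_pos)).2.2

theorem IsDoubling.exists_dilation (hd : IsDoubling ρ m) (s : ℝ) :
    ∃ D : ℝ≥0, ∀ x r, 0 < r → m (qball ρ x (s * r)) ≤ D * m (qball ρ x r) := by
  obtain ⟨D, hD⟩ := hd.doubling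
  have h : ∀ n : ℕ, ∀ x r, 0 < r → m (qball ρ x (2 ^ n * r)) ≤ (D ^ n : ℝ≥0) * m (qball ρ x r) := by
    intro n
    induction n with
    | zero => intro x r _; simp
    | succ n ih =>
      intro x r hr
      have h1 := (hD x (2 ^ n * r) (by positivity)).2.1
      rw [← mul_assoc, ← pow_succ'] at h1
      refine h1.trans ((mul_le_mul_right (ih x r hr) _).trans ?_)
      rw [← mul_assoc, pow_succ', ENNReal.coe_mul]
  obtain ⟨n, hn⟩ := pow_unbounded_of_one_lt s (one_lt_two)
  exact ⟨D ^ n, fun x r hr => (measure_mono (qball_mono (by gcongr))).trans (h n x r hr)⟩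

theorem IsDoubling.sigmaFinite (hd : IsDoubling ρ m) : SigmaFinite m := by
  rcases isEmpty_or_nonempty K with hK | ⟨⟨x⟩⟩
  · rw [Measure.eq_zero_of_isEmpty m]
    infer_instance
  · refine ⟨⟨⟨fun n : ℕ => qball ρ x n, fun _ => mem_univ _,
      fun n => hd.measure_qball_lt_top x n, ?_⟩⟩⟩
    refine eq_univ_of_forall fun y => ?_
    obtain ⟨n, hn⟩ := exists_nat_gt (ρ x y)
    exact mem_iUnion.2 ⟨n, hn⟩

/-- The Hardy–Littlewood maximal function with respect to the balls of `ρ`. -/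
noncomputable def maximalFunction (ρ : K → K → ℝ) (m : Measure K) (g : K → ℝ≥0∞) (x : K) : ℝ≥0∞ :=
  ⨆ (r : ℝ) (_ : 0 < r), (∫⁻ y in qball ρ x r, g y ∂m) / m (qball ρ x r)

theorem setLIntegral_qball_le (hd : IsDoubling ρ m) (g : K → ℝ≥0∞) (x : K) {r : ℝ} (hr : 0 < r) :
    ∫⁻ y in qball ρ x r, g y ∂m ≤ m (qball ρ x r) * maximalFunction ρ m g x := by
  rw [mul_comm, ← ENNReal.div_le_iff (hd.measure_qball_pos x hr).ne'
    (hd.measure_qball_lt_top x r).ne]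
  exact le_iSup₂ (f := fun (r : ℝ) (_ : 0 < r) =>
    (∫⁻ y in qball ρ x r, g y ∂m) / m (qball ρ x r)) r hr

/-- Vitali covering. Only outer measures of level sets occur, so no measurability of the maximal
function is needed. -/
theorem maximalFunction_weak_type (hρ : IsQuasiMetric ρ) (hd : IsDoubling ρ m) :
    ∃ D : ℝ≥0, ∀ (g : K → ℝ≥0∞) (t : ℝ≥0∞), t ≠ ∞ →
      t * m {x | t < maximalFunction ρ m g x} ≤ D * ∫⁻ y, g y ∂m := by
  obtain ⟨c, hc1, hc⟩ := hρ.quasi_triangle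
  obtain ⟨D, hD⟩ := hd.exists_dilation (3 * c)
  have := hd.sigmaFinite
  refine ⟨D, fun g t ht => ?_⟩
  -- The covering lemma requires bounded radii, hence the exhaustion by radii at most `n`.
  set E : ℕ → Set K := fun n => {x | ∃ r : ℝ, 0 < r ∧ r ≤ n ∧
    t * m (qball ρ x r) < ∫⁻ y in qball ρ x r, g y ∂m} with hE
  have hEmono : Monotone E := by
    rintro i j hij x ⟨r, hr, hri, hx⟩
    exact ⟨r, hr, hri.trans (by exact_mod_cast hij), hx⟩
  have hEU : {x | t < maximalFunction ρ m g x} ⊆ ⋃ n, E n := by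
    intro x hx
    obtain ⟨r, hx⟩ := lt_iSup_iff.1 (show t < maximalFunction ρ m g x from hx)
    obtain ⟨hr, hx⟩ := lt_iSup_iff.1 hx
    rw [ENNReal.lt_div_iff_mul_lt (Or.inl (hd.measure_qball_pos x hr).ne')
      (Or.inl (hd.measure_qball_lt_top x r).ne)] at hx
    obtain ⟨n, hn⟩ := exists_nat_gt r
    exact mem_iUnion.2 ⟨n, r, hr, hn.le, hx⟩
  refine (mul_le_mul_right (measure_mono hEU) t).trans ?_
  rw [hEmono.measure_iUnion, ENNReal.mul_iSup]
  refine iSup_le fun n => ?_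
  set T : Set (K × ℝ) := {q | 0 < q.2 ∧ q.2 ≤ n ∧
    t * m (qball ρ q.1 q.2) < ∫⁻ y in qball ρ q.1 q.2, g y ∂m} with hT
  obtain ⟨u, huT, hudisj, hucov⟩ := Vitali.exists_disjoint_subfamily_covering_enlargement
    (fun q : K × ℝ => qball ρ q.1 q.2) T (fun q => q.2) 2 one_lt_two (fun q hq => hq.1.le) n
    (fun q hq => hq.2.1) (fun q hq => ⟨q.1, mem_qball_self hρ q.1 hq.1⟩)
  -- Disjoint balls of positive measure in a σ-finite space are countably many.
  have hucount : u.Countable := by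
    have h1 := Measure.countable_meas_pos_of_disjoint_iUnion₀ (μ := m)
      (As := fun q : u => qball ρ q.1.1 q.1.2) (fun q => hd.nullMeasurableSet_qball _ _)
      (fun i j hij => (hudisj i.2 j.2 (fun h => hij (Subtype.ext h))).aedisjoint)
    have h2 : {q : u | 0 < m (qball ρ q.1.1 q.1.2)} = univ :=
      eq_univ_of_forall fun q => hd.measure_qball_pos _ (huT q.2).1
    rw [h2] at h1
    exact countable_coe_iff.1 (countable_univ_iff.1 h1)
  -- If `B(x, r)` meets the selected `B(q, s)` with `r ≤ 2s`, the quasi-triangle inequality puts `x`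
  -- within `c (s + 2s)` of `q`.
  have hcov : E n ⊆ ⋃ q ∈ u, qball ρ q.1 (3 * c * q.2) := by
    rintro x ⟨r, hr, hrn, hx⟩
    obtain ⟨q, hq, ⟨z, hz1, hz2⟩, hrq⟩ := hucov (x, r) ⟨hr, hrn, hx⟩
    refine mem_biUnion hq ?_
    have h1 := hc q.1 x z
    have h2 : ρ x z < r := hz1
    have h3 : ρ q.1 z < q.2 := hz2
    rw [hρ.symm] at h2
    have h4 : r ≤ 2 * q.2 := hrq
    change ρ q.1 x < 3 * c * q.2
    nlinarith
  have : Countable u := hucount.to_subtype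
  calc t * m (E n) ≤ t * ∑' q : u, m (qball ρ q.1.1 (3 * c * q.1.2)) := by
        gcongr
        refine (measure_mono hcov).trans ?_
        exact measure_biUnion_le _ hucount _
    _ ≤ t * ∑' q : u, D * m (qball ρ q.1.1 q.1.2) := by
        gcongr with q
        exact hD _ _ (huT q.2).1
    _ = D * ∑' q : u, t * m (qball ρ q.1.1 q.1.2) := by
        simp only [ENNReal.tsum_mul_left]
        ring
    _ ≤ D * ∑' q : u, ∫⁻ y in qball ρ q.1.1 q.1.2, g y ∂m := by
        gcongr with q
        exact (huT q.2).2.2.le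
    _ = D * ∫⁻ y in ⋃ q : u, qball ρ q.1.1 q.1.2, g y ∂m := by
        rw [lintegral_iUnion₀ (fun q => hd.nullMeasurableSet_qball _ _)
          (fun i j hij => (hudisj i.2 j.2 (fun h => hij (Subtype.ext h))).aedisjoint)]
    _ ≤ D * ∫⁻ y, g y ∂m := by
        gcongr
        exact Measure.restrict_le_self

/-- The part of `g` below height `t` contributes at most `t` to any average; this is the truncation
behind the interpolation argument. -/
theorem maximalFunction_le_add (hd : IsDoubling ρ m) {g : K → ℝ≥0∞} (hg : Measurable g) (t : ℝ≥0∞)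
    (x : K) : maximalFunction ρ m g x ≤
      maximalFunction ρ m ({y | t < g y}.indicator g) x + t := by
  refine iSup₂_le fun r hr => ?_
  rw [ENNReal.div_le_iff (hd.measure_qball_pos x hr).ne' (hd.measure_qball_lt_top x r).ne, add_mul]
  have hms : MeasurableSet {y | t < g y} := measurableSet_lt measurable_const hg
  calc ∫⁻ y in qball ρ x r, g y ∂m
      ≤ ∫⁻ y in qball ρ x r, {y | t < g y}.indicator g y + t ∂m := by
        refine lintegral_mono fun y => ?_
        by_cases hy : t < g y
        · simp [indicator, hy]
        · have hy' : y ∉ {y | t < g y} := hy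
          have h0 : {y | t < g y}.indicator g y = 0 := indicator_of_notMem hy' g
          exact (not_lt.1 hy).trans (by rw [h0, zero_add])
    _ = (∫⁻ y in qball ρ x r, {y | t < g y}.indicator g y ∂m) + t * m (qball ρ x r) := by
        rw [lintegral_add_left (hg.indicator hms), setLIntegral_const]
    _ ≤ _ := by
        gcongr
        rw [mul_comm]
        exact setLIntegral_qball_le hd _ x hr

/-- The maximal function is bounded on `L^p` for `1 < p < ∞`. -/
theorem maximalFunction_strong_type (hρ : IsQuasiMetric ρ) (hd : IsDoubling ρ m) {p : ℝ}
    (hp : 1 < p) :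
    ∃ D : ℝ≥0, ∀ g : K → ℝ≥0, Measurable g →
      ∫⁻ x, (maximalFunction ρ m (fun y => g y) x) ^ p ∂m ≤ D * ∫⁻ y, (g y : ℝ≥0∞) ^ p ∂m := by
  obtain ⟨D, hD⟩ := maximalFunction_weak_type hρ hd
  have hp0 : 0 < p := by linarith
  have hp1 : 0 < p - 1 := by linarith
  refine ⟨2 * D * p.toNNReal * (p - 1).toNNReal⁻¹ * 2 ^ (p - 1), fun g hg => ?_⟩
  -- The maximal function is not known to be measurable, so the layer-cake formula is applied to the
  -- `p`-th root of each simple minorant of `(Mg)^p`.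
  rw [lintegral_eq_nnreal]
  refine iSup₂_le fun φ hφ => ?_
  set m' := m.withDensity fun y => (g y : ℝ≥0∞) with hm'
  have hG : Measurable fun x => ((φ x ^ p⁻¹ : ℝ≥0) : ℝ) :=
    (φ.measurable.pow_const _).coe_nnreal_real
  have h1 : (φ.map ((↑) : ℝ≥0 → ℝ≥0∞)).lintegral m =
      ∫⁻ x, ENNReal.ofReal ((((φ x ^ p⁻¹ : ℝ≥0) : ℝ)) ^ p) ∂m := by
    rw [← SimpleFunc.lintegral_eq_lintegral]
    refine lintegral_congr fun x => ?_
    rw [← NNReal.coe_rpow, ENNReal.ofReal_coe_nnreal, ← NNReal.rpow_mul,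
      inv_mul_cancel₀ hp0.ne', NNReal.rpow_one]
    rfl
  -- Where `Mg > t`, the maximal function of `g χ_{g > t/2}` exceeds `t/2`. The weak type bound then
  -- gives `(2D/t) m'{2g > t}` with `m' = g m`, and the layer-cake formula for `m'` with exponent `p
  -- - 1` sums these up.
  have h2 : ∀ t ∈ Ioi (0 : ℝ), m {x | t < ((φ x ^ p⁻¹ : ℝ≥0) : ℝ)} * ENNReal.ofReal (t ^ (p - 1)) ≤
      2 * D * (m' {y | t < 2 * (g y : ℝ)} * ENNReal.ofReal (t ^ (p - 1 - 1))) := by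
    intro t ht
    have ht : 0 < t := ht
    set τ : ℝ≥0∞ := ENNReal.ofReal (t / 2) with hτ
    have hτ0 : τ ≠ 0 := by simpa [hτ] using ht
    have hτtop : τ ≠ ∞ := ENNReal.ofReal_ne_top
    have hττ : ENNReal.ofReal t = τ + τ := by
      rw [hτ, ← ENNReal.ofReal_add (by positivity) (by positivity), add_halves]
    have hsub : {x | t < ((φ x ^ p⁻¹ : ℝ≥0) : ℝ)} ⊆ {x | τ < maximalFunction ρ m
        ({y | τ < (g y : ℝ≥0∞)}.indicator fun y => (g y : ℝ≥0∞)) x} := by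
      intro x hx
      have hx1 : ENNReal.ofReal t < ((φ x ^ p⁻¹ : ℝ≥0) : ℝ≥0∞) := by
        rw [← ENNReal.ofReal_coe_nnreal]
        exact (ENNReal.ofReal_lt_ofReal_iff (lt_trans ht hx)).2 hx
      have hx2 : ((φ x ^ p⁻¹ : ℝ≥0) : ℝ≥0∞) ≤ maximalFunction ρ m (fun y => g y) x := by
        rw [ENNReal.coe_rpow_of_nonneg _ (by positivity), ENNReal.rpow_inv_le_iff hp0]
        exact hφ x
      have hx3 := hx1.trans_le (hx2.trans
        (maximalFunction_le_add hd hg.coe_nnreal_ennreal τ x))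
      rw [hττ] at hx3
      exact lt_of_add_lt_add_right hx3
    have hm'eq : ∫⁻ y, ({y | τ < (g y : ℝ≥0∞)}.indicator fun y => (g y : ℝ≥0∞)) y ∂m =
        m' {y | t < 2 * (g y : ℝ)} := by
      have hset : {y | τ < (g y : ℝ≥0∞)} = {y | t < 2 * (g y : ℝ)} := by
        ext y
        simp only [mem_ofPred_eq, hτ, ← ENNReal.ofReal_coe_nnreal]
        rw [ENNReal.ofReal_lt_ofReal_iff_of_nonneg (by positivity), div_lt_iff₀' two_pos]
      have hms : MeasurableSet {y | t < 2 * (g y : ℝ)} :=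
        measurableSet_lt measurable_const (hg.coe_nnreal_real.const_mul 2)
      rw [hset, lintegral_indicator hms, hm', withDensity_apply _ hms]
    have hw := hD ({y | τ < (g y : ℝ≥0∞)}.indicator fun y => (g y : ℝ≥0∞)) τ hτtop
    rw [hm'eq] at hw
    have hpow : ENNReal.ofReal (t ^ (p - 1)) = 2 * τ * ENNReal.ofReal (t ^ (p - 1 - 1)) := by
      rw [two_mul, ← hττ, ← ENNReal.ofReal_mul ht.le, Real.rpow_sub_one ht.ne' (p - 1),
        mul_div_cancel₀ _ ht.ne']
    calc _ ≤ m {x | τ < maximalFunction ρ m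
          ({y | τ < (g y : ℝ≥0∞)}.indicator fun y => (g y : ℝ≥0∞)) x} *
            (2 * τ * ENNReal.ofReal (t ^ (p - 1 - 1))) := by
          rw [hpow]
          gcongr
      _ = 2 * (τ * m {x | τ < maximalFunction ρ m
          ({y | τ < (g y : ℝ≥0∞)}.indicator fun y => (g y : ℝ≥0∞)) x}) *
            ENNReal.ofReal (t ^ (p - 1 - 1)) := by ring
      _ ≤ 2 * (D * m' {y | t < 2 * (g y : ℝ)}) * ENNReal.ofReal (t ^ (p - 1 - 1)) := by gcongr
      _ = _ := by ring
  have h3 : ∫⁻ y, ENNReal.ofReal ((2 * (g y : ℝ)) ^ (p - 1)) ∂m' =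
      ((2 ^ (p - 1) : ℝ≥0) : ℝ≥0∞) * ∫⁻ y, (g y : ℝ≥0∞) ^ p ∂m := by
    rw [hm', lintegral_withDensity_eq_lintegral_mul _ hg.coe_nnreal_ennreal (by fun_prop),
      ← lintegral_const_mul _ (by fun_prop)]
    refine lintegral_congr fun y => ?_
    rw [Pi.mul_apply, Real.mul_rpow two_pos.le (g y).coe_nonneg,
      ENNReal.ofReal_mul (by positivity), ← NNReal.coe_rpow, ENNReal.ofReal_coe_nnreal,
      ← ENNReal.coe_rpow_of_nonneg _ hp0.le]
    have e1 : ENNReal.ofReal (2 ^ (p - 1)) = ((2 ^ (p - 1) : ℝ≥0) : ℝ≥0∞) := by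
      rw [← ENNReal.ofReal_coe_nnreal, NNReal.coe_rpow]
      rfl
    have e2 : g y ^ p = g y * g y ^ (p - 1) := by
      rcases eq_or_ne (g y) 0 with h0 | h0
      · rw [h0, NNReal.zero_rpow hp0.ne', zero_mul]
      · rw [NNReal.rpow_sub_one h0, mul_div_cancel₀ _ h0]
    rw [e1, e2, ENNReal.coe_mul]
    ring
  have h4 := lintegral_rpow_eq_lintegral_meas_lt_mul m' (f := fun y => 2 * (g y : ℝ))
    (Eventually.of_forall fun y => by positivity) (by fun_prop) hp1
  rw [h1, lintegral_rpow_eq_lintegral_meas_lt_mul m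
    (Eventually.of_forall fun x => NNReal.coe_nonneg _) hG.aemeasurable hp0]
  refine (mul_le_mul_right (setLIntegral_mono' measurableSet_Ioi h2) _).trans ?_
  rw [lintegral_const_mul' _ _ (by finiteness)]
  have h5 : ∫⁻ t in Ioi (0 : ℝ), m' {y | t < 2 * (g y : ℝ)} * ENNReal.ofReal (t ^ (p - 1 - 1)) =
      ((p - 1).toNNReal⁻¹ : ℝ≥0) * (((2 ^ (p - 1) : ℝ≥0) : ℝ≥0∞) * ∫⁻ y, (g y : ℝ≥0∞) ^ p ∂m) := by
    rw [← h3, h4, ENNReal.coe_inv (by simpa using hp1), ← mul_assoc]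
    change _ = (ENNReal.ofReal (p - 1))⁻¹ * ENNReal.ofReal (p - 1) * _
    rw [ENNReal.inv_mul_cancel (by simpa using hp1) ENNReal.ofReal_ne_top, one_mul]
  rw [h5]
  simp only [ENNReal.coe_mul, ENNReal.coe_ofNat]
  change (p.toNNReal : ℝ≥0∞) * _ ≤ _
  exact le_of_eq (by ring)

end MaximalFunction

end HypergroupPotential

namespace HypergroupPotential

/-! ### Primitives of decreasing weights and their inverse `N`-functions. -/

section Primitives

/-- The primitive `∫_0^u ω` of a function on the positive half-line, extended by zero. -/
noncomputable def halfPrimitive (ω : ℝ → ℝ) (u : ℝ) : ℝ :=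
  ∫ t in (0 : ℝ)..u, (Ioi (0 : ℝ)).indicator ω t

theorem measurableSet_below (r : ℝ≥0∞) :
    MeasurableSet {t : ℝ | 0 < t ∧ ENNReal.ofReal t < r} :=
  (measurableSet_lt measurable_const measurable_id).inter
    (measurableSet_lt ENNReal.measurable_ofReal measurable_const)

theorem below_ofReal (u : ℝ) : {t : ℝ | 0 < t ∧ ENNReal.ofReal t < ENNReal.ofReal u} = Ioo 0 u := by
  ext t
  constructor
  · rintro ⟨h0, h⟩
    exact ⟨h0, (ENNReal.ofReal_lt_ofReal_iff_of_nonneg h0.le).1 h⟩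
  · rintro ⟨h0, h⟩
    exact ⟨h0, (ENNReal.ofReal_lt_ofReal_iff_of_nonneg h0.le).2 h⟩

theorem below_top : {t : ℝ | 0 < t ∧ ENNReal.ofReal t < ∞} = Ioi 0 := by
  ext t
  simp

theorem volume_below (u : ℝ≥0∞) : volume {t : ℝ | 0 < t ∧ ENNReal.ofReal t < u} = u := by
  rcases eq_or_ne u ∞ with rfl | hu
  · rw [below_top, Real.volume_Ioi]
  · rw [← ENNReal.ofReal_toReal hu, below_ofReal, Real.volume_Ioo, sub_zero]

variable {ω : ℝ → ℝ}

theorem intervalIntegrable_indicator (hint : ∀ R, IntegrableOn ω (Ioo 0 R)) (u v : ℝ) :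
    IntervalIntegrable ((Ioi (0 : ℝ)).indicator ω) volume u v := by
  rw [intervalIntegrable_iff]
  have h : IntegrableOn ((Ioi (0 : ℝ)).indicator ω) (Iio (max u v + 1)) := by
    rw [IntegrableOn, integrable_indicator_iff measurableSet_Ioi, IntegrableOn,
      Measure.restrict_restrict measurableSet_Ioi]
    exact (hint (max u v + 1))
  refine h.mono_set fun t ht => ?_
  have := ht.2
  exact lt_of_le_of_lt this (by simp)

theorem continuous_halfPrimitive (hint : ∀ R, IntegrableOn ω (Ioo 0 R)) :
    Continuous (halfPrimitive ω) :=
  intervalIntegral.continuous_primitive (intervalIntegrable_indicator hint) 0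

theorem halfPrimitive_zero : halfPrimitive ω 0 = 0 := intervalIntegral.integral_same

theorem setLIntegral_Ioo_eq (hpos : ∀ t, 0 < t → 0 ≤ ω t)
    (hint : ∀ R, IntegrableOn ω (Ioo 0 R)) (u : ℝ) :
    ∫⁻ t in Ioo 0 u, ENNReal.ofReal (ω t) = ENNReal.ofReal (halfPrimitive ω u) := by
  rcases le_total u 0 with hu | hu
  · rw [Ioo_eq_empty (not_lt.2 hu)]
    have h : halfPrimitive ω u ≤ 0 := by
      rw [halfPrimitive, intervalIntegral.integral_symm]
      simp only [Left.neg_nonpos_iff]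
      refine intervalIntegral.integral_nonneg hu fun t _ => ?_
      exact indicator_nonneg (fun t ht => hpos t ht) t
    simp [ENNReal.ofReal_of_nonpos h]
  · rw [halfPrimitive, intervalIntegral.integral_of_le hu, integral_Ioc_eq_integral_Ioo,
      setIntegral_congr_fun (g := ω) measurableSet_Ioo
        (fun t ht => indicator_of_mem (show t ∈ Ioi (0 : ℝ) from ht.1) ω),
      ofReal_integral_eq_lintegral_ofReal (hint u)]
    filter_upwards [ae_restrict_mem measurableSet_Ioo] with t ht using hpos t ht.1

theorem halfPrimitive_mono (hpos : ∀ t, 0 < t → 0 ≤ ω t)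
    (hint : ∀ R, IntegrableOn ω (Ioo 0 R)) : Monotone (halfPrimitive ω) := by
  intro u v huv
  have h := intervalIntegral.integral_add_adjacent_intervals
    (intervalIntegrable_indicator hint 0 u) (intervalIntegrable_indicator hint u v)
  have h2 : 0 ≤ ∫ t in u..v, (Ioi (0 : ℝ)).indicator ω t :=
    intervalIntegral.integral_nonneg huv fun t _ => indicator_nonneg (fun t ht => hpos t ht) t
  unfold halfPrimitive
  linarith

theorem lintegral_rpow_Ioo {s b : ℝ} (hs : -1 < s) (hb : 0 ≤ b) :
    ∫⁻ t in Ioo 0 b, ENNReal.ofReal (t ^ s) = ENNReal.ofReal (b ^ (s + 1) / (s + 1)) := by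
  have h1 : IntegrableOn (fun t : ℝ => t ^ s) (Ioo 0 b) :=
    ((intervalIntegrable_iff_integrableOn_Ioc_of_le hb).1
      (intervalIntegral.intervalIntegrable_rpow' hs)).mono_set Ioo_subset_Ioc_self
  rw [← ofReal_integral_eq_lintegral_ofReal h1, ← integral_Ioc_eq_integral_Ioo,
    ← intervalIntegral.integral_of_le hb, integral_rpow (Or.inl hs),
    Real.zero_rpow (by linarith), sub_zero]
  filter_upwards [ae_restrict_mem measurableSet_Ioo] with t ht using Real.rpow_nonneg ht.1.le s

/-- If `ω` is a continuous, positive and decreasing weight on `(0, ∞)` with finite integrals near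
`0`, with `ω → 0` and `u ω(u) → ∞` at infinity, then `r ↦ ∫_0^r ω` is a bijection of `[0, ∞]` and
its inverse is an `N`-function. -/
theorem exists_nFunction_inverse (hpos : ∀ t, 0 < t → 0 < ω t) (hcont : ContinuousOn ω (Ioi 0))
    (hanti : AntitoneOn ω (Ioi 0)) (hint : ∀ R, IntegrableOn ω (Ioo 0 R))
    (hlim : Tendsto ω atTop (𝓝 0)) (hinf : Tendsto (fun u => u * ω u) atTop atTop)
    {W : ℝ≥0∞ → ℝ≥0∞}
    (hW : ∀ r, W r = ∫⁻ t in {t : ℝ | 0 < t ∧ ENNReal.ofReal t < r}, ENNReal.ofReal (ω t)) :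
    StrictMono W ∧ ∃ Φ : ℝ≥0∞ → ℝ≥0∞, IsNFunction Φ ∧ Function.LeftInverse Φ W ∧
      Function.RightInverse Φ W := by
  have hpos' : ∀ t, 0 < t → 0 ≤ ω t := fun t ht => (hpos t ht).le
  set G := halfPrimitive ω with hG
  have hWG : ∀ u : ℝ, W (ENNReal.ofReal u) = ENNReal.ofReal (G u) := by
    intro u
    rw [hW, below_ofReal, setLIntegral_Ioo_eq hpos' hint]
  have hG0 : G 0 = 0 := halfPrimitive_zero
  have hGmono : Monotone G := halfPrimitive_mono hpos' hint
  have hGderiv : ∀ t, 0 < t → HasDerivAt G (ω t) t := by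
    intro t ht
    have hca : ContinuousAt ((Ioi (0 : ℝ)).indicator ω) t := by
      refine (hcont.continuousAt (Ioi_mem_nhds ht)).congr ?_
      filter_upwards [Ioi_mem_nhds ht] with s hs
      rw [indicator_of_mem hs]
    have h := intervalIntegral.integral_hasDerivAt_right (intervalIntegrable_indicator hint 0 t)
      (ContinuousOn.stronglyMeasurableAtFilter (s := Ioi 0) isOpen_Ioi
        (fun s hs => ?_) t ht) hca
    · rwa [indicator_of_mem (show t ∈ Ioi (0 : ℝ) from ht)] at h
    · refine ContinuousAt.continuousWithinAt ?_
      refine (hcont.continuousAt (Ioi_mem_nhds hs)).congr ?_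
      filter_upwards [Ioi_mem_nhds hs] with s hs
      rw [indicator_of_mem hs]
  have hGcont : Continuous G := continuous_halfPrimitive hint
  have hGstrict : StrictMonoOn G (Ici 0) := by
    refine strictMonoOn_of_deriv_pos (convex_Ici 0) hGcont.continuousOn fun t ht => ?_
    rw [interior_Ici] at ht
    rw [(hGderiv t ht).deriv]
    exact hpos t ht
  have hGle : ∀ u, 0 < u → u * ω u ≤ G u := by
    intro u hu
    have h1 : ENNReal.ofReal (u * ω u) ≤ ENNReal.ofReal (G u) := by
      rw [← setLIntegral_Ioo_eq hpos' hint, ENNReal.ofReal_mul hu.le]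
      calc _ = ∫⁻ t in Ioo 0 u, ENNReal.ofReal (ω u) := by
            rw [setLIntegral_const, Real.volume_Ioo, sub_zero, mul_comm]
        _ ≤ _ := setLIntegral_mono' measurableSet_Ioo fun t ht =>
            ENNReal.ofReal_le_ofReal (hanti ht.1 hu ht.2.le)
    exact (ENNReal.ofReal_le_ofReal_iff (hG0 ▸ hGmono hu.le)).1 h1
  have hGtop : Tendsto G atTop atTop := by
    refine tendsto_atTop_mono' _ ?_ hinf
    filter_upwards [eventually_gt_atTop 0] with u hu using hGle u hu
  have hWmono : Monotone W := by
    intro r s hrs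
    rw [hW, hW]
    exact lintegral_mono_set fun t ht => ⟨ht.1, ht.2.trans_le hrs⟩
  have hWtop : W ∞ = ∞ := by
    refine ENNReal.eq_top_of_forall_nnreal_le fun c => ?_
    obtain ⟨u, hu⟩ := (hGtop.eventually_ge_atTop (c : ℝ)).exists
    calc (c : ℝ≥0∞) = ENNReal.ofReal c := (ENNReal.ofReal_coe_nnreal).symm
      _ ≤ ENNReal.ofReal (G u) := ENNReal.ofReal_le_ofReal hu
      _ = W (ENNReal.ofReal u) := (hWG u).symm
      _ ≤ W ∞ := hWmono le_top
  have hWstrict : StrictMono W := by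
    intro r s hrs
    have hr : r ≠ ∞ := hrs.ne_top
    rw [← ENNReal.ofReal_toReal hr, hWG]
    rcases eq_or_ne s ∞ with rfl | hs
    · rw [hWtop]
      exact ENNReal.ofReal_lt_top
    · rw [← ENNReal.ofReal_toReal hs, hWG]
      have h1 : r.toReal < s.toReal := (ENNReal.toReal_lt_toReal hr hs).2 hrs
      refine (ENNReal.ofReal_lt_ofReal_iff_of_nonneg ?_).2
        (hGstrict ENNReal.toReal_nonneg ENNReal.toReal_nonneg h1)
      rw [← hG0]
      exact hGmono ENNReal.toReal_nonneg
  have hWsurj : Function.Surjective W := by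
    intro y
    rcases eq_or_ne y ∞ with rfl | hy
    · exact ⟨∞, hWtop⟩
    · obtain ⟨b, hb0, hb⟩ := ((eventually_ge_atTop (0 : ℝ)).and
        (hGtop.eventually_ge_atTop y.toReal)).exists
      obtain ⟨u, -, hu⟩ := intermediate_value_Icc hb0 hGcont.continuousOn
        ⟨by rw [hG0]; exact ENNReal.toReal_nonneg, hb⟩
      exact ⟨ENNReal.ofReal u, by rw [hWG, hu, ENNReal.ofReal_toReal hy]⟩
  refine ⟨hWstrict, ?_⟩
  let E := Equiv.ofBijective W ⟨hWstrict.injective, hWsurj⟩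
  have hl : Function.LeftInverse E.symm W := E.symm_apply_apply
  have hr : Function.RightInverse E.symm W := E.apply_symm_apply
  refine ⟨E.symm, ?_, hl, hr⟩
  -- The derivative of the inverse is `1/ω` at the preimage. Taking the supremum over strictly
  -- smaller arguments makes it monotone and left continuous on all of `[0, ∞]`, with value `0` at
  -- `0` as an empty supremum.
  set φ : ℝ≥0∞ → ℝ≥0∞ := fun s => ⨆ (t : ℝ) (_ : 0 < t ∧ W (ENNReal.ofReal t) < s),
    (ENNReal.ofReal (ω t))⁻¹ with hφ
  have hφmono : Monotone φ := fun r s hrs =>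
    iSup_mono fun t => iSup_mono' fun h => ⟨⟨h.1, h.2.trans_le hrs⟩, le_rfl⟩
  have hφleft : ∀ t, Tendsto φ (𝓝[<] t) (𝓝 (φ t)) := by
    intro s
    have h1 : φ s = sSup (φ '' Iio s) := by
      refine le_antisymm (iSup₂_le fun t ht => ?_) ?_
      · obtain ⟨s', h1, h2⟩ := exists_between ht.2
        refine le_trans ?_ (le_sSup (mem_image_of_mem φ h2))
        exact le_iSup₂ (f := fun (t : ℝ) (_ : 0 < t ∧ W (ENNReal.ofReal t) < s') =>
          (ENNReal.ofReal (ω t))⁻¹) t ⟨ht.1, h1⟩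
      · refine sSup_le ?_
        rintro _ ⟨s', hs', rfl⟩
        exact hφmono (le_of_lt hs')
    rw [h1]
    exact hφmono.tendsto_nhdsLT s
  have hφtop : φ ∞ = ∞ := by
    refine ENNReal.eq_top_of_forall_nnreal_le fun c => ?_
    have h1 : Tendsto (fun t => (ENNReal.ofReal (ω t))⁻¹) atTop (𝓝 ∞) := by
      have := tendsto_inv_iff.2 (ENNReal.tendsto_ofReal hlim)
      simpa using this
    obtain ⟨t, ht0, ht⟩ := ((eventually_gt_atTop (0 : ℝ)).and
      (h1.eventually (lt_mem_nhds (ENNReal.coe_lt_top (r := c))))).exists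
    refine ht.le.trans ?_
    exact le_iSup₂ (f := fun (t : ℝ) (_ : 0 < t ∧ W (ENNReal.ofReal t) < ∞) =>
      (ENNReal.ofReal (ω t))⁻¹) t ⟨ht0, by rw [hWG]; exact ENNReal.ofReal_lt_top⟩
  have hφG : ∀ u, 0 < u → φ (ENNReal.ofReal (G u)) = (ENNReal.ofReal (ω u))⁻¹ := by
    intro u hu
    refine le_antisymm (iSup₂_le fun t ht => ?_) ?_
    · rw [← hWG, hWstrict.lt_iff_lt, ENNReal.ofReal_lt_ofReal_iff_of_nonneg ht.1.le] at ht
      exact ENNReal.inv_le_inv.2 (ENNReal.ofReal_le_ofReal (hanti ht.1 hu ht.2.le))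
    · have h1 : Tendsto (fun t => (ENNReal.ofReal (ω t))⁻¹) (𝓝[<] u)
          (𝓝 (ENNReal.ofReal (ω u))⁻¹) :=
        tendsto_inv_iff.2 (ENNReal.tendsto_ofReal
          ((hcont.continuousAt (Ioi_mem_nhds hu)).tendsto.mono_left nhdsWithin_le_nhds))
      refine le_of_tendsto h1 ?_
      filter_upwards [self_mem_nhdsWithin,
        mem_nhdsWithin_of_mem_nhds (Ioi_mem_nhds hu)] with t ht ht0
      refine le_iSup₂ (f := fun (t : ℝ) (_ : 0 < t ∧ W (ENNReal.ofReal t) <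
        ENNReal.ofReal (G u)) => (ENNReal.ofReal (ω t))⁻¹) t ⟨ht0, ?_⟩
      rw [← hWG]
      exact hWstrict ((ENNReal.ofReal_lt_ofReal_iff hu).2 ht)
  refine ⟨φ, hφmono, hφleft, ?_, ?_, fun r => ?_⟩
  · simp [hφ]
  · have := hφleft ∞
    rwa [hφtop] at this
  · obtain ⟨u, rfl⟩ := hWsurj r
    rw [hl u]
    have himage : {s : ℝ | 0 < s ∧ ENNReal.ofReal s < W u} =
        G '' {t : ℝ | 0 < t ∧ ENNReal.ofReal t < u} := by
      ext s
      constructor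
      · rintro ⟨hs0, hs⟩
        obtain ⟨v, hv⟩ := hWsurj (ENNReal.ofReal s)
        rw [← hv, hWstrict.lt_iff_lt] at hs
        have hvt : v ≠ ∞ := hs.ne_top
        rw [← ENNReal.ofReal_toReal hvt] at hs hv
        rw [hWG] at hv
        have h0 : 0 ≤ G v.toReal := hG0 ▸ hGmono ENNReal.toReal_nonneg
        have hGs : G v.toReal = s := (ENNReal.ofReal_eq_ofReal_iff h0 hs0.le).1 hv
        refine ⟨v.toReal, ⟨?_, hs⟩, hGs⟩
        rcases (ENNReal.toReal_nonneg (a := v)).eq_or_lt with h | h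
        · rw [← h, hG0] at hGs
          exact absurd hGs hs0.ne
        · exact h
      · rintro ⟨t, ⟨ht0, ht⟩, rfl⟩
        refine ⟨?_, ?_⟩
        · rw [← hG0]
          exact hGstrict self_mem_Ici ht0.le ht0
        · rw [← hWG]
          exact hWstrict ht
    -- Substituting `s = G(t)` turns `∫ φ(s) ds` into `∫ φ(G t) ω(t) dt`, whose integrand is `1`.
    rw [himage, lintegral_image_eq_lintegral_abs_deriv_mul (measurableSet_below u)
      (fun t ht => (hGderiv t ht.1).hasDerivWithinAt)
      (hGstrict.injOn.mono fun t ht => ht.1.le)]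
    rw [setLIntegral_congr_fun (g := fun _ => 1) (measurableSet_below u)]
    · rw [setLIntegral_one, volume_below]
    · intro t ht
      simp only
      rw [hφG t ht.1, abs_of_pos (hpos t ht.1), ENNReal.mul_inv_cancel
        (by simpa using hpos t ht.1) ENNReal.ofReal_ne_top]

end Primitives

end HypergroupPotential

namespace HypergroupPotential

/-! ### Growth functions, the weight of the Young function, and one-dimensional integrals. -/

section Growth

/-- A positive function `a` on the half-line that is almost increasing, with `a(r) / r ^ β` almost
decreasing, and with `a(t) / t` integrable near `0`. -/
structure IsGrowthFunction (a : ℝ → ℝ) (β C : ℝ) : Prop where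
  measurable : Measurable a
  pos : ∀ t, 0 < t → 0 < a t
  exponent_pos : 0 < β
  one_le : 1 ≤ C
  le_of_le : ∀ s t, 0 < s → s ≤ t → a s ≤ C * a t
  le_rpow : ∀ s t, 0 < s → s ≤ t → a t ≤ C * (t / s) ^ β * a s
  lintegral_lt_top : ∫⁻ t in Ioo (0 : ℝ) 1, ENNReal.ofReal (a t / t) < ∞

/-- Positivity on all of `(0, ∞)` spreads from a single point: to the right because `a` is almost
increasing, to the left because `a(r)/r^β` is almost decreasing. -/
theorem exists_isGrowthFunction {a : ℝ → ℝ} {β : ℝ} (ha : Measurable a)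
    (ha_nonneg : ∀ r, 0 ≤ r → 0 ≤ a r) (ha_ne : ∃ r, 0 < r ∧ a r ≠ 0) (hβ : 0 < β)
    (hincr : AlmostIncreasing a) (hdecr : AlmostDecreasing fun r => a r / r ^ β)
    (hint : ∫⁻ t in Ioo (0 : ℝ) 1, ENNReal.ofReal (a t / t) < ∞) :
    ∃ C, IsGrowthFunction a β C := by
  obtain ⟨C₁, hC₁, h1⟩ := hincr
  obtain ⟨C₂, hC₂, h2⟩ := hdecr
  obtain ⟨r, hr, har⟩ := ha_ne
  have har : 0 < a r := lt_of_le_of_ne (ha_nonneg r hr.le) (Ne.symm har)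
  set C := max 1 (max C₁ C₂) with hC
  have hC1 : 1 ≤ C := le_max_left _ _
  have hCC₁ : C₁ ≤ C := (le_max_left _ _).trans (le_max_right _ _)
  have hCC₂ : C₂ ≤ C := (le_max_right _ _).trans (le_max_right _ _)
  refine ⟨C, ha, fun t ht => ?_, hβ, hC1, fun s t hs hst => ?_, fun s t hs hst => ?_, hint⟩
  · rcases lt_trichotomy t r with h | rfl | h
    · have h3 := h2 r t ht h
      have h4 : 0 < a r / r ^ β := div_pos har (Real.rpow_pos_of_pos hr β)
      have h5 : 0 < a t / t ^ β := pos_of_mul_pos_right (h4.trans_le h3) hC₂.le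
      by_contra h6
      exact absurd h5 (not_lt.2 (div_nonpos_of_nonpos_of_nonneg (not_lt.1 h6)
        (Real.rpow_nonneg ht.le β)))
    · exact har
    · exact pos_of_mul_pos_right (har.trans_le (h1 r t hr h)) hC₁.le
  · rcases hst.eq_or_lt with rfl | h
    · exact le_mul_of_one_le_left (ha_nonneg s hs.le) hC1
    · exact (h1 s t hs h).trans (mul_le_mul_of_nonneg_right hCC₁ (ha_nonneg t (hs.trans h).le))
  · rcases hst.eq_or_lt with rfl | h
    · rw [div_self hs.ne', Real.one_rpow, mul_one]
      exact le_mul_of_one_le_left (ha_nonneg s hs.le) hC1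
    · have ht : 0 < t := hs.trans h
      have h3 := h2 t s hs h
      simp only at h3
      rw [div_le_iff₀ (Real.rpow_pos_of_pos ht β)] at h3
      rw [Real.div_rpow ht.le hs.le]
      refine h3.trans (le_of_eq_of_le (b := C₂ * (t ^ β / s ^ β * a s)) (by ring) ?_)
      rw [mul_assoc]
      exact mul_le_mul_of_nonneg_right hCC₂ (mul_nonneg (by positivity) (ha_nonneg s hs.le))

variable {a : ℝ → ℝ} {β C : ℝ}

namespace IsGrowthFunction

theorem C_pos (h : IsGrowthFunction a β C) : 0 < C := one_pos.trans_le h.one_le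

theorem integrableOn (h : IsGrowthFunction a β C) (R : ℝ) :
    IntegrableOn (fun t => a t / t) (Ioo 0 R) := by
  have h1 : IntegrableOn (fun t => a t / t) (Ioo 0 1) := by
    refine ⟨(h.measurable.div measurable_id).aestronglyMeasurable, ?_⟩
    rw [hasFiniteIntegral_iff_ofReal]
    · exact h.lintegral_lt_top
    · filter_upwards [ae_restrict_mem measurableSet_Ioo] with t ht
      exact div_nonneg (h.pos t ht.1).le ht.1.le
  have h2 : IntegrableOn (fun t => a t / t) (Icc 1 R) := by
    refine IntegrableOn.of_bound (by simp) (h.measurable.div measurable_id).aestronglyMeasurable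
      (C * a R) ?_
    filter_upwards [ae_restrict_mem measurableSet_Icc] with t ht
    have ht0 : 0 < t := one_pos.trans_le ht.1
    rw [Real.norm_of_nonneg (div_nonneg (h.pos t ht0).le ht0.le)]
    exact (div_le_self (h.pos t ht0).le ht.1).trans (h.le_of_le t R ht0 ht.2)
  refine (h1.union h2).mono_set fun t ht => ?_
  rcases lt_or_ge t 1 with h | h
  · exact Or.inl ⟨ht.1, h⟩
  · exact Or.inr ⟨h, ht.2.le⟩

theorem div_nonneg (h : IsGrowthFunction a β C) (t : ℝ) (ht : 0 < t) : 0 ≤ a t / t :=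
  _root_.div_nonneg (h.pos t ht).le ht.le

theorem logPrimitive_eq (h : IsGrowthFunction a β C) (r : ℝ) :
    logPrimitive a r = ENNReal.ofReal (halfPrimitive (fun t => a t / t) r) :=
  setLIntegral_Ioo_eq h.div_nonneg h.integrableOn r

theorem halfPrimitive_nonneg (h : IsGrowthFunction a β C) {r : ℝ} (hr : 0 ≤ r) :
    0 ≤ halfPrimitive (fun t => a t / t) r := by
  rw [← halfPrimitive_zero (ω := fun t => a t / t)]
  exact halfPrimitive_mono h.div_nonneg h.integrableOn hr

/-- On `(r/2, r)` the function `a` is comparable to `a(r)` from below, so this interval alone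
contributes a multiple of `a(r)` to `A(r)`. -/
theorem le_halfPrimitive (h : IsGrowthFunction a β C) {r : ℝ} (hr : 0 < r) :
    a r ≤ 2 * C * 2 ^ β * halfPrimitive (fun t => a t / t) r := by
  have hC := h.C_pos
  set c : ℝ := a r / (C * 2 ^ β * r) with hc
  have h1 : ∀ t ∈ Ioo (r / 2) r, c ≤ a t / t := by
    intro t ht
    have ht0 : 0 < t := (half_pos hr).trans ht.1
    have h2 := h.le_rpow t r ht0 ht.2.le
    have h3 : (r / t) ^ β ≤ 2 ^ β := by
      refine Real.rpow_le_rpow (by positivity) ?_ h.exponent_pos.le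
      rw [div_le_iff₀ ht0]
      linarith [ht.1]
    have h4 : a r ≤ C * 2 ^ β * a t := h2.trans (by
      have := h.pos t ht0
      gcongr)
    rw [hc, div_le_div_iff₀ (by positivity) ht0]
    have := (h.pos r hr).le
    calc a r * t ≤ a r * r := by gcongr; exact ht.2.le
      _ ≤ C * 2 ^ β * a t * r := by gcongr
      _ = _ := by ring
  have h2 : ENNReal.ofReal (r / 2 * c) ≤
      ENNReal.ofReal (halfPrimitive (fun t => a t / t) r) := by
    rw [← setLIntegral_Ioo_eq h.div_nonneg h.integrableOn, ENNReal.ofReal_mul (by positivity)]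
    calc _ = ∫⁻ t in Ioo (r / 2) r, ENNReal.ofReal c := by
          rw [setLIntegral_const, Real.volume_Ioo, sub_half, mul_comm]
      _ ≤ ∫⁻ t in Ioo (r / 2) r, ENNReal.ofReal (a t / t) :=
          setLIntegral_mono' measurableSet_Ioo fun t ht => ENNReal.ofReal_le_ofReal (h1 t ht)
      _ ≤ _ := lintegral_mono_set (Ioo_subset_Ioo_left (by positivity))
  rw [ENNReal.ofReal_le_ofReal_iff (h.halfPrimitive_nonneg hr.le)] at h2
  calc a r = 2 * C * 2 ^ β * (r / 2 * c) := by
        rw [hc]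
        field_simp
    _ ≤ _ := by gcongr

theorem halfPrimitive_pos (h : IsGrowthFunction a β C) {r : ℝ} (hr : 0 < r) :
    0 < halfPrimitive (fun t => a t / t) r := by
  have hC := h.C_pos
  exact pos_of_mul_pos_right ((h.pos r hr).trans_le (h.le_halfPrimitive hr)) (by positivity)

theorem exists_rpow_le_halfPrimitive (h : IsGrowthFunction a β C) :
    ∃ c : ℝ, 0 < c ∧ ∀ r, 0 < r → r ≤ 1 → c * r ^ β ≤ halfPrimitive (fun t => a t / t) r := by
  have hC := h.C_pos
  have h1 := h.pos 1 one_pos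
  refine ⟨a 1 / (2 * C * 2 ^ β * C), by positivity, fun r hr hr1 => ?_⟩
  have h2 := h.le_halfPrimitive hr
  have h3 := h.le_rpow r 1 hr hr1
  rw [Real.div_rpow one_pos.le hr.le, Real.one_rpow] at h3
  have hrβ := Real.rpow_pos_of_pos hr β
  have h4 : a 1 * r ^ β ≤ C * a r := by
    calc a 1 * r ^ β ≤ C * (1 / r ^ β) * a r * r ^ β := by gcongr
      _ = C * a r := by field_simp
  rw [div_mul_eq_mul_div, div_le_iff₀ (by positivity)]
  calc a 1 * r ^ β ≤ C * a r := h4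
    _ ≤ C * (2 * C * 2 ^ β * halfPrimitive (fun t => a t / t) r) := by gcongr
    _ = _ := by ring

theorem exists_halfPrimitive_le_rpow (h : IsGrowthFunction a β C) :
    ∃ c : ℝ, 0 < c ∧ ∀ r, 1 ≤ r → halfPrimitive (fun t => a t / t) r ≤ c * r ^ β := by
  have hC := h.C_pos
  have hβ := h.exponent_pos
  have h1 := h.pos 1 one_pos
  have hA := h.halfPrimitive_pos one_pos
  set A := halfPrimitive (fun t => a t / t) with hAdef
  refine ⟨A 1 + C * a 1 / β, by positivity, fun r hr => ?_⟩
  have hr0 : 0 < r := one_pos.trans_le hr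
  have h2 : ∀ t ∈ Ico 1 r, a t / t ≤ C * a 1 * t ^ (β - 1) := by
    intro t ht
    have ht0 : 0 < t := one_pos.trans_le ht.1
    have h3 := h.le_rpow 1 t one_pos ht.1
    rw [div_one] at h3
    rw [div_le_iff₀ ht0, mul_assoc, ← Real.rpow_add_one ht0.ne', sub_add_cancel]
    exact h3.trans (le_of_eq (by ring))
  have h3 : ENNReal.ofReal (A r) ≤ ENNReal.ofReal (A 1 + C * a 1 * (r ^ β / β)) := by
    rw [ENNReal.ofReal_add hA.le (by positivity), hAdef,
      ← setLIntegral_Ioo_eq h.div_nonneg h.integrableOn,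
      ← setLIntegral_Ioo_eq h.div_nonneg h.integrableOn, ← Ioo_union_Ico_eq_Ioo one_pos hr]
    refine (lintegral_union_le _ _ _).trans (add_le_add le_rfl ?_)
    calc ∫⁻ t in Ico 1 r, ENNReal.ofReal (a t / t)
        ≤ ∫⁻ t in Ico 1 r, ENNReal.ofReal (C * a 1 * t ^ (β - 1)) :=
          setLIntegral_mono' measurableSet_Ico fun t ht => ENNReal.ofReal_le_ofReal (h2 t ht)
      _ ≤ ∫⁻ t in Ioo 0 r, ENNReal.ofReal (C * a 1 * t ^ (β - 1)) :=
          lintegral_mono_set fun t ht => ⟨one_pos.trans_le ht.1, ht.2⟩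
      _ = ENNReal.ofReal (C * a 1) * ENNReal.ofReal (r ^ β / β) := by
          simp only [ENNReal.ofReal_mul (show 0 ≤ C * a 1 by positivity)]
          rw [lintegral_const_mul' _ _ ENNReal.ofReal_ne_top,
            lintegral_rpow_Ioo (by linarith) hr0.le, sub_add_cancel]
      _ = _ := (ENNReal.ofReal_mul (by positivity)).symm
  rw [ENNReal.ofReal_le_ofReal_iff (by positivity)] at h3
  have h4 : 1 ≤ r ^ β := Real.one_le_rpow hr hβ.le
  calc A r ≤ A 1 + C * a 1 * (r ^ β / β) := h3
    _ ≤ A 1 * r ^ β + C * a 1 * (r ^ β / β) := by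
        gcongr
        exact le_mul_of_one_le_right hA.le h4
    _ = _ := by ring

/-- The weight whose primitive is the inverse of the Young function. -/
noncomputable def weight (a : ℝ → ℝ) (N p t : ℝ) : ℝ :=
  halfPrimitive (fun t => a t / t) (t ^ (-1 / N)) * t ^ (-1 / p.conjExponent)

theorem conjExponent_neg_inv {p : ℝ} (hp : 1 < p) : -1 / p.conjExponent = 1 / p - 1 := by
  have : p - 1 ≠ 0 := by linarith
  have : p ≠ 0 := by linarith
  rw [Real.conjExponent]
  field_simp
  ring

theorem inverseYoung_eq (h : IsGrowthFunction a β C) (N p : ℝ) (r : ℝ≥0∞) :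
    inverseYoung a N p r = ∫⁻ t in {t : ℝ | 0 < t ∧ ENNReal.ofReal t < r},
      ENNReal.ofReal (weight a N p t) := by
  refine setLIntegral_congr_fun (measurableSet_below r) fun t ht => ?_
  simp only [weight]
  rw [ENNReal.ofReal_mul (h.halfPrimitive_nonneg (Real.rpow_nonneg ht.1.le _)),
    h.logPrimitive_eq]

variable {N p : ℝ}

theorem weight_pos (h : IsGrowthFunction a β C) {t : ℝ} (ht : 0 < t) : 0 < weight a N p t :=
  mul_pos (h.halfPrimitive_pos (Real.rpow_pos_of_pos ht _)) (Real.rpow_pos_of_pos ht _)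

theorem continuousOn_weight (h : IsGrowthFunction a β C) :
    ContinuousOn (weight a N p) (Ioi 0) := by
  have h1 : ∀ s : ℝ, ContinuousOn (fun t : ℝ => t ^ s) (Ioi 0) := fun s =>
    continuousOn_id.rpow_const fun t ht => Or.inl (ne_of_gt ht)
  exact ((continuous_halfPrimitive h.integrableOn).comp_continuousOn (h1 _)).mul (h1 _)

theorem antitoneOn_weight (h : IsGrowthFunction a β C) (hN : 0 < N) (hp : 1 < p) :
    AntitoneOn (weight a N p) (Ioi 0) := by
  intro s hs t ht hst
  have hs : 0 < s := hs
  have ht : 0 < t := ht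
  have hq : -1 / p.conjExponent ≤ 0 := by
    rw [conjExponent_neg_inv hp, sub_nonpos, div_le_one (by linarith)]
    exact hp.le
  refine mul_le_mul (halfPrimitive_mono h.div_nonneg h.integrableOn ?_) ?_
    (Real.rpow_nonneg ht.le _) (h.halfPrimitive_nonneg (Real.rpow_nonneg hs.le _))
  · exact Real.rpow_le_rpow_of_nonpos hs hst (div_nonpos_of_nonpos_of_nonneg (by norm_num) hN.le)
  · exact Real.rpow_le_rpow_of_nonpos hs hst hq

/-- Near `0` the argument `t^(-1/N)` is large and `A(t^(-1/N))` is at most a multiple of `t^(-β/N)`.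
The exponent `-β/N + 1/p - 1` exceeds `-1` precisely because `β < N/p`. -/
theorem integrableOn_weight (h : IsGrowthFunction a β C) (hN : 0 < N) (hp : 1 < p)
    (hβN : β < N / p) (R : ℝ) : IntegrableOn (weight a N p) (Ioo 0 R) := by
  obtain ⟨c, hc, hle⟩ := h.exists_halfPrimitive_le_rpow
  have hmeas : ∀ S ⊆ Ioi (0 : ℝ), MeasurableSet S →
      AEStronglyMeasurable (weight a N p) (volume.restrict S) := fun S hS hSm =>
    (h.continuousOn_weight.mono hS).aestronglyMeasurable hSm
  have hp0 : 0 < p := by linarith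
  have hs : -1 < -β / N + (1 / p - 1) := by
    have : β / N < 1 / p := by
      rw [div_lt_div_iff₀ hN hp0]
      rw [lt_div_iff₀ hp0] at hβN
      linarith
    have : -β / N = -(β / N) := by ring
    linarith
  have h1 : IntegrableOn (weight a N p) (Ioc 0 1) := by
    have h2 : IntegrableOn (fun t : ℝ => c * t ^ (-β / N + (1 / p - 1))) (Ioc 0 1) :=
      ((intervalIntegrable_iff_integrableOn_Ioc_of_le one_pos.le).1
        (intervalIntegral.intervalIntegrable_rpow' hs)).const_mul c
    refine Integrable.mono' h2 (hmeas _ (fun t ht => ht.1) measurableSet_Ioc) ?_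
    filter_upwards [ae_restrict_mem measurableSet_Ioc] with t ht
    rw [Real.norm_of_nonneg (h.weight_pos ht.1).le, weight, conjExponent_neg_inv hp,
      Real.rpow_add ht.1, ← mul_assoc]
    refine mul_le_mul_of_nonneg_right ?_ (Real.rpow_nonneg ht.1.le _)
    refine (hle _ ?_).trans (le_of_eq ?_)
    · exact Real.one_le_rpow_of_pos_of_le_one_of_nonpos ht.1 ht.2
        (div_nonpos_of_nonpos_of_nonneg (by norm_num) hN.le)
    · rw [← Real.rpow_mul ht.1.le]
      congr 2
      ring
  have h2 : IntegrableOn (weight a N p) (Icc 1 R) := by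
    refine IntegrableOn.of_bound (by simp)
      (hmeas _ (fun t ht => one_pos.trans_le ht.1) measurableSet_Icc) (weight a N p 1) ?_
    filter_upwards [ae_restrict_mem measurableSet_Icc] with t ht
    have ht0 : 0 < t := one_pos.trans_le ht.1
    rw [Real.norm_of_nonneg (h.weight_pos ht0).le]
    exact h.antitoneOn_weight hN hp (mem_Ioi.2 one_pos) ht0 ht.1
  refine (h1.union h2).mono_set fun t ht => ?_
  rcases le_total t 1 with h | h
  · exact Or.inl ⟨ht.1, h⟩
  · exact Or.inr ⟨h, ht.2.le⟩

theorem tendsto_weight (h : IsGrowthFunction a β C) (hN : 0 < N) (hp : 1 < p) :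
    Tendsto (weight a N p) atTop (𝓝 0) := by
  have hq : 0 < 1 - 1 / p := by
    rw [sub_pos, div_lt_one (by linarith)]
    exact hp
  have h1 := (tendsto_rpow_neg_atTop hq).const_mul (halfPrimitive (fun t => a t / t) 1)
  rw [mul_zero] at h1
  refine tendsto_of_tendsto_of_tendsto_of_le_of_le' tendsto_const_nhds h1 ?_ ?_
  · filter_upwards [eventually_gt_atTop 0] with t ht using (h.weight_pos ht).le
  · filter_upwards [eventually_ge_atTop 1] with t ht
    have ht0 : 0 < t := one_pos.trans_le ht
    rw [weight, conjExponent_neg_inv hp, neg_sub]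
    refine mul_le_mul_of_nonneg_right ?_ (Real.rpow_nonneg ht0.le _)
    refine halfPrimitive_mono h.div_nonneg h.integrableOn ?_
    exact Real.rpow_le_one_of_one_le_of_nonpos ht
      (div_nonpos_of_nonpos_of_nonneg (by norm_num) hN.le)

/-- For `t ≥ 1` the lower bound on `A` gives `t ω(t) ≥ c t^(1/p - β/N)`, with positive exponent. -/
theorem tendsto_mul_weight (h : IsGrowthFunction a β C) (hN : 0 < N) (hp : 1 < p)
    (hβN : β < N / p) : Tendsto (fun t => t * weight a N p t) atTop atTop := by
  obtain ⟨c, hc, hle⟩ := h.exists_rpow_le_halfPrimitive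
  have hp0 : 0 < p := by linarith
  have hs : 0 < -β / N + 1 / p := by
    have : β / N < 1 / p := by
      rw [div_lt_div_iff₀ hN hp0]
      rw [lt_div_iff₀ hp0] at hβN
      linarith
    have : -β / N = -(β / N) := by ring
    linarith
  refine tendsto_atTop_mono' _ ?_ ((tendsto_rpow_atTop hs).const_mul_atTop hc)
  filter_upwards [eventually_ge_atTop 1] with t ht
  have ht0 : 0 < t := one_pos.trans_le ht
  have h1 := hle (t ^ (-1 / N)) (Real.rpow_pos_of_pos ht0 _)
    (Real.rpow_le_one_of_one_le_of_nonpos ht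
      (div_nonpos_of_nonpos_of_nonneg (by norm_num) hN.le))
  rw [← Real.rpow_mul ht0.le] at h1
  have h2 : t * t ^ (1 / p - 1) = t ^ (1 / p) := by
    rw [mul_comm, ← Real.rpow_add_one ht0.ne', sub_add_cancel]
  rw [weight, conjExponent_neg_inv hp, mul_left_comm, h2, Real.rpow_add ht0, ← mul_assoc]
  refine mul_le_mul_of_nonneg_right (le_of_eq_of_le ?_ h1) (Real.rpow_nonneg ht0.le _)
  congr 2
  ring

theorem exists_nFunction (h : IsGrowthFunction a β C) (hN : 0 < N) (hp : 1 < p)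
    (hβN : β < N / p) : StrictMono (inverseYoung a N p) ∧ ∃ Φ : ℝ≥0∞ → ℝ≥0∞, IsNFunction Φ ∧
      Function.LeftInverse Φ (inverseYoung a N p) ∧
      Function.RightInverse Φ (inverseYoung a N p) :=
  exists_nFunction_inverse (fun _ ht => h.weight_pos ht) h.continuousOn_weight
    (h.antitoneOn_weight hN hp) (h.integrableOn_weight hN hp hβN) (h.tendsto_weight hN hp)
    (h.tendsto_mul_weight hN hp hβN) (h.inverseYoung_eq N p)

/-- The integrand is decreasing, so the integral over `(0, r)` is at least `r` times its value at
`r`. This lower bound on `Φ⁻¹` is what the modular inequality uses. -/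
theorem le_inverseYoung (h : IsGrowthFunction a β C) (hN : 0 < N) (hp : 1 < p) {r : ℝ}
    (hr : 0 < r) :
    ENNReal.ofReal (r ^ (1 / p) * halfPrimitive (fun t => a t / t) (r ^ (-1 / N))) ≤
      inverseYoung a N p (ENNReal.ofReal r) := by
  have h1 : r ^ (1 / p) * halfPrimitive (fun t => a t / t) (r ^ (-1 / N)) =
      r * weight a N p r := by
    have h2 : r * r ^ (1 / p - 1) = r ^ (1 / p) := by
      rw [mul_comm, ← Real.rpow_add_one hr.ne', sub_add_cancel]
    rw [weight, conjExponent_neg_inv hp, mul_left_comm, h2, mul_comm]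
  rw [h1, h.inverseYoung_eq, below_ofReal, ENNReal.ofReal_mul hr.le]
  calc _ = ∫⁻ t in Ioo 0 r, ENNReal.ofReal (weight a N p r) := by
        rw [setLIntegral_const, Real.volume_Ioo, sub_zero, mul_comm]
    _ ≤ _ := setLIntegral_mono' measurableSet_Ioo fun t ht =>
        ENNReal.ofReal_le_ofReal (h.antitoneOn_weight hN hp ht.1 hr ht.2.le)

/-- Linear growth of `Φ⁻¹` bounds `s` by `c (1 + Φ(s))`; finite modulars therefore yield local
integrability and almost everywhere finiteness. -/
theorem exists_inverseYoung_le (h : IsGrowthFunction a β C) (hN : 0 < N) (hp : 1 < p)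
    (hβN : β < N / p) : ∃ c : ℝ≥0, ∀ u, inverseYoung a N p u ≤ c * (1 + u) := by
  have hfin : inverseYoung a N p 1 ≠ ∞ := by
    rw [h.inverseYoung_eq, ← ENNReal.ofReal_one, below_ofReal]
    exact ((h.integrableOn_weight hN hp hβN 1).lintegral_lt_top).ne
  refine ⟨(inverseYoung a N p 1).toNNReal + (weight a N p 1).toNNReal, fun u => ?_⟩
  have h1 : {t : ℝ | 0 < t ∧ ENNReal.ofReal t < u} ⊆
      {t : ℝ | 0 < t ∧ ENNReal.ofReal t < 1} ∪ {t : ℝ | 1 ≤ t ∧ ENNReal.ofReal t < u} := by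
    rintro t ⟨h0, ht⟩
    rcases lt_or_ge t 1 with h | h
    · exact Or.inl ⟨h0, ENNReal.ofReal_lt_one.2 h⟩
    · exact Or.inr ⟨h, ht⟩
  have hms : MeasurableSet {t : ℝ | 1 ≤ t ∧ ENNReal.ofReal t < u} :=
    (measurableSet_le measurable_const measurable_id).inter
      (measurableSet_lt ENNReal.measurable_ofReal measurable_const)
  have h2 : ∫⁻ t in {t : ℝ | 1 ≤ t ∧ ENNReal.ofReal t < u}, ENNReal.ofReal (weight a N p t) ≤
      ENNReal.ofReal (weight a N p 1) * u := by
    calc _ ≤ ∫⁻ t in {t : ℝ | 1 ≤ t ∧ ENNReal.ofReal t < u}, ENNReal.ofReal (weight a N p 1) :=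
          setLIntegral_mono' hms fun t ht => ENNReal.ofReal_le_ofReal
            (h.antitoneOn_weight hN hp (mem_Ioi.2 one_pos)
              (mem_Ioi.2 (one_pos.trans_le ht.1)) ht.1)
      _ ≤ _ := by
          rw [setLIntegral_const]
          gcongr
          refine (measure_mono ?_).trans (volume_below u).le
          exact fun t ht => ⟨one_pos.trans_le ht.1, ht.2⟩
  calc inverseYoung a N p u ≤ inverseYoung a N p 1 + ENNReal.ofReal (weight a N p 1) * u := by
        rw [h.inverseYoung_eq, h.inverseYoung_eq]
        exact (lintegral_mono_set h1).trans
          ((lintegral_union_le _ _ _).trans (add_le_add le_rfl h2))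
    _ ≤ inverseYoung a N p 1 * (1 + u) + ENNReal.ofReal (weight a N p 1) * (1 + u) := by
        gcongr
        · exact le_mul_of_one_le_right' le_self_add
        · exact le_add_self
    _ = _ := by
        rw [ENNReal.coe_add, ENNReal.coe_toNNReal hfin, add_mul]
        rfl

/-- Integrating over `(r, 2r)` suffices, since `a` is almost increasing. This presents the kernel as
a superposition of indicators of balls, in place of a dyadic decomposition. -/
theorem div_rpow_le_lintegral (h : IsGrowthFunction a β C) (hN : 0 < N) {r : ℝ} (hr : 0 < r) :
    ENNReal.ofReal (a r / r ^ N) ≤ ENNReal.ofReal (C * 2 ^ (N + 1)) *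
      ∫⁻ t in Ioi r, ENNReal.ofReal (a t * t ^ (-N - 1)) := by
  have hC := h.C_pos
  set c : ℝ := a r / C * (2 * r) ^ (-N - 1) with hc
  have h1 : ENNReal.ofReal (r * c) ≤ ∫⁻ t in Ioi r, ENNReal.ofReal (a t * t ^ (-N - 1)) := by
    rw [ENNReal.ofReal_mul hr.le]
    calc _ = ∫⁻ t in Ioo r (2 * r), ENNReal.ofReal c := by
          rw [setLIntegral_const, Real.volume_Ioo, mul_comm]
          congr 2
          ring
      _ ≤ ∫⁻ t in Ioo r (2 * r), ENNReal.ofReal (a t * t ^ (-N - 1)) := by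
          refine setLIntegral_mono' measurableSet_Ioo fun t ht => ENNReal.ofReal_le_ofReal ?_
          have ht0 : 0 < t := hr.trans ht.1
          refine mul_le_mul ?_ ?_ (by positivity) (h.pos t ht0).le
          · rw [div_le_iff₀' hC]
            exact h.le_of_le r t hr ht.1.le
          · exact Real.rpow_le_rpow_of_nonpos ht0 ht.2.le (by linarith)
      _ ≤ _ := lintegral_mono_set Ioo_subset_Ioi_self
  refine le_trans (le_of_eq ?_) (mul_le_mul_right h1 _)
  rw [← ENNReal.ofReal_mul (by positivity), hc, Real.mul_rpow two_pos.le hr.le,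
    show -N - 1 = -(N + 1) by ring, Real.rpow_neg two_pos.le, Real.rpow_neg hr.le,
    Real.rpow_add_one hr.ne']
  congr 1
  field_simp

theorem lintegral_tail_le (h : IsGrowthFunction a β C) {σ : ℝ} (hσ : β < σ) {δ : ℝ} (hδ : 0 < δ) :
    ∫⁻ t in Ioi δ, ENNReal.ofReal (a t * t ^ (-σ - 1)) ≤
      ENNReal.ofReal (C / (σ - β) * a δ * δ ^ (-σ)) := by
  have hC := h.C_pos
  have ha := h.pos δ hδ
  have h1 : ∀ t ∈ Ioi δ, a t * t ^ (-σ - 1) ≤ C * a δ * δ ^ (-β) * t ^ (β - σ - 1) := by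
    intro t ht
    have ht0 : 0 < t := hδ.trans ht
    have h2 := h.le_rpow δ t hδ (le_of_lt ht)
    rw [Real.div_rpow ht0.le hδ.le] at h2
    rw [show β - σ - 1 = β + (-σ - 1) by ring, Real.rpow_add ht0, Real.rpow_neg hδ.le]
    refine le_trans (mul_le_mul_of_nonneg_right h2 (by positivity)) (le_of_eq ?_)
    field_simp
  have hlt : β - σ - 1 < -1 := by linarith
  have hint : IntegrableOn (fun t : ℝ => C * a δ * δ ^ (-β) * t ^ (β - σ - 1)) (Ioi δ) :=
    (integrableOn_Ioi_rpow_of_lt hlt hδ).const_mul _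
  refine (setLIntegral_mono' measurableSet_Ioi fun t ht =>
    ENNReal.ofReal_le_ofReal (h1 t ht)).trans ?_
  rw [← ofReal_integral_eq_lintegral_ofReal hint, integral_const_mul,
    integral_Ioi_rpow_of_lt hlt hδ]
  · refine ENNReal.ofReal_le_ofReal (le_of_eq ?_)
    have e1 : δ ^ (-σ) = δ ^ (-β) * δ ^ (β - σ - 1 + 1) := by
      rw [← Real.rpow_add hδ]
      congr 1
      ring
    have e2 : β - σ - 1 + 1 = -(σ - β) := by ring
    have e3 : σ - β ≠ 0 := by linarith
    rw [e1, e2]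
    field_simp
  · filter_upwards [ae_restrict_mem measurableSet_Ioi] with t ht
    have ht0 : 0 < t := hδ.trans ht
    positivity

end IsGrowthFunction

end Growth

end HypergroupPotential

namespace HypergroupPotential

/-! ### Convolution with balls and Hedberg's estimate. -/

section Potential

open ProbabilityTheory

set_option linter.unusedSectionVars false

variable {K : Type*} [TopologicalSpace K] [T2Space K] [LocallyCompactSpace K]
  [MeasurableSpace K] [BorelSpace K] {H : Hypergroup K} {m : Measure K} {ρ : K → K → ℝ}

namespace Hypergroup

/-- The convolution with `δ_x` as a Markov kernel. -/
noncomputable def kernel (H : Hypergroup K) (x : K) : Kernel K K :=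
  ⟨H.pconv x, H.measurable_pconv_right x⟩

instance (H : Hypergroup K) (x : K) : IsMarkovKernel (H.kernel x) :=
  ⟨fun y => inferInstanceAs (IsProbabilityMeasure (H.pconv x y))⟩

/-- Haar invariance applied to the indicator of a Borel null set: almost every `δ_x * δ_y` gives it
measure zero. This allows `τ` to replace `ρ(e, ·)` inside translations. -/
theorem IsHaar.ae_ae_pconv (hm : H.IsHaar m) {P : K → Prop} (hP : ∀ᵐ z ∂m, P z) (x : K) :
    ∀ᵐ y ∂m, ∀ᵐ z ∂(H.pconv x y), P z := by
  set Z := toMeasurable m {z | ¬ P z} with hZ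
  have hZm : MeasurableSet Z := measurableSet_toMeasurable _ _
  have hZ0 : m Z = 0 := by
    rw [hZ, measure_toMeasurable]
    exact hP
  have h1 := hm.lintegral_translate x (Z.indicator 1) (measurable_one.indicator hZm)
  simp only [lintegral_indicator_one hZm, hZ0] at h1
  have hmz : Measurable fun y => H.pconv x y Z :=
    (Measure.measurable_coe hZm).comp (H.measurable_pconv_right x)
  rw [lintegral_eq_zero_iff hmz] at h1
  filter_upwards [h1] with y hy
  exact measure_mono_null (subset_toMeasurable _ _) hy

/-- For fixed `x` and `g` the convolution is the integral of `k` against one measure, so Tonelli's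
theorem applies in `z` and the radius. -/
theorem lconv_eq_lintegral_bind {k g : K → ℝ≥0∞} (hk : Measurable k) (hg : Measurable g) (x : K) :
    H.lconv m k g x = ∫⁻ z, k z ∂((m.withDensity g).bind (H.kernel x)) := by
  rw [Measure.lintegral_bind (H.kernel x).measurable.aemeasurable hk.aemeasurable]
  change _ = ∫⁻ y, ∫⁻ z, k z ∂(H.pconv x y) ∂(m.withDensity g)
  rw [lintegral_withDensity_eq_lintegral_mul _ hg (H.measurable_lintegral_pconv x hk)]
  refine lintegral_congr fun y => ?_
  rw [Pi.mul_apply, mul_comm]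

end Hypergroup

open Hypergroup

theorem exists_measurable_gauge (hρ : IsQuasiMetric ρ) (hd : IsDoubling ρ m) (x : K) :
    ∃ τ : K → ℝ, Measurable τ ∧ (∀ z, 0 ≤ τ z) ∧ ∀ᵐ z ∂m, τ z = ρ x z := by
  have h1 : NullMeasurable (ρ x) m := by
    have h2 : @Measurable (NullMeasurableSpace K m) ℝ _ _ (ρ x) :=
      measurable_of_Iio fun r => hd.nullMeasurableSet_qball x r
    exact h2
  have h2 := h1.aemeasurable
  refine ⟨fun z => max 0 (h2.mk _ z), measurable_const.max h2.measurable_mk,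
    fun z => le_max_left _ _, ?_⟩
  filter_upwards [h2.ae_eq_mk] with z hz
  rw [← hz, max_eq_right (hρ.nonneg x z)]

/-- The potential kernel with respect to a gauge `τ`, as a function with values in `[0, ∞]`. -/
noncomputable def gaugeKernel (a : ℝ → ℝ) (N : ℝ) (τ : K → ℝ) (z : K) : ℝ≥0∞ :=
  ENNReal.ofReal (a (τ z) / τ z ^ N)

theorem measurable_gaugeKernel {a : ℝ → ℝ} (ha : Measurable a) (N : ℝ) {τ : K → ℝ}
    (hτ : Measurable τ) : Measurable (gaugeKernel a N τ) :=
  ((ha.comp hτ).div (hτ.pow_const N)).ennreal_ofReal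

variable {a : ℝ → ℝ} {β C N p : ℝ} {τ : K → ℝ}

theorem lconv_gaugeKernel_le [SigmaFinite m] (h : IsGrowthFunction a β C)
    (hN : 0 < N)
    (hτm : Measurable τ) (hτ0 : ∀ z, 0 ≤ τ z) {g : K → ℝ≥0} (hg : Measurable g) (x : K) :
    H.lconv m (gaugeKernel a N τ) (fun y => g y) x ≤ ENNReal.ofReal (C * 2 ^ (N + 1)) *
      ∫⁻ t in Ioi (0 : ℝ), ENNReal.ofReal (a t * t ^ (-N - 1)) *
        H.lconv m ({z | τ z < t}.indicator 1) (fun y => g y) x := by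
  set b : ℝ → ℝ≥0∞ := fun t => ENNReal.ofReal (a t * t ^ (-N - 1)) with hb
  have hbm : Measurable b := (h.measurable.mul (measurable_id.pow_const _)).ennreal_ofReal
  set ν := (m.withDensity fun y => (g y : ℝ≥0∞)).bind (H.kernel x) with hν
  have hgm : Measurable fun y => (g y : ℝ≥0∞) := hg.coe_nnreal_ennreal
  have hset : ∀ t, MeasurableSet {z | τ z < t} := fun t => measurableSet_lt hτm measurable_const
  have hjoint : MeasurableSet {q : K × ℝ | τ q.1 < q.2} :=
    measurableSet_lt (hτm.comp measurable_fst) measurable_snd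
  have hk : ∀ z, gaugeKernel a N τ z ≤ ENNReal.ofReal (C * 2 ^ (N + 1)) *
      ∫⁻ t in Ioi (0 : ℝ), {q : K × ℝ | τ q.1 < q.2}.indicator (fun q => b q.2) (z, t) := by
    intro z
    -- At `τ z = 0` the kernel is `0`, by division by `0 ^ N = 0`, so the bound is trivial there.
    rcases (hτ0 z).eq_or_lt with h0 | h0
    · simp [gaugeKernel, ← h0, Real.zero_rpow hN.ne']
    · refine (h.div_rpow_le_lintegral hN h0).trans (mul_le_mul_right ?_ _)
      rw [← lintegral_indicator measurableSet_Ioi, ← lintegral_indicator measurableSet_Ioi]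
      refine lintegral_mono fun t => ?_
      by_cases ht : τ z < t
      · have ht0 : 0 < t := h0.trans ht
        simp [indicator, ht, ht0, hb]
      · simp [indicator, ht]
  rw [lconv_eq_lintegral_bind (measurable_gaugeKernel h.measurable N hτm) hgm]
  refine (lintegral_mono hk).trans ?_
  rw [lintegral_const_mul' _ _ ENNReal.ofReal_ne_top]
  refine mul_le_mul_right (le_of_eq ?_) _
  have hbj : Measurable (Function.uncurry fun (z : K) (t : ℝ) =>
      {q : K × ℝ | τ q.1 < q.2}.indicator (fun q => b q.2) (z, t)) :=
    (hbm.comp measurable_snd).indicator hjoint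
  rw [lintegral_lintegral_swap hbj.aemeasurable]
  refine lintegral_congr fun t => ?_
  rw [lconv_eq_lintegral_bind (measurable_one.indicator (hset t)) hgm, ← lintegral_const_mul _
    (measurable_one.indicator (hset t))]
  refine lintegral_congr fun z => ?_
  by_cases ht : τ z < t
  · simp [indicator, ht, hb]
  · simp [indicator, ht]

theorem measure_qball_e_le (hd : IsDoubling ρ m) {c₂ c₃ : ℝ} (hc₂ : 0 < c₂)
    (hsize : ∀ r, 0 < r → c₂ * m.real (qball ρ H.e r) ≤ c₃ * r ^ N) {t : ℝ} (ht : 0 < t) :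
    m (qball ρ H.e t) ≤ ENNReal.ofReal (c₃ / c₂ * t ^ N) := by
  rw [← ENNReal.ofReal_toReal (hd.measure_qball_lt_top H.e t).ne]
  refine ENNReal.ofReal_le_ofReal ?_
  rw [div_mul_eq_mul_div, le_div_iff₀ hc₂, mul_comm]
  exact hsize t ht

/-- Hölder's inequality. As `T^x χ ≤ 1`, its `p'`-th power is at most itself, and its integral is `m
B(e, t)`, at most a multiple of `t^N`. -/
theorem lconv_ball_le_rpow (hm : H.IsHaar m) (hd : IsDoubling ρ m) (hp : 1 < p)
    (hsize : SizeCondition H ρ m N) (hτm : Measurable τ) (hτ : ∀ᵐ z ∂m, τ z = ρ H.e z) :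
    ∃ D : ℝ≥0, ∀ g : K → ℝ≥0, Measurable g → ∀ x t, 0 < t →
      H.lconv m ({z | τ z < t}.indicator 1) (fun y => g y) x ≤
        D * ENNReal.ofReal (t ^ (N * (1 - 1 / p))) * (∫⁻ y, (g y : ℝ≥0∞) ^ p ∂m) ^ (1 / p) := by
  obtain ⟨c₂, c₃, hc₂, hc₃, hs⟩ := hsize
  have hpq := Real.HolderConjugate.conjExponent hp
  have hq : 1 / p.conjExponent = 1 - 1 / p := by
    have := IsGrowthFunction.conjExponent_neg_inv hp
    rw [neg_div] at this
    linarith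
  have hp0 : 0 < p := by linarith
  have hq0 : 0 ≤ 1 - 1 / p := by rw [sub_nonneg, div_le_one hp0]; exact hp.le
  refine ⟨((c₃ / c₂) ^ (1 - 1 / p)).toNNReal, fun g hg x t ht => ?_⟩
  have hset : MeasurableSet {z | τ z < t} := measurableSet_lt hτm measurable_const
  have hu : Measurable fun y => H.pconv x y {z | τ z < t} :=
    (Measure.measurable_coe hset).comp (H.measurable_pconv_right x)
  have h1 : H.lconv m ({z | τ z < t}.indicator 1) (fun y => g y) x =
      ∫⁻ y, ((fun y => (g y : ℝ≥0∞)) * fun y => H.pconv x y {z | τ z < t}) y ∂m := by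
    refine lintegral_congr fun y => ?_
    rw [lintegral_indicator_one hset, Pi.mul_apply, mul_comm]
  have h2 : ∫⁻ y, (H.pconv x y {z | τ z < t}) ^ p.conjExponent ∂m ≤
      ENNReal.ofReal (c₃ / c₂ * t ^ N) := by
    calc _ ≤ ∫⁻ y, H.pconv x y {z | τ z < t} ∂m := by
          refine lintegral_mono fun y => ?_
          exact (ENNReal.rpow_le_rpow_of_exponent_ge prob_le_one hpq.symm.lt.le).trans
            (ENNReal.rpow_one _).le
      _ = m {z | τ z < t} := by
          have := hm.lintegral_translate x ({z | τ z < t}.indicator 1)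
            (measurable_one.indicator hset)
          simpa only [lintegral_indicator_one hset] using this
      _ = m (qball ρ H.e t) := by
          refine measure_congr ?_
          filter_upwards [hτ] with z hz
          exact propext (by
            change τ z < t ↔ ρ H.e z < t
            rw [hz])
      _ ≤ _ := measure_qball_e_le hd hc₂ (fun r hr => (hs H.e H.e r hr).2) ht
  rw [h1]
  refine (ENNReal.lintegral_mul_le_Lp_mul_Lq m hpq hg.coe_nnreal_ennreal.aemeasurable
    hu.aemeasurable).trans ?_
  rw [mul_comm, hq]
  refine mul_le_mul_left ((ENNReal.rpow_le_rpow h2 hq0).trans (le_of_eq ?_)) _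
  rw [ENNReal.ofReal_rpow_of_nonneg (by positivity) hq0,
    Real.mul_rpow (by positivity) (by positivity), ENNReal.ofReal_mul (by positivity),
    ← Real.rpow_mul ht.le]
  rfl

/-- After the substitution `y ↦ y~` the translated indicator is `Λ_x`, which is at most `c₃ t^N / m
B(x, t)` and lives on `B(x, c₁ t)`. Doubling compares the two balls. -/
theorem lconv_ball_le_maximalFunction (hcomm : H.IsCommutative) (hm : H.IsHaar m)
    (hd : IsDoubling ρ m) (hsupp : SupportCondition H ρ)
    (hsize : SizeCondition H ρ m N) (hτm : Measurable τ) (hτ : ∀ᵐ z ∂m, τ z = ρ H.e z) :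
    ∃ D : ℝ≥0, ∀ f : K → ℝ≥0, Measurable f → ∀ x t, 0 < t →
      H.lconv m ({z | τ z < t}.indicator 1) (fun y => f (H.inv y)) x ≤
        D * ENNReal.ofReal (t ^ N) * maximalFunction ρ m (fun y => f y) x := by
  obtain ⟨c₂, c₃, hc₂, hc₃, hs⟩ := hsize
  obtain ⟨c₁, hc₁, hsup⟩ := hsupp
  obtain ⟨D, hD⟩ := hd.exists_dilation c₁
  have hinv := hm.measurePreserving_inv hcomm
  refine ⟨c₃.toNNReal * D, fun f hf x t ht => ?_⟩
  have hset : MeasurableSet {z | τ z < t} := measurableSet_lt hτm measurable_const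
  have hu : Measurable fun y => H.pconv x y {z | τ z < t} :=
    (Measure.measurable_coe hset).comp (H.measurable_pconv_right x)
  have h1 : H.lconv m ({z | τ z < t}.indicator 1) (fun y => f (H.inv y)) x =
      ∫⁻ y, H.pconv x (H.inv y) {z | τ z < t} * f y ∂m := by
    rw [← hinv.lintegral_comp (f := fun y => H.pconv x (H.inv y) {z | τ z < t} * f y)
      ((hu.comp hinv.measurable).mul hf.coe_nnreal_ennreal)]
    refine lintegral_congr fun y => ?_
    rw [lintegral_indicator_one hset, H.inv_inv]
  have hgood : ∀ᵐ y ∂m, ∀ᵐ z ∂(H.pconv x (H.inv y)), τ z = ρ H.e z :=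
    hinv.quasiMeasurePreserving.ae (hm.ae_ae_pconv hτ x)
  set M := m (qball ρ x t) with hM
  have hM0 : M ≠ 0 := (hd.measure_qball_pos x ht).ne'
  have hMtop : M ≠ ∞ := (hd.measure_qball_lt_top x t).ne
  have h2 : ∀ᵐ y ∂m, H.pconv x (H.inv y) {z | τ z < t} * f y ≤
      ENNReal.ofReal (c₃ * t ^ N) / M *
        (qball ρ x (c₁ * t)).indicator (fun y => (f y : ℝ≥0∞)) y := by
    filter_upwards [hgood] with y hy
    have hval : ballTranslate H ρ t x y = (H.pconv x (H.inv y) {z | τ z < t}).toReal := by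
      rw [ballTranslate, Hypergroup.translate, integral_congr_ae (g := {z | τ z < t}.indicator 1),
        integral_indicator_one hset]
      · rfl
      · filter_upwards [hy] with z hz
        have hiff : z ∈ qball ρ H.e t ↔ τ z < t := by
          rw [hz]
          rfl
        by_cases hzt : τ z < t
        · rw [indicator_of_mem (show z ∈ {z | τ z < t} from hzt),
            indicator_of_mem (hiff.2 hzt)]
        · rw [indicator_of_notMem (show z ∉ {z | τ z < t} from hzt),
            indicator_of_notMem (mt hiff.1 hzt)]
    have hmeas : H.pconv x (H.inv y) {z | τ z < t} = ENNReal.ofReal (ballTranslate H ρ t x y) := by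
      rw [hval, ENNReal.ofReal_toReal (measure_ne_top _ _)]
    rw [hmeas]
    by_cases hyB : y ∈ qball ρ x (c₁ * t)
    · rw [indicator_of_mem hyB]
      refine mul_le_mul_left ?_ _
      rw [ENNReal.le_div_iff_mul_le (Or.inl hM0) (Or.inl hMtop), mul_comm,
        ← ENNReal.ofReal_toReal hMtop, ← ENNReal.ofReal_mul ENNReal.toReal_nonneg]
      exact ENNReal.ofReal_le_ofReal ((hs x y t ht).1.trans (hs x y t ht).2)
    · have : ballTranslate H ρ t x y = 0 := by
        by_contra hne
        exact hyB (hsup x t ht hne)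
      rw [this]
      simp
  rw [h1]
  refine (lintegral_mono_ae h2).trans ?_
  have hfin : ENNReal.ofReal (c₃ * t ^ N) / M ≠ ∞ :=
    ENNReal.div_ne_top ENNReal.ofReal_ne_top hM0
  rw [lintegral_const_mul' _ _ hfin, lintegral_indicator₀ (hd.nullMeasurableSet_qball _ _)]
  calc ENNReal.ofReal (c₃ * t ^ N) / M * ∫⁻ y in qball ρ x (c₁ * t), f y ∂m
      ≤ ENNReal.ofReal (c₃ * t ^ N) / M * (D * M * maximalFunction ρ m (fun y => f y) x) := by
        gcongr
        refine (setLIntegral_qball_le hd _ x (by positivity)).trans ?_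
        gcongr
        exact hD x t ht
    _ = ENNReal.ofReal (c₃ * t ^ N) / M * M * (D * maximalFunction ρ m (fun y => f y) x) := by
        ring
    _ = _ := by
        rw [ENNReal.div_mul_cancel hM0 hMtop, ENNReal.ofReal_mul hc₃.le, ENNReal.coe_mul]
        change ENNReal.ofReal c₃ * _ * _ = ENNReal.ofReal c₃ * _ * _ * _
        ring

/-- Hedberg's pointwise estimate for the generalized potential. -/
theorem exists_hedberg_bound (hcomm : H.IsCommutative) (hm : H.IsHaar m)
    (hd : IsDoubling ρ m) (hsupp : SupportCondition H ρ)
    (hsize : SizeCondition H ρ m N) (h : IsGrowthFunction a β C) (hN : 0 < N) (hp : 1 < p)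
    (hβN : β < N / p) (hτm : Measurable τ) (hτ0 : ∀ z, 0 ≤ τ z)
    (hτ : ∀ᵐ z ∂m, τ z = ρ H.e z) :
    ∃ Q : ℝ≥0, ∀ f : K → ℝ≥0, Measurable f → ∀ x δ, 0 < δ →
      H.lconv m (gaugeKernel a N τ) (fun y => f (H.inv y)) x ≤
        Q * ENNReal.ofReal (halfPrimitive (fun t => a t / t) δ) *
          (maximalFunction ρ m (fun y => f y) x +
            ENNReal.ofReal (δ ^ (-(N / p))) * (∫⁻ y, (f y : ℝ≥0∞) ^ p ∂m) ^ (1 / p)) := by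
  have := hd.sigmaFinite
  obtain ⟨D₁, h1⟩ := lconv_ball_le_maximalFunction hcomm hm hd hsupp hsize hτm hτ
  obtain ⟨D₂, h2⟩ := lconv_ball_le_rpow hm hd hp hsize hτm hτ
  have hinv := hm.measurePreserving_inv hcomm
  have hC := h.C_pos
  have hσ : 0 < N / p - β := by linarith
  set E : ℝ := C / (N / p - β) * (2 * C * 2 ^ β) with hE
  refine ⟨(C * 2 ^ (N + 1)).toNNReal * (D₁ + D₂ * E.toNNReal), fun f hf x δ hδ => ?_⟩
  set A := halfPrimitive (fun t => a t / t) with hA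
  set M := maximalFunction ρ m (fun y => f y) x
  set F := (∫⁻ y, (f y : ℝ≥0∞) ^ p ∂m) ^ (1 / p) with hF
  have hFinv : (∫⁻ y, (f (H.inv y) : ℝ≥0∞) ^ p ∂m) ^ (1 / p) = F := by
    rw [hF, ← hinv.lintegral_comp (f := fun y => (f y : ℝ≥0∞) ^ p)
      (hf.coe_nnreal_ennreal.pow_const p)]
  set J : ℝ → ℝ≥0∞ := fun t => ENNReal.ofReal (a t * t ^ (-N - 1)) *
        H.lconv m ({z | τ z < t}.indicator 1) (fun y => f (H.inv y)) x with hJ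
  -- With the maximal bound the powers of `t` combine to `a(t)/t`, whose integral is `A(δ)`.
  have hsmall : ∫⁻ t in Ioo 0 δ, J t ≤ D₁ * M * ENNReal.ofReal (A δ) := by
    have hma : Measurable fun t => ENNReal.ofReal (a t / t) :=
      (h.measurable.div measurable_id).ennreal_ofReal
    rw [hA, ← setLIntegral_Ioo_eq h.div_nonneg h.integrableOn,
      ← lintegral_const_mul _ hma]
    refine setLIntegral_mono' measurableSet_Ioo fun t ht => ?_
    have ht0 : 0 < t := ht.1
    calc J t ≤ ENNReal.ofReal (a t * t ^ (-N - 1)) * (D₁ * ENNReal.ofReal (t ^ N) * M) := by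
          simp only [hJ]
          gcongr
          exact h1 f hf x t ht0
      _ = D₁ * M * (ENNReal.ofReal (a t * t ^ (-N - 1)) * ENNReal.ofReal (t ^ N)) := by ring
      _ = _ := by
          rw [← ENNReal.ofReal_mul (mul_nonneg (h.pos t ht0).le (by positivity)), mul_assoc (a t),
            ← Real.rpow_add ht0, show -N - 1 + N = -1 by ring, Real.rpow_neg_one, div_eq_mul_inv]
  -- With the Hölder bound the integrand becomes `a(t) t^(-N/p-1)`. Its tail is a multiple of `a(δ)
  -- δ^(-N/p)`, and `a(δ)` is absorbed into `A(δ)`; `E` collects both constants.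
  have hlarge : ∫⁻ t in Ioi δ, J t ≤
      D₂ * E.toNNReal * (ENNReal.ofReal (A δ) * (ENNReal.ofReal (δ ^ (-(N / p))) * F)) := by
    have hb : ∀ t ∈ Ioi δ, J t ≤ D₂ * F * ENNReal.ofReal (a t * t ^ (-(N / p) - 1)) := by
      intro t ht
      have ht0 : 0 < t := hδ.trans ht
      have h3 := h2 _ (hf.comp hinv.measurable) x t ht0
      simp only [Function.comp_apply, hFinv] at h3
      calc J t ≤ ENNReal.ofReal (a t * t ^ (-N - 1)) *
            (D₂ * ENNReal.ofReal (t ^ (N * (1 - 1 / p))) * F) := by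
            simp only [hJ]
            gcongr
        _ = D₂ * F * (ENNReal.ofReal (a t * t ^ (-N - 1)) *
            ENNReal.ofReal (t ^ (N * (1 - 1 / p)))) := by ring
        _ = _ := by
            rw [← ENNReal.ofReal_mul (mul_nonneg (h.pos t ht0).le (by positivity)),
              mul_assoc (a t), ← Real.rpow_add ht0,
              show -N - 1 + N * (1 - 1 / p) = -(N / p) - 1 by ring]
    refine (setLIntegral_mono' measurableSet_Ioi hb).trans ?_
    have hmb : Measurable fun t : ℝ => ENNReal.ofReal (a t * t ^ (-(N / p) - 1)) :=
      (h.measurable.mul (measurable_id.pow_const _)).ennreal_ofReal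
    rw [lintegral_const_mul _ hmb]
    have h4 : ENNReal.ofReal (C / (N / p - β) * a δ * δ ^ (-(N / p))) ≤
        E.toNNReal * (ENNReal.ofReal (A δ) * ENNReal.ofReal (δ ^ (-(N / p)))) := by
      change _ ≤ ENNReal.ofReal E * _
      have hAδ := h.halfPrimitive_nonneg hδ.le
      rw [← ENNReal.ofReal_mul hAδ, ← ENNReal.ofReal_mul (by positivity)]
      refine ENNReal.ofReal_le_ofReal ?_
      rw [← mul_assoc]
      refine mul_le_mul_of_nonneg_right ?_ (by positivity)
      rw [hE, mul_assoc (C / (N / p - β))]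
      exact mul_le_mul_of_nonneg_left (h.le_halfPrimitive hδ) (by positivity)
    calc _ ≤ D₂ * F * (E.toNNReal * (ENNReal.ofReal (A δ) * ENNReal.ofReal (δ ^ (-(N / p))))) := by
          gcongr
          exact (h.lintegral_tail_le hβN hδ).trans h4
      _ = _ := by ring
  have hsplit : ∫⁻ t in Ioi (0 : ℝ), J t ≤ (∫⁻ t in Ioo 0 δ, J t) + ∫⁻ t in Ioi δ, J t := by
    rw [← Ioc_union_Ioi_eq_Ioi hδ.le]
    refine (lintegral_union_le _ _ _).trans (add_le_add (le_of_eq ?_) le_rfl)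
    rw [restrict_Ioo_eq_restrict_Ioc]
  refine (lconv_gaugeKernel_le h hN hτm hτ0 (hf.comp hinv.measurable) x).trans ?_
  calc _ ≤ ENNReal.ofReal (C * 2 ^ (N + 1)) * (D₁ * M * ENNReal.ofReal (A δ) +
        D₂ * E.toNNReal * (ENNReal.ofReal (A δ) * (ENNReal.ofReal (δ ^ (-(N / p))) * F))) := by
        gcongr
        exact hsplit.trans (add_le_add hsmall hlarge)
    _ ≤ ENNReal.ofReal (C * 2 ^ (N + 1)) * ((D₁ + D₂ * E.toNNReal) * (ENNReal.ofReal (A δ) *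
        (M + ENNReal.ofReal (δ ^ (-(N / p))) * F))) := by
        gcongr
        calc _ = D₁ * (ENNReal.ofReal (A δ) * M) + D₂ * E.toNNReal *
              (ENNReal.ofReal (A δ) * (ENNReal.ofReal (δ ^ (-(N / p))) * F)) := by ring
          _ ≤ D₁ * (ENNReal.ofReal (A δ) * (M + ENNReal.ofReal (δ ^ (-(N / p))) * F)) +
              D₂ * E.toNNReal *
                (ENNReal.ofReal (A δ) * (M + ENNReal.ofReal (δ ^ (-(N / p))) * F)) := by
              gcongr
              · exact le_self_add
              · exact le_add_self
          _ = _ := by ring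
    _ = _ := by
        rw [ENNReal.coe_mul, ENNReal.coe_add, ENNReal.coe_mul]
        change ENNReal.ofReal _ * _ = ENNReal.ofReal _ * _ * _ * _
        ring

end Potential

end HypergroupPotential

namespace HypergroupPotential

/-! ### The modular inequality and the passage to real-valued functions. -/

section Boundedness

set_option linter.unusedSectionVars false

variable {K : Type*} [TopologicalSpace K] [T2Space K] [LocallyCompactSpace K]
  [MeasurableSpace K] [BorelSpace K] {H : Hypergroup K} {m : Measure K} {ρ : K → K → ℝ}
  {k : K → ℝ≥0∞} {A : ℝ → ℝ} {N p : ℝ} {Q : ℝ≥0}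

/-- Hedberg's pointwise estimate for the convolution with the kernel `k`. -/
def HedbergBound (H : Hypergroup K) (m : Measure K) (ρ : K → K → ℝ) (k : K → ℝ≥0∞)
    (A : ℝ → ℝ) (N p : ℝ) (Q : ℝ≥0) : Prop :=
  ∀ f : K → ℝ≥0, Measurable f → ∀ x δ, 0 < δ →
    H.lconv m k (fun y => f (H.inv y)) x ≤ Q * ENNReal.ofReal (A δ) *
      (maximalFunction ρ m (fun y => f y) x +
        ENNReal.ofReal (δ ^ (-(N / p))) * (∫⁻ y, (f y : ℝ≥0∞) ^ p ∂m) ^ (1 / p))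

theorem maximalFunction_indicator_le_one (S : Set K) (x : K) :
    maximalFunction ρ m (fun y => ((S.indicator 1 y : ℝ≥0) : ℝ≥0∞)) x ≤ 1 := by
  refine iSup₂_le fun r _ => ENNReal.div_le_of_le_mul ?_
  rw [one_mul]
  calc _ ≤ ∫⁻ _ in qball ρ x r, 1 ∂m := by
        refine lintegral_mono fun y => ?_
        by_cases hy : y ∈ S <;> simp [hy]
    _ = _ := by rw [setLIntegral_const, one_mul]

/-- Hedberg's estimate with `δ = 1` is tested on indicators of finite-measure sets exhausting `K`:
their maximal functions are at most `1` and their `L^p` norms are finite. -/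
theorem HedbergBound.ae_lintegral_pconv_lt_top [SigmaFinite m]
    (hinv : MeasurePreserving H.inv m m) (hp : 1 < p) (hk : Measurable k)
    (hQ : HedbergBound H m ρ k A N p Q) (x : K) :
    ∀ᵐ y ∂m, ∫⁻ z, k z ∂(H.pconv x y) < ∞ := by
  have hp0 : 0 < p := one_pos.trans hp
  have h1 : ∀ n : ℕ, ∀ᵐ y ∂m, (∫⁻ z, k z ∂(H.pconv x y)) *
      (((spanningSets m n).indicator 1 (H.inv y) : ℝ≥0) : ℝ≥0∞) < ∞ := by
    intro n
    have hS := measurableSet_spanningSets m n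
    have hf : Measurable ((spanningSets m n).indicator (1 : K → ℝ≥0)) :=
      measurable_one.indicator hS
    refine ae_lt_top ((H.measurable_lintegral_pconv x hk).mul
      (hf.comp hinv.measurable).coe_nnreal_ennreal) ?_
    refine ((hQ _ hf x 1 one_pos).trans_lt (ENNReal.mul_lt_top
      (ENNReal.mul_lt_top ENNReal.coe_lt_top ENNReal.ofReal_lt_top)
      (ENNReal.add_lt_top.2 ⟨(maximalFunction_indicator_le_one _ _).trans_lt ENNReal.one_lt_top,
        ENNReal.mul_lt_top ENNReal.ofReal_lt_top
          (ENNReal.rpow_lt_top_of_nonneg (by positivity) (ne_of_lt ?_))⟩))).ne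
    calc _ = ∫⁻ y, (spanningSets m n).indicator 1 y ∂m := by
          refine lintegral_congr fun y => ?_
          by_cases hy : y ∈ spanningSets m n <;> simp [hy, hp0]
      _ = m (spanningSets m n) := lintegral_indicator_one hS
      _ < ∞ := measure_spanningSets_lt_top m n
  filter_upwards [ae_all_iff.2 h1] with y hy
  obtain ⟨n, hn⟩ := mem_iUnion.1 ((iUnion_spanningSets m).symm ▸ mem_univ (H.inv y))
  simpa [hn] using hy n

theorem ae_eq_zero_of_maximalFunction_eq_zero (hd : IsDoubling ρ m) {g : K → ℝ≥0∞}
    (hg : Measurable g) {x : K} (hx : maximalFunction ρ m g x = 0) : ∀ᵐ y ∂m, g y = 0 := by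
  refine (lintegral_eq_zero_iff hg).1 ?_
  have hU : ⋃ n : ℕ, qball ρ x (n + 1) = univ := by
    refine eq_univ_of_forall fun y => ?_
    obtain ⟨n, hn⟩ := exists_nat_gt (ρ x y)
    exact mem_iUnion.2 ⟨n, show ρ x y < n + 1 by linarith⟩
  rw [← setLIntegral_univ, ← hU, ← nonpos_iff_eq_zero]
  refine (lintegral_iUnion_le _ _).trans (le_of_eq (ENNReal.tsum_eq_zero.2 fun n => ?_))
  have := setLIntegral_qball_le hd g x (r := n + 1) (by positivity)
  rwa [hx, mul_zero, nonpos_iff_eq_zero] at this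

variable {a : ℝ → ℝ} {β C : ℝ} {Φ : ℝ≥0∞ → ℝ≥0∞}

theorem monotone_of_strictMono_rightInverse {W : ℝ≥0∞ → ℝ≥0∞} (hW : StrictMono W)
    (hR : Function.RightInverse Φ W) : Monotone Φ := fun u v huv => by
  rwa [← hW.le_iff_le, hR u, hR v]

/-- The modular inequality for the convolution with a kernel satisfying Hedberg's estimate. -/
theorem HedbergBound.exists_modular_le (hinv : MeasurePreserving H.inv m m)
    (hρ : IsQuasiMetric ρ) (hd : IsDoubling ρ m) (h : IsGrowthFunction a β C) (hN : 0 < N)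
    (hp : 1 < p) (hQ : HedbergBound H m ρ k (halfPrimitive fun t => a t / t) N p Q)
    (hΦ : Monotone Φ) (hL : Function.LeftInverse Φ (inverseYoung a N p)) :
    ∃ B : ℝ, 0 < B ∧ ∀ f : K → ℝ≥0, Measurable f → ∀ s : ℝ, 0 < s →
      (∫⁻ y, (f y : ℝ≥0∞) ^ p ∂m) ^ (1 / p) ≤ ENNReal.ofReal s →
      ∫⁻ x, Φ (H.lconv m k (fun y => f (H.inv y)) x / ENNReal.ofReal (B * s)) ∂m ≤ 1 := by
  have hp0 : 0 < p := one_pos.trans hp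
  obtain ⟨D₀, hD₀⟩ := maximalFunction_strong_type hρ hd hp
  set A := halfPrimitive fun t => a t / t with hA
  -- Requiring `D ≥ 1` ensures `r ≤ u^p` below, hence `δ ≤ r^(-1/N)`.
  set D : ℝ := max D₀ 1 with hD
  have hD1 : 1 ≤ D := le_max_right _ _
  have hD0 : 0 < D := one_pos.trans_le hD1
  set d : ℝ := D ^ (1 / p) with hdd
  have hd0 : 0 < d := by positivity
  refine ⟨2 * (Q + 1) * d, by positivity, fun f hf s hs hfs => ?_⟩
  have hc : ENNReal.ofReal (D * s ^ p) ≠ 0 := by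
    rw [Ne, ENNReal.ofReal_eq_zero, not_le]
    positivity
  have hpt : ∀ x, Φ (H.lconv m k (fun y => f (H.inv y)) x /
      ENNReal.ofReal (2 * (Q + 1) * d * s)) ≤
      (maximalFunction ρ m (fun y => f y) x) ^ p / ENNReal.ofReal (D * s ^ p) := by
    intro x
    set M := maximalFunction ρ m (fun y => f y) x with hM
    rcases eq_or_ne M ∞ with hMt | hMt
    · rw [hMt, ENNReal.top_rpow_of_pos hp0, ENNReal.top_div_of_ne_top ENNReal.ofReal_ne_top]
      exact le_top
    rcases eq_or_ne M 0 with hM0 | hM0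
    · have h0 := ae_eq_zero_of_maximalFunction_eq_zero hd hf.coe_nnreal_ennreal hM0
      have h1 : H.lconv m k (fun y => f (H.inv y)) x = 0 := by
        refine lintegral_eq_zero_of_ae_eq_zero ?_
        filter_upwards [hinv.quasiMeasurePreserving.ae h0] with y hy
        simp only [hy, mul_zero, Pi.zero_apply]
      have h2 : inverseYoung a N p 0 = 0 := by simp [inverseYoung]
      have h3 := hL 0
      rw [h2] at h3
      rw [h1, ENNReal.zero_div, h3]
      exact zero_le
    set M' := M.toReal with hM'
    have hMr : M = ENNReal.ofReal M' := (ENNReal.ofReal_toReal hMt).symm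
    have hM'0 : 0 < M' := ENNReal.toReal_pos hM0 hMt
    set u := M' / s with hu
    have hu0 : 0 < u := by positivity
    -- This choice makes `δ^(-N/p) s` equal to the maximal function, so both terms of Hedberg's
    -- bound coincide.
    set δ := u ^ (-p / N) with hδ
    have hδ0 : 0 < δ := by positivity
    -- Dividing by `D` normalizes the final integral to at most `1`; the price is the factor `d =
    -- D^(1/p)` in the constant.
    set r := u ^ p / D with hr
    have hr0 : 0 < r := by positivity
    have hδu : δ ^ (-(N / p)) = u := by
      rw [hδ, ← Real.rpow_mul hu0.le, show -p / N * -(N / p) = 1 by field_simp, Real.rpow_one]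
    have hus : u * s = M' := div_mul_cancel₀ _ hs.ne'
    have hAδ := h.halfPrimitive_nonneg hδ0.le
    rw [← hA] at hAδ
    have hr1 : r ^ (1 / p) = u / d := by
      rw [hr, Real.div_rpow (by positivity) hD0.le, ← Real.rpow_mul hu0.le,
        mul_one_div_cancel hp0.ne', Real.rpow_one]
    have hr2 : δ ≤ r ^ (-1 / N) := by
      have h1 : u ^ p ≥ r := div_le_self (by positivity) hD1
      have h2 : -1 / N ≤ 0 := by
        rw [neg_div]
        exact neg_nonpos.2 (by positivity)
      have h3 := Real.rpow_le_rpow_of_nonpos hr0 h1 h2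
      rwa [← Real.rpow_mul hu0.le, show p * (-1 / N) = -p / N by ring] at h3
    have hle : H.lconv m k (fun y => f (H.inv y)) x / ENNReal.ofReal (2 * (Q + 1) * d * s) ≤
        inverseYoung a N p (ENNReal.ofReal r) := by
      refine le_trans ?_ (h.le_inverseYoung hN hp hr0)
      refine ENNReal.div_le_of_le_mul ?_
      refine (hQ f hf x δ hδ0).trans ?_
      calc _ ≤ Q * ENNReal.ofReal (A δ) * (ENNReal.ofReal M' +
            ENNReal.ofReal u * ENNReal.ofReal s) := by
            rw [hδu, ← hMr]
            gcongr
        _ = ENNReal.ofReal (Q * A δ * (M' + M')) := by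
            rw [← ENNReal.ofReal_mul hu0.le, hus, ← ENNReal.ofReal_add hM'0.le hM'0.le,
              ENNReal.ofReal_mul (by positivity), ENNReal.ofReal_mul (by positivity),
              ENNReal.ofReal_coe_nnreal]
        _ ≤ ENNReal.ofReal (r ^ (1 / p) * A (r ^ (-1 / N)) * (2 * (Q + 1) * d * s)) := by
            refine ENNReal.ofReal_le_ofReal ?_
            have h1 : A δ ≤ A (r ^ (-1 / N)) := halfPrimitive_mono h.div_nonneg h.integrableOn hr2
            rw [hr1]
            calc _ ≤ ((Q : ℝ) + 1) * A (r ^ (-1 / N)) * (M' + M') := by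
                  gcongr
                  linarith
              _ = _ := by
                  rw [← hus]
                  field_simp
                  ring
        _ = _ := ENNReal.ofReal_mul
            (mul_nonneg (by positivity) (h.halfPrimitive_nonneg (by positivity)))
    refine (hΦ hle).trans ?_
    rw [hL, hMr, ENNReal.ofReal_rpow_of_pos hM'0, ← ENNReal.ofReal_div_of_pos (by positivity)]
    refine ENNReal.ofReal_le_ofReal (le_of_eq ?_)
    rw [hr, hu, Real.div_rpow hM'0.le hs.le]
    field_simp
  refine (lintegral_mono hpt).trans ?_
  simp_rw [div_eq_mul_inv]
  rw [lintegral_mul_const' _ _ (ENNReal.inv_ne_top.2 hc), ← div_eq_mul_inv]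
  refine ENNReal.div_le_of_le_mul ?_
  rw [one_mul, ENNReal.ofReal_mul hD0.le]
  refine (hD₀ f hf).trans (mul_le_mul' ?_ ?_)
  · rw [← ENNReal.ofReal_coe_nnreal]
    exact ENNReal.ofReal_le_ofReal (le_max_left _ _)
  · have h1 := ENNReal.rpow_le_rpow hfs hp0.le
    rwa [← ENNReal.rpow_mul, one_div_mul_cancel hp0.ne', ENNReal.rpow_one,
      ENNReal.ofReal_rpow_of_pos hs] at h1

section Translate

variable {τ : K → ℝ}

theorem ae_translate_eq (hm : H.IsHaar m) (h : IsGrowthFunction a β C)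
    (ha : ∀ r, 0 ≤ r → 0 ≤ a r) (hτm : Measurable τ) (hτ0 : ∀ z, 0 ≤ τ z)
    (hτ : ∀ᵐ z ∂m, τ z = ρ H.e z) {x : K}
    (hx : ∀ᵐ y ∂m, ∫⁻ z, gaugeKernel a N τ z ∂(H.pconv x y) < ∞) :
    ∀ᵐ y ∂m, Integrable (potentialKernel H ρ N a) (H.pconv x y) ∧
      H.translate x (potentialKernel H ρ N a) y =
        (∫⁻ z, gaugeKernel a N τ z ∂(H.pconv x y)).toReal := by
  filter_upwards [hx, hm.ae_ae_pconv hτ x] with y hy hy'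
  set q : K → ℝ := fun z => a (τ z) / τ z ^ N with hq
  have hqm : Measurable q := (h.measurable.comp hτm).div (hτm.pow_const N)
  have hq0 : ∀ z, 0 ≤ q z := fun z => div_nonneg (ha _ (hτ0 z)) (Real.rpow_nonneg (hτ0 z) _)
  have he : potentialKernel H ρ N a =ᵐ[H.pconv x y] q := by
    filter_upwards [hy'] with z hz
    simp only [potentialKernel, hq, hz]
  refine ⟨?_, ?_⟩
  · refine Integrable.congr ?_ he.symm
    exact (lintegral_ofReal_ne_top_iff_integrable hqm.aestronglyMeasurable
      (ae_of_all _ hq0)).1 hy.ne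
  · rw [Hypergroup.translate, integral_congr_ae he, integral_eq_lintegral_of_nonneg_ae
      (ae_of_all _ hq0) hqm.aestronglyMeasurable]
    rfl

variable {T : K → ℝ≥0∞} {w : K → ℝ} {f f₀ : K → ℝ}

theorem lintegral_enorm_mul_comp_inv (hinv : MeasurePreserving H.inv m m)
    (hT : ∀ᵐ y ∂m, T y < ∞) (hw : ∀ᵐ y ∂m, w y = (T y).toReal) (hf : f =ᵐ[m] f₀) :
    ∫⁻ y, ‖w y * f (H.inv y)‖ₑ ∂m = ∫⁻ y, T y * ‖f₀ (H.inv y)‖₊ ∂m := by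
  refine lintegral_congr_ae ?_
  filter_upwards [hT, hw, hinv.quasiMeasurePreserving.ae hf] with y h1 h2 h3
  rw [enorm_mul, h2, h3, Real.enorm_of_nonneg ENNReal.toReal_nonneg, ENNReal.ofReal_toReal h1.ne]
  rfl

/-- Splitting `f₀` into positive and negative parts writes the integral through two nonnegative
convolutions, whose measurability in `x` is already known. -/
theorem integrable_mul_comp_inv (hinv : MeasurePreserving H.inv m m) (hTm : Measurable T)
    (hT : ∀ᵐ y ∂m, T y < ∞) (hw : ∀ᵐ y ∂m, w y = (T y).toReal) (hf₀ : Measurable f₀)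
    (hf : f =ᵐ[m] f₀) (hfin : ∫⁻ y, T y * ‖f₀ (H.inv y)‖₊ ∂m < ∞) :
    Integrable (fun y => w y * f (H.inv y)) m ∧
      ∫ y, w y * f (H.inv y) ∂m = (∫⁻ y, T y * (f₀ (H.inv y)).toNNReal ∂m).toReal -
        (∫⁻ y, T y * (-f₀ (H.inv y)).toNNReal ∂m).toReal := by
  have he : (fun y => w y * f (H.inv y)) =ᵐ[m] fun y => (T y).toReal * f₀ (H.inv y) := by
    filter_upwards [hw, hinv.quasiMeasurePreserving.ae hf] with y h2 h3
    rw [h2, h3]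
  have hmeas : Measurable fun y => (T y).toReal * f₀ (H.inv y) :=
    hTm.ennreal_toReal.mul (hf₀.comp hinv.measurable)
  have hi : Integrable (fun y => w y * f (H.inv y)) m := by
    refine ⟨hmeas.aestronglyMeasurable.congr he.symm, ?_⟩
    rw [HasFiniteIntegral, lintegral_enorm_mul_comp_inv hinv hT hw hf]
    exact hfin
  refine ⟨hi, ?_⟩
  rw [integral_congr_ae he, integral_eq_lintegral_pos_part_sub_lintegral_neg_part (hi.congr he)]
  congr 2
  · refine lintegral_congr_ae ?_
    filter_upwards [hT] with y h1
    rw [ENNReal.ofReal_mul ENNReal.toReal_nonneg, ENNReal.ofReal_toReal h1.ne]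
    rfl
  · refine lintegral_congr_ae ?_
    filter_upwards [hT] with y h1
    rw [← mul_neg, ENNReal.ofReal_mul ENNReal.toReal_nonneg, ENNReal.ofReal_toReal h1.ne]
    rfl

end Translate

/-- A function dominated by `F` with `∫ Φ(F / η) ≤ 1`, where `Φ` has an inverse of at most linear
growth, is locally integrable. -/
theorem locallyIntegrable_of_modular_le [m.Regular] {F : K → ℝ≥0∞} {I : K → ℝ} {η : ℝ}
    {W : ℝ≥0∞ → ℝ≥0∞} {c : ℝ≥0} (hη : 0 < η) (hI : AEStronglyMeasurable I m)
    (hIF : ∀ x, ‖I x‖ₑ ≤ F x) (hW : ∀ u, W u ≤ c * (1 + u)) (hR : Function.RightInverse Φ W)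
    (hF : ∫⁻ x, Φ (F x / ENNReal.ofReal η) ∂m ≤ 1) : LocallyIntegrable I m := by
  intro x
  obtain ⟨s, hs, hsm⟩ := m.finiteAt_nhds x
  refine ⟨s, hs, hI.restrict, ?_⟩
  have hη0 : ENNReal.ofReal η ≠ 0 := by simpa using hη
  have hb : ∀ y, ‖I y‖ₑ ≤ ENNReal.ofReal η * c * (1 + Φ (F y / ENNReal.ofReal η)) := by
    intro y
    refine (hIF y).trans ?_
    have h1 := hW (Φ (F y / ENNReal.ofReal η))
    rw [hR, ENNReal.div_le_iff hη0 ENNReal.ofReal_ne_top] at h1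
    exact h1.trans (le_of_eq (by ring))
  calc _ ≤ ∫⁻ y in s, ENNReal.ofReal η * c * (1 + Φ (F y / ENNReal.ofReal η)) ∂m :=
        lintegral_mono hb
    _ = ENNReal.ofReal η * c * (m s + ∫⁻ y in s, Φ (F y / ENNReal.ofReal η) ∂m) := by
        rw [lintegral_const_mul' _ _ (ENNReal.mul_ne_top ENNReal.ofReal_ne_top ENNReal.coe_ne_top),
          lintegral_add_left measurable_const, setLIntegral_const, one_mul]
    _ ≤ ENNReal.ofReal η * c * (m s + 1) := by
        gcongr
        exact (setLIntegral_le_lintegral _ _).trans hF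
    _ < ∞ := ENNReal.mul_lt_top (ENNReal.mul_lt_top ENNReal.ofReal_lt_top ENNReal.coe_lt_top)
        (ENNReal.add_lt_top.2 ⟨hsm, ENNReal.one_lt_top⟩)

theorem ae_lt_top_of_modular_le {F : K → ℝ≥0∞} {η : ℝ}
    {W : ℝ≥0∞ → ℝ≥0∞} {c : ℝ≥0} (hη : 0 < η) (hFm : Measurable F) (hΦ : Monotone Φ)
    (hW : ∀ u, W u ≤ c * (1 + u)) (hR : Function.RightInverse Φ W)
    (hF : ∫⁻ x, Φ (F x / ENNReal.ofReal η) ∂m ≤ 1) : ∀ᵐ x ∂m, F x < ∞ := by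
  have hη0 : ENNReal.ofReal η ≠ 0 := by simpa using hη
  filter_upwards [ae_lt_top (hΦ.measurable.comp (hFm.div_const (ENNReal.ofReal η)))
    (hF.trans_lt ENNReal.one_lt_top).ne] with x hx
  have h1 := hW (Φ (F x / ENNReal.ofReal η))
  rw [hR, ENNReal.div_le_iff hη0 ENNReal.ofReal_ne_top] at h1
  exact h1.trans_lt (ENNReal.mul_lt_top (ENNReal.mul_lt_top ENNReal.coe_lt_top
    (ENNReal.add_lt_top.2 ⟨ENNReal.one_lt_top, hx⟩)) ENNReal.ofReal_lt_top)

end Boundedness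

end HypergroupPotential

/-! ### Boundedness of the generalized fractional integral. -/

theorem theorem1 {K : Type*} [TopologicalSpace K] [T2Space K] [LocallyCompactSpace K]
    [MeasurableSpace K] [BorelSpace K]
    (H : Hypergroup K) (hcomm : H.IsCommutative)
    (m : Measure K) (hm : H.IsHaar m)
    (ρ : K → K → ℝ) (hρ : IsQuasiMetric ρ) (hdoubling : IsDoubling ρ m)
    (N : ℝ) (hsupp : SupportCondition H ρ) (hsize : SizeCondition H ρ m N)
    (p : ℝ) (hp : 1 < p)
    (a : ℝ → ℝ) (ha_meas : Measurable a) (ha_nonneg : ∀ r, 0 ≤ r → 0 ≤ a r)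
    (ha_ne : ∃ r, 0 < r ∧ a r ≠ 0)
    (ha_incr : AlmostIncreasing a)
    (β : ℝ) (hβ : 0 < β) (hβN : β < N / p) (ha_decr : AlmostDecreasing fun r => a r / r ^ β)
    (ha_int : ∫⁻ t in Ioo (0 : ℝ) 1, ENNReal.ofReal (a t / t) < ∞) :
    ∃ Φ : ℝ≥0∞ → ℝ≥0∞, IsNFunction Φ ∧
      Function.LeftInverse Φ (inverseYoung a N p) ∧
      Function.RightInverse Φ (inverseYoung a N p) ∧
      (∀ x, ∀ᵐ y ∂m, Integrable (potentialKernel H ρ N a) (H.pconv x y)) ∧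
      ∃ C : ℝ, 0 < C ∧ ∀ f : K → ℝ, MemLp f (ENNReal.ofReal p) m →
        (∀ᵐ x ∂m, Integrable
          (fun y => H.translate x (potentialKernel H ρ N a) y * f (H.inv y)) m) ∧
        MemOrlicz Φ m (fracIntegral H ρ m N a f) ∧
        orliczNorm Φ m (fracIntegral H ρ m N a f) ≤
          ENNReal.ofReal C * eLpNorm f (ENNReal.ofReal p) m := by
  have hp0 : 0 < p := one_pos.trans hp
  have hN : 0 < N := by
    have := hβ.trans hβN
    rwa [lt_div_iff₀ hp0, zero_mul] at this
  have hσ := hdoubling.sigmaFinite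
  have hreg := hm.regular
  have hinv := hm.measurePreserving_inv hcomm
  obtain ⟨C, h⟩ := exists_isGrowthFunction ha_meas ha_nonneg ha_ne hβ ha_incr ha_decr ha_int
  obtain ⟨hWmono, Φ, hΦN, hL, hR⟩ := h.exists_nFunction hN hp hβN
  have hΦ := monotone_of_strictMono_rightInverse hWmono hR
  obtain ⟨c, hc⟩ := h.exists_inverseYoung_le hN hp hβN
  obtain ⟨τ, hτm, hτ0, hτ⟩ := exists_measurable_gauge hρ hdoubling H.e
  obtain ⟨Q, hQ⟩ := exists_hedberg_bound hcomm hm hdoubling hsupp hsize h hN hp hβN hτm hτ0 hτ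
  replace hQ : HedbergBound H m ρ (gaugeKernel a N τ) (halfPrimitive fun t => a t / t) N p Q := hQ
  have hkm := measurable_gaugeKernel ha_meas N hτm
  have hT := hQ.ae_lintegral_pconv_lt_top hinv hp hkm
  have htr := fun x => ae_translate_eq hm h ha_nonneg hτm hτ0 hτ (hT x)
  obtain ⟨B, hB, hmod⟩ := hQ.exists_modular_le hinv hρ hdoubling h hN hp hΦ hL
  refine ⟨Φ, hΦN, hL, hR, fun x => (htr x).mono fun y hy => hy.1, B, hB, fun f hf => ?_⟩
  set f₀ := hf.1.mk f with hf₀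
  have hf₀m : Measurable f₀ := hf.1.stronglyMeasurable_mk.measurable
  have hff₀ : f =ᵐ[m] f₀ := hf.1.ae_eq_mk
  have hnm : Measurable fun y => ‖f₀ y‖₊ := hf₀m.nnnorm
  have hF0 : (∫⁻ y, (‖f₀ y‖₊ : ℝ≥0∞) ^ p ∂m) ^ (1 / p) = eLpNorm f (ENNReal.ofReal p) m := by
    rw [eLpNorm_congr_ae hff₀, eLpNorm_eq_lintegral_rpow_enorm_toReal (by simpa using hp0)
      ENNReal.ofReal_ne_top, ENNReal.toReal_ofReal hp0.le]
    rfl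
  set F : K → ℝ≥0∞ := H.lconv m (gaugeKernel a N τ) fun y => ‖f₀ (H.inv y)‖₊ with hF
  have hlm : ∀ g : K → ℝ≥0, Measurable g →
      Measurable (H.lconv m (gaugeKernel a N τ) fun y => g (H.inv y)) := fun g hg =>
    hm.measurable_lconv hkm (hg.comp hinv.measurable).coe_nnreal_ennreal
  have hFm : Measurable F := hlm _ hnm
  have hIF : ∀ x, ‖fracIntegral H ρ m N a f x‖ₑ ≤ F x := fun x =>
    (enorm_integral_le_lintegral_enorm _).trans (lintegral_enorm_mul_comp_inv hinv (hT x)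
      ((htr x).mono fun y hy => hy.2) hff₀).le
  have hnorm : eLpNorm f (ENNReal.ofReal p) m < ∞ := hf.2
  have hmodF : ∀ s : ℝ, 0 < s → eLpNorm f (ENNReal.ofReal p) m ≤ ENNReal.ofReal s →
      ∫⁻ x, Φ (F x / ENNReal.ofReal (B * s)) ∂m ≤ 1 := fun s hs hle =>
    hmod _ hnm s hs (hF0.le.trans hle)
  have hmodI : ∀ s : ℝ, 0 < s → eLpNorm f (ENNReal.ofReal p) m ≤ ENNReal.ofReal s →
      orliczModular Φ m (fracIntegral H ρ m N a f) (B * s) ≤ 1 := fun s hs hle => by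
    refine (lintegral_mono fun x => hΦ ?_).trans (hmodF s hs hle)
    rw [ENNReal.ofReal_div_of_pos (by positivity), ← Real.norm_eq_abs, ofReal_norm]
    exact ENNReal.div_le_div_right (hIF x) _
  -- The `+ 1` keeps the scale positive when `f` vanishes almost everywhere.
  set s₀ : ℝ := (eLpNorm f (ENNReal.ofReal p) m).toReal + 1 with hs₀
  have hs₀pos : 0 < s₀ := by positivity
  have hs₀le : eLpNorm f (ENNReal.ofReal p) m ≤ ENNReal.ofReal s₀ := by
    rw [← ENNReal.ofReal_toReal hnorm.ne]
    exact ENNReal.ofReal_le_ofReal (by simp [hs₀])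
  have hη : 0 < B * s₀ := by positivity
  have hFfin := ae_lt_top_of_modular_le hη hFm hΦ hc hR (hmodF s₀ hs₀pos hs₀le)
  have hint := fun x (hx : F x < ∞) => integrable_mul_comp_inv hinv
    (H.measurable_lintegral_pconv x hkm) (hT x) ((htr x).mono fun y hy => hy.2) hf₀m hff₀ hx
  have hmeas : AEStronglyMeasurable (fracIntegral H ρ m N a f) m := by
    have h1 := ((hlm _ hf₀m.real_toNNReal).ennreal_toReal.sub
      (hlm _ hf₀m.neg.real_toNNReal).ennreal_toReal).aestronglyMeasurable (μ := m)
    refine h1.congr ?_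
    filter_upwards [hFfin] with x hx using (hint x hx).2.symm
  refine ⟨hFfin.mono fun x hx => (hint x hx).1, ⟨?_, B * s₀, hη,
    (hmodI s₀ hs₀pos hs₀le).trans_lt ENNReal.one_lt_top⟩, ?_⟩
  · exact locallyIntegrable_of_modular_le hη hmeas hIF hc hR (hmodF s₀ hs₀pos hs₀le)
  -- Every finite `b > B ‖f‖_p` is admissible in the infimum, through the scale `b / B`; this also
  -- covers `‖f‖_p = 0`, where `B ‖f‖_p` itself is not admissible.
  · refine le_of_forall_gt_imp_ge_of_dense fun b hb => ?_
    rcases eq_or_ne b ∞ with rfl | hbt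
    · exact le_top
    have hb0 : 0 < b.toReal := ENNReal.toReal_pos (pos_of_gt hb).ne' hbt
    have hle : eLpNorm f (ENNReal.ofReal p) m ≤ ENNReal.ofReal (b.toReal / B) := by
      rw [ENNReal.ofReal_div_of_pos hB, ENNReal.ofReal_toReal hbt,
        ENNReal.le_div_iff_mul_le (Or.inl (by simpa using hB)) (Or.inl ENNReal.ofReal_ne_top),
        mul_comm]
      exact hb.le
    have h1 := hmodI (b.toReal / B) (by positivity) hle
    rw [mul_div_cancel₀ _ hB.ne'] at h1
    exact (iInf₂_le b.toReal ⟨hb0, h1⟩).trans (ENNReal.ofReal_toReal hbt).le
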